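/- Let $G$ be a non-elementary (i.e. not virtually cyclic) Gromov-hyperbolic group, let $\Gamma$ be its Cayley graph with respect to a finite symmetric generating set, with word metric $d$, edge set $E$, identity vertex $1$, and Gromov boundary $\partial G$. Let $\rho$ be a probability measure on $[0,\infty)$ without atoms such that $\int e^{ax}\,d\rho(x)<\infty$ for some $a>0$, and let $\Omega=[0,\infty)^E$ with the product measure $\mathbb P=\rho^{\otimes E}$. For $\omega\in\Omega$ let $d_\omega(x,y)=\inf_{\gamma:x\to y}\sum_{e\in\gamma}\omega(e)$; an $\omega$-geodesic is an edge path realizing $d_\omega$ between its endpoints, and an $\omega$-geodesic ray is a semi-infinite edge path all of whose finite subpaths are $\omega$-geodesics. Such a ray has direction $\xi\in\partial G$ if $\xi$ is its only accumulation point in $\partial G$. The forward tree $F(1,\omega)$ is the union of all $\omega$-geodesics $[1,g]_\omega$, $g\in G$. For $\xi\in\partial G$, let $\Omega_\xi$ be the set of $\omega$ for which from every $g\in G$ there is exactly one $\omega$-geodesic ray $[g,\xi)_\omega$ in direction $\xi$, and any two of these rays coalesce (agree from some point on); the backward tree $T(\xi,\omega)$ is the union of all $\omega$-geodesic rays in direction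 $\xi$, that is, $\bigcup_{g}[g,\xi)_\omega$ when $\omega\in\Omega_\xi$. Both carry their intrinsic simplicial metric (unit edge lengths) and the base-point $1$. A base-pointed embedding of hyperbolic spaces $i:(Y,y_0)\to(X,x_0)$ is proper if there is $M:\mathbb N\to\mathbb N$ with $M(n)\to\infty$ such that $d_Y(y_0,y)\ge n$ implies $d_X(x_0,i(y))\ge M(n)$. It is 2-proper if there is $M':\mathbb N\to\mathbb N$ with $M'(n)\to\infty$ such that for all $y_1,y_2\in Y$ and all geodesics, $d_Y(y_0,[y_1,y_2]_Y)\ge n$ implies $d_X(x_0,[i(y_1),i(y_2)]_X)\ge M'(n)$. A Cannon–Thurston map for $i$ is a continuous extension $\widehat Y\to\widehat X$ of $i$ to the Gromov compactifications. **Theorem.** There is a measurable set $\Omega_0\subset\Omega$ with $\mathbb P(\Omega_0)=1$ such that the following hold. 1. For every $\omega\in\Omega_0$, $F(1,\omega)$ is a tree, and its inclusion into $\Gamma$ is proper and 2-proper and admits a Cannon–Thurston map whose boundary value $\partial F(1,\omega)\to\partial G$ is surjective. 2. For every $\xi\in\partial G$, $\mathbb P(\Omega_\xi)=1$, and for every $\omega\in\Omega_0\cap\Omega_\xi$,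 $T(\xi,\omega)$ is a tree, and its inclusion into $\Gamma$ is proper and 2-proper and admits a Cannon–Thurston map whose boundary value $\partial T(\xi,\omega)\to\partial G$ is surjective. -/

import Mathlib

open MeasureTheory Filter Topology
open scoped NNReal

/-! ### Hyperbolic graphs, Gromov boundary and Gromov compactification

A connected graph is regarded as a metric space through its vertex set with the graph metric
`SimpleGraph.dist` (for a Cayley graph: the word metric). -/

namespace HypGraph

variable {V W : Type*}

/-- The Gromov product `(x|y)_o` in the graph metric. -/
noncomputable def gromovProduct (H : SimpleGraph V) (o x y : V) : ℝ :=
  ((H.dist o x : ℝ) + H.dist o y - H.dist x y) / 2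

/-- Gromov hyperbolicity: `(x|z)_w ≥ min ((x|y)_w, (y|z)_w) - δ` for some constant `δ`. -/
def IsHyperbolic (H : SimpleGraph V) : Prop :=
  H.Connected ∧ ∃ δ : ℝ, ∀ w x y z : V,
    min (gromovProduct H w x y) (gromovProduct H w y z) - δ ≤ gromovProduct H w x z

/-- Geodesic rays of the graph metric (from an arbitrary starting vertex). -/
structure GeodesicRay (H : SimpleGraph V) where
  /-- the sequence of vertices of the ray -/
  toFun : ℕ → V
  dist_eq : ∀ m k : ℕ, H.dist (toFun m) (toFun (m + k)) = k

/-- Two geodesic rays are asymptotic if they stay at bounded distance from each other. -/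
def rayAsymptotic (H : SimpleGraph V) : Setoid (GeodesicRay H) where
  r γ γ' := ∃ C : ℕ, ∀ n, H.edist (γ.toFun n) (γ'.toFun n) ≤ C
  iseqv :=
    { refl := fun γ => ⟨0, fun n => by simp⟩
      symm := fun ⟨C, h⟩ => ⟨C, fun n => by rw [SimpleGraph.edist_comm]; exact h n⟩
      trans := fun ⟨C, h⟩ ⟨C', h'⟩ => ⟨C + C', fun n => by
        push_cast
        exact (SimpleGraph.edist_triangle).trans (add_le_add (h n) (h' n))⟩ }

/-- The Gromov boundary: asymptote classes of geodesic rays. -/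
def Boundary (H : SimpleGraph V) : Type _ := Quotient (rayAsymptotic H)

/-- The endpoint at infinity of a geodesic ray. -/
def GeodesicRay.endpoint {H : SimpleGraph V} (γ : GeodesicRay H) : Boundary H :=
  Quotient.mk (rayAsymptotic H) γ

/-- The Gromov compactification `V ∪ ∂H`; the base-point `o` only serves to write down
the topology. -/
inductive Compactification (H : SimpleGraph V) (_o : V) : Type _
  | vertex (v : V)
  | bdry (ξ : Boundary H)

/-- A sequence of vertices that represents a point of the compactification: the constant sequence
at a vertex, or a geodesic ray in the class of a boundary point. -/
def Represents {H : SimpleGraph V} {o : V} (u : ℕ → V) : Compactification H o → Prop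
  | .vertex v => ∀ n, u n = v
  | .bdry ξ => ∃ γ : GeodesicRay H, γ.endpoint = ξ ∧ γ.toFun = u

/-- The basic neighbourhood `U(ξ, R)` of a boundary point: all points `η` such that, for some
representing sequences, `(γ i|u j)_o ≥ R` for all large `i`, `j`. -/
def basicNhd {H : SimpleGraph V} (o : V) (ξ : Boundary H) (R : ℝ) : Set (Compactification H o) :=
  {η | ∃ γ : GeodesicRay H, γ.endpoint = ξ ∧ ∃ u : ℕ → V, Represents u η ∧
    ∃ N : ℕ, ∀ i j, N ≤ i → N ≤ j → R ≤ gromovProduct H o (γ.toFun i) (u j)}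

/-- The topology of the Gromov compactification: vertices are isolated, and a set is
open when with each of its boundary points `ξ` it contains some `U(ξ, R)`. -/
instance (H : SimpleGraph V) (o : V) : TopologicalSpace (Compactification H o) where
  IsOpen U := ∀ ξ : Boundary H, Compactification.bdry ξ ∈ U → ∃ R : ℝ, basicNhd o ξ R ⊆ U
  isOpen_univ := fun _ _ => ⟨0, Set.subset_univ _⟩
  isOpen_inter := by
    intro U U' hU hU' ξ hξ
    obtain ⟨R, hR⟩ := hU ξ hξ.1
    obtain ⟨R', hR'⟩ := hU' ξ hξ.2
    refine ⟨max R R', fun η hη => ?_⟩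
    obtain ⟨γ, hγ, u, hu, N, hN⟩ := hη
    exact ⟨hR ⟨γ, hγ, u, hu, N, fun i j hi hj => (le_max_left _ _).trans (hN i j hi hj)⟩,
      hR' ⟨γ, hγ, u, hu, N, fun i j hi hj => (le_max_right _ _).trans (hN i j hi hj)⟩⟩
  isOpen_sUnion := by
    intro s hs ξ hξ
    obtain ⟨U, hU, hξU⟩ := hξ
    obtain ⟨R, hR⟩ := hs U hU ξ hξU
    exact ⟨R, hR.trans (Set.subset_sUnion_of_mem hU)⟩

/-! ### Proper and 2-proper embeddings, Cannon-Thurston maps -/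

/-- An injective graph homomorphism `f : (H, o) → (K, f o)` is a proper embedding if
`d_H(o, y) ≥ n` implies `d_K(f o, f y) ≥ M n` for some `M : ℕ → ℕ` tending to infinity. -/
def IsProperEmbedding {H : SimpleGraph V} {K : SimpleGraph W} (f : H →g K) (o : V) : Prop :=
  Function.Injective f ∧ ∃ M : ℕ → ℕ, Tendsto M atTop atTop ∧
    ∀ (n : ℕ) (y : V), n ≤ H.dist o y → M n ≤ K.dist (f o) (f y)

/-- A walk realizing the graph distance of its endpoints. -/
def IsWordGeodesic {H : SimpleGraph V} {x y : V} (p : H.Walk x y) : Prop :=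
  p.length = H.dist x y

/-- `f` is 2-proper: for some `M : ℕ → ℕ` tending to infinity, if a geodesic `[y₁, y₂]` of `H` is at
distance at least `n` from `o`, then every geodesic `[f y₁, f y₂]` of `K` is at distance at least
`M n` from `f o`. -/
def IsTwoProper {H : SimpleGraph V} {K : SimpleGraph W} (f : H →g K) (o : V) : Prop :=
  ∃ M : ℕ → ℕ, Tendsto M atTop atTop ∧
    ∀ (n : ℕ) (y₁ y₂ : V) (p : H.Walk y₁ y₂) (q : K.Walk (f y₁) (f y₂)),
      IsWordGeodesic p → IsWordGeodesic q →
      (∀ v ∈ p.support, n ≤ H.dist o v) → ∀ w ∈ q.support, M n ≤ K.dist (f o) w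

/-- A Cannon-Thurston map for `f`: a continuous extension of `f` to the Gromov
compactifications. -/
def IsCannonThurstonMap {H : SimpleGraph V} {K : SimpleGraph W} (f : H →g K) (o : V)
    (F : Compactification H o → Compactification K (f o)) : Prop :=
  Continuous F ∧ ∀ v : V, F (.vertex v) = .vertex (f v)

/-- `φ : ∂H → ∂K` is the boundary value of the map `F` between the compactifications. -/
def IsBoundaryValue {H : SimpleGraph V} {K : SimpleGraph W} {o : V} {o' : W}
    (F : Compactification H o → Compactification K o') (φ : Boundary H → Boundary K) : Prop :=
  ∀ η : Boundary H, F (.bdry η) = .bdry (φ η)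

end HypGraph

/-! ### First passage percolation -/

namespace FPP

open HypGraph

variable {V : Type*}

/-- The configuration space `[0, ∞)^E` of the edge set `E` of `Γ`. -/
abbrev Config (Γ : SimpleGraph V) : Type _ := Γ.edgeSet → ℝ≥0

/-- The product measure `ρ^{⊗ E}`: the edge lengths are i.i.d. with law `ρ`. -/
noncomputable def law (Γ : SimpleGraph V) (ρ : Measure ℝ≥0) [IsProbabilityMeasure ρ] :
    Measure (Config Γ) :=
  Measure.infinitePi (fun _ : Γ.edgeSet => ρ)

/-- The sum of the edge lengths along a walk. -/
def passageTime {Γ : SimpleGraph V} (ω : Config Γ) {x y : V} (p : Γ.Walk x y) : ℝ≥0 :=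
  (p.darts.map fun d => ω ⟨d.edge, d.edge_mem⟩).sum

/-- The first passage metric `d_ω`. -/
noncomputable def fppDist {Γ : SimpleGraph V} (ω : Config Γ) (x y : V) : ℝ≥0 :=
  ⨅ p : Γ.Walk x y, passageTime ω p

/-- `ω`-geodesics between two vertices. -/
def IsFPPGeodesic {Γ : SimpleGraph V} (ω : Config Γ) {x y : V} (p : Γ.Walk x y) : Prop :=
  passageTime ω p = fppDist ω x y

/-- `ω`-geodesic rays: semi-infinite edge paths all of whose finite subpaths are `ω`-geodesics. -/
def IsFPPRay {Γ : SimpleGraph V} (ω : Config Γ) (σ : ℕ → V) : Prop :=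
  ∃ h : ∀ n, Γ.Adj (σ n) (σ (n + 1)), ∀ m n, m ≤ n →
    ∑ i ∈ Finset.Ico m n, ω ⟨s(σ i, σ (i + 1)), h i⟩ = fppDist ω (σ m) (σ n)

/-- The path `σ` accumulates on `ξ`: some sequence of vertices of `σ` converges to `ξ` in
the Gromov compactification. -/
def AccumulatesOn {Γ : SimpleGraph V} (o : V) (σ : ℕ → V) (ξ : Boundary Γ) : Prop :=
  ∃ v : ℕ → V, (∀ n, v n ∈ Set.range σ) ∧
    Tendsto (fun n => (Compactification.vertex (v n) : Compactification Γ o)) atTop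
      (𝓝 (Compactification.bdry ξ))

/-- The path `σ` has direction `ξ`: `ξ` is its only accumulation point in the boundary. -/
def HasDirection {Γ : SimpleGraph V} (o : V) (σ : ℕ → V) (ξ : Boundary Γ) : Prop :=
  ∀ ξ' : Boundary Γ, AccumulatesOn o σ ξ' ↔ ξ' = ξ

/-- Two paths coalesce if they agree from some point on. -/
def Coalesce (σ τ : ℕ → V) : Prop := ∃ a b : ℕ, ∀ n, σ (a + n) = τ (b + n)

/-- The event `Ω_ξ` on which every vertex `v` is the starting point of a unique `ω`-geodesic ray
`[v, ξ)_ω` in direction `ξ`, and any two of these rays coalesce. -/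
def coalescenceEvent {Γ : SimpleGraph V} (o : V) (ξ : Boundary Γ) : Set (Config Γ) :=
  {ω | (∀ v : V, ∃! σ : ℕ → V, σ 0 = v ∧ IsFPPRay ω σ ∧ HasDirection o σ ξ) ∧
    ∀ σ τ : ℕ → V, IsFPPRay ω σ → HasDirection o σ ξ → IsFPPRay ω τ → HasDirection o τ ξ →
      Coalesce σ τ}

/-- The forward tree `F(o, ω)`: all vertices, and the edges of all `ω`-geodesics `[o, g]_ω`. -/
def forwardTree {Γ : SimpleGraph V} (o : V) (ω : Config Γ) : SimpleGraph V where
  Adj u v := ∃ (g : V) (p : Γ.Walk o g), IsFPPGeodesic ω p ∧ s(u, v) ∈ p.edges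
  symm := ⟨fun _ _ ⟨g, p, hp, h⟩ => ⟨g, p, hp, Sym2.eq_swap ▸ h⟩⟩
  loopless := ⟨fun _ ⟨_, p, _, h⟩ => (p.adj_of_mem_edges h).ne rfl⟩

/-- The backward tree `T(ξ, ω)`: all vertices, and the edges of all `ω`-geodesic rays `[g, ξ)_ω`
in direction `ξ` (on `coalescenceEvent` there is exactly one from each vertex). -/
def backwardTree {Γ : SimpleGraph V} (o : V) (ξ : Boundary Γ) (ω : Config Γ) :
    SimpleGraph V where
  Adj u v := ∃ σ : ℕ → V, IsFPPRay ω σ ∧ HasDirection o σ ξ ∧ ∃ n, s(u, v) = s(σ n, σ (n + 1))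
  symm := ⟨fun _ _ ⟨σ, h, h', n, e⟩ => ⟨σ, h, h', n, Sym2.eq_swap.trans e⟩⟩
  loopless := ⟨fun u ⟨σ, ⟨h, _⟩, _, n, e⟩ => by
    have h1 := h n
    rw [← SimpleGraph.mem_edgeSet, ← e, SimpleGraph.mem_edgeSet] at h1
    exact h1.ne rfl⟩

theorem forwardTree_le {Γ : SimpleGraph V} (o : V) (ω : Config Γ) : forwardTree o ω ≤ Γ :=
  fun _ _ ⟨_, p, _, h⟩ => p.adj_of_mem_edges h

theorem backwardTree_le {Γ : SimpleGraph V} (o : V) (ξ : Boundary Γ) (ω : Config Γ) :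
    backwardTree o ξ ω ≤ Γ := by
  rintro u v ⟨σ, ⟨h, _⟩, _, n, e⟩
  rw [← SimpleGraph.mem_edgeSet, e]
  exact h n

/-- The inclusion of the forward tree into the graph (the identity on vertices). -/
def forwardInclusion {Γ : SimpleGraph V} (o : V) (ω : Config Γ) : forwardTree o ω →g Γ :=
  SimpleGraph.Hom.ofLE (forwardTree_le o ω)

/-- The inclusion of the backward tree into the graph (the identity on vertices). -/
def backwardInclusion {Γ : SimpleGraph V} (o : V) (ξ : Boundary Γ) (ω : Config Γ) :
    backwardTree o ξ ω →g Γ :=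
  SimpleGraph.Hom.ofLE (backwardTree_le o ξ ω)

/-- The Cayley graph of `G` for the finite set `S`: `g` and `g * s` are joined by an edge for every
`s ∈ S` (no loops are drawn). -/
abbrev cayleyGraph {G : Type*} [Group G] (S : Finset G) : SimpleGraph G :=
  SimpleGraph.mulCayley (S : Set G)

/-- A hyperbolic group is elementary if it is virtually cyclic (which includes finite groups). -/
def IsElementary (G : Type*) [Group G] : Prop :=
  ∃ H : Subgroup G, H.FiniteIndex ∧ IsCyclic H

end FPP

open HypGraph FPP

/-! Everything is deduced from two almost sure properties of $\omega$. It is generic: distinct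
finite edge sets have distinct total lengths, so edge lengths are positive and $\omega$-geodesics
are unique. And it is coarse from some scale on: the vertices of the ball of radius $s$ have
$d_\omega(o,\cdot)\le Cs$, whereas self-avoiding paths of $As$ edges from that ball cost more than
$2Cs$. Hence an $\omega$-geodesic takes at most $As$ steps between two of its points in the ball of
radius $s$.

The geometric core, `ShortExcursions.le_gromovProduct`, says that a path with this property which
stays outside the ball of radius $s$ has endpoints with Gromov product at least $(1-\varepsilon)s$.
In a hyperbolic space a path of length $n$ outside a ball of radius $m$ has Gromov product at least
$m-O(\log n)$. This is applied to the part of the path near its closest point to $o$; the remaining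
tails lie outside a ball of twice the radius, and induction treats them with room to spare.

Both trees are given by a parent map whose orbits, stopped before $o$, are $\omega$-geodesics. A
tree geodesic $[x,y]$ contains the orbits of $x$ and $y$ up to a common ancestor. If it is far from
$o$, both orbits avoid a large ball, and $(x|y)_o$ is large in $\Gamma$. This single property,
`GromovTwoProper`, gives 2-properness and, since it carries large Gromov products in the tree to
large ones in $\Gamma$, the Cannon–Thurston map. The map is surjective because the tree spans: tree
geodesics from $o$ to the points of a word ray subconverge to a tree ray with the same limit.
Properness needs only finiteness of balls.

For $\mathbb P(\Omega_\xi)=1$, fix a word ray $\gamma$ to $\xi$. A barrier at $\gamma(N)$ makes the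
$2L$ central edges of $\gamma$ cheap and all other nearby edges expensive but bounded. A ray towards
$\xi$ has to cross the ball of radius $L$ there, and by comparison of costs it must visit
$\gamma(N)$ (`Barrier.exists_eq`). Barriers around well separated centres are nearly independent and
have probability bounded below, so Borel–Cantelli yields infinitely many of them. Two rays that meet
on $\gamma$ infinitely often coalesce by uniqueness of geodesics.

The probabilistic input is a union bound with Chernoff estimates: exponential moments for the upper
bound on $d_\omega$, absence of an atom at $0$ for the lower bound on paths. To keep the coarse
estimates independent of a barrier, `goodSet` replaces the lengths inside the barrier by
deterministic bounds. -/

/-! ### Gromov products -/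

namespace HypGraph

variable {V : Type*}

/-- The four-point inequality with constant `δ ≥ 0`. -/
def HasDelta (H : SimpleGraph V) (δ : ℝ) : Prop :=
  0 ≤ δ ∧ ∀ w x y z : V,
    min (gromovProduct H w x y) (gromovProduct H w y z) - δ ≤ gromovProduct H w x z

theorem IsHyperbolic.exists_hasDelta {H : SimpleGraph V} (h : IsHyperbolic H) :
    ∃ δ, HasDelta H δ := by
  obtain ⟨-, δ, hδ⟩ := h
  exact ⟨max δ 0, le_max_right _ _, fun w x y z =>
    (sub_le_sub_left (le_max_left _ _) _).trans (hδ w x y z)⟩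

section

variable {H : SimpleGraph V} {o : V} {δ : ℝ}

theorem gromovProduct_comm (x y : V) : gromovProduct H o x y = gromovProduct H o y x := by
  unfold gromovProduct
  rw [H.dist_comm (u := x) (v := y)]
  ring

theorem HasDelta.chain (hδ : HasDelta H δ) {x y z : V} {c : ℝ}
    (h₁ : c ≤ gromovProduct H o x y) (h₂ : c ≤ gromovProduct H o y z) :
    c - δ ≤ gromovProduct H o x z :=
  (sub_le_sub_right (le_min h₁ h₂) _).trans (hδ.2 o x y z)

theorem dist_triangle_real (hc : H.Connected) (x y z : V) :
    (H.dist x z : ℝ) ≤ H.dist x y + H.dist y z := by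
  exact_mod_cast hc.dist_triangle

theorem gromovProduct_self (x : V) : gromovProduct H o x x = H.dist o x := by
  simp [gromovProduct]

theorem gromovProduct_le_left (hc : H.Connected) (x y : V) :
    gromovProduct H o x y ≤ H.dist o x := by
  have := dist_triangle_real hc o x y
  unfold gromovProduct
  linarith

theorem gromovProduct_le_right (hc : H.Connected) (x y : V) :
    gromovProduct H o x y ≤ H.dist o y := by
  rw [gromovProduct_comm]
  exact gromovProduct_le_left hc y x

theorem gromovProduct_ge_left (hc : H.Connected) (x y : V) :
    (H.dist o x : ℝ) - H.dist x y ≤ gromovProduct H o x y := by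
  have := dist_triangle_real hc o y x
  rw [H.dist_comm (u := y)] at this
  unfold gromovProduct
  linarith

/-- Moving the base-point by a distance `c` changes the Gromov product by at most `c`. -/
theorem gromovProduct_base_sub_le (hc : H.Connected) (o' x y : V) :
    gromovProduct H o x y - H.dist o o' ≤ gromovProduct H o' x y := by
  have h₁ := dist_triangle_real hc o o' x
  have h₂ := dist_triangle_real hc o o' y
  unfold gromovProduct
  linarith

/-- The base-point is at distance at least `(x|y)` from every point of a geodesic `[x, y]`. -/
theorem gromovProduct_le_dist_of_mem_geodesic (hc : H.Connected) {x y w : V} {p : H.Walk x y}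
    (hp : IsWordGeodesic p) (hw : w ∈ p.support) : gromovProduct H o x y ≤ H.dist o w := by
  classical
  have h₁ := H.dist_le (p.takeUntil w hw)
  have h₂ := H.dist_le (p.dropUntil w hw)
  have h₃ : (p.takeUntil w hw).length + (p.dropUntil w hw).length = p.length := by
    rw [← SimpleGraph.Walk.length_append, SimpleGraph.Walk.take_spec]
  have h₄ : (H.dist x w : ℝ) + H.dist w y ≤ H.dist x y := by
    have : H.dist x w + H.dist w y ≤ H.dist x y := by
      rw [← hp]; omega
    exact_mod_cast this
  have h₅ := dist_triangle_real hc o w x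
  have h₆ := dist_triangle_real hc o w y
  rw [H.dist_comm (u := w) (v := x)] at h₅
  unfold gromovProduct
  linarith

/-! ### Paths outside balls: logarithmic loss and short excursions. -/

/-- A path of length at most `2 ^ k` that stays outside the ball of radius `r` has endpoints
with large Gromov product. -/
theorem HasDelta.sub_le_gromovProduct_of_path (hδ : HasDelta H δ) {σ : ℕ → V} {r : ℝ}
    (k : ℕ) : ∀ a b : ℕ, a ≤ b → b ≤ a + 2 ^ k →
      (∀ i, a ≤ i → i < b → H.Adj (σ i) (σ (i + 1))) →
      (∀ i, a ≤ i → i ≤ b → r ≤ H.dist o (σ i)) →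
      r - 1 / 2 - k * δ ≤ gromovProduct H o (σ a) (σ b) := by
  induction k with
  | zero =>
    intro a b hab hb hadj hr
    have h₁ := hr a le_rfl hab
    have h₂ := hr b hab le_rfl
    have h₃ : (H.dist (σ a) (σ b) : ℝ) ≤ 1 := by
      rcases hab.eq_or_lt with rfl | hlt
      · simp
      · obtain rfl : b = a + 1 := by simp at hb; omega
        rw [SimpleGraph.dist_eq_one_iff_adj.2 (hadj a le_rfl (by omega))]
        simp
    unfold gromovProduct
    push_cast
    linarith
  | succ k ih =>
    intro a b hab hb hadj hr
    have h2k : 2 ^ (k + 1) = 2 ^ k + 2 ^ k := by ring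
    -- Bisection: each halving costs one $\delta$, and a single edge outside the ball costs $1/2$.
    obtain ⟨c, hac, hcb, hc₁, hc₂⟩ : ∃ c, a ≤ c ∧ c ≤ b ∧ c ≤ a + 2 ^ k ∧ b ≤ c + 2 ^ k := by
      by_cases h : b ≤ a + 2 ^ k
      · exact ⟨b, hab, le_rfl, h, by omega⟩
      · exact ⟨a + 2 ^ k, by omega, by omega, le_rfl, by omega⟩
    have h₁ := ih a c hac hc₁ (fun i hi hi' => hadj i hi (by omega))
      (fun i hi hi' => hr i hi (by omega))
    have h₂ := ih c b hcb hc₂ (fun i hi hi' => hadj i (by omega) hi')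
      (fun i hi hi' => hr i (by omega) hi')
    have := hδ.chain h₁ h₂
    push_cast
    linarith

/-- The path `σ` on the interval `[a, b]` makes no long excursions: between two of its points
in a ball of radius `s ≥ s₀` about `o` it takes at most `A * s` steps. -/
def ShortExcursions (H : SimpleGraph V) (o : V) (A s₀ : ℕ) (σ : ℕ → V) (a b : ℕ) : Prop :=
  ∀ s, s₀ ≤ s → ∀ i j, a ≤ i → i ≤ j → j ≤ b →
    H.dist o (σ i) ≤ s → H.dist o (σ j) ≤ s → j - i ≤ A * s

theorem ShortExcursions.mono {A s₀ a b a' b' : ℕ} {σ : ℕ → V}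
    (h : ShortExcursions H o A s₀ σ a b) (ha : a ≤ a') (hb : b' ≤ b) :
    ShortExcursions H o A s₀ σ a' b' :=
  fun s hs i j hi hij hj => h s hs i j (ha.trans hi) hij (hj.trans hb)

/-- The threshold `s₀` is large with respect to `δ`, `A` and `ε`. -/
def LargeThreshold (δ ε : ℝ) (A s₀ : ℕ) : Prop :=
  0 ≤ ε ∧ ∀ m : ℕ, s₀ ≤ m →
    δ * Nat.clog 2 (A * (2 * m)) + 4 * δ + 1 / 2 ≤ ε * m ∧ 4 * δ + 1 / 2 ≤ (1 - ε) * m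

theorem LargeThreshold.mono {ε : ℝ} {A s₀ s₁ : ℕ} (h : LargeThreshold δ ε A s₀) (hs : s₀ ≤ s₁) :
    LargeThreshold δ ε A s₁ :=
  ⟨h.1, fun m hm => h.2 m (hs.trans hm)⟩

/-- The logarithm is sublinear. The argument $A\cdot 2m$ is the number of steps that a path with
short excursions can spend between its visits to the ball of radius $2m$. -/
theorem exists_largeThreshold (δ : ℝ) {ε : ℝ} (hε : 0 < ε) (hε1 : ε < 1) (A : ℕ) :
    ∃ s₀, LargeThreshold δ ε A s₀ := by
  have h₁ : Tendsto (fun m : ℕ => (m : ℝ)) atTop atTop := tendsto_natCast_atTop_atTop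
  have h₂ : ∀ᶠ m : ℕ in atTop, 4 * δ + 1 / 2 ≤ (1 - ε) * m :=
    (h₁.const_mul_atTop (by linarith : 0 < 1 - ε)).eventually_ge_atTop _
  have h₃ : ∀ᶠ m : ℕ in atTop, |δ| * Nat.clog 2 (A * (2 * m)) + 4 * |δ| + 1 / 2 ≤ ε * m := by
    have hlog : Tendsto (fun m : ℕ => Real.log m / m) atTop (𝓝 0) := by
      have := (Real.isLittleO_log_id_atTop.tendsto_div_nhds_zero).comp h₁
      exact this
    have h0 : Tendsto (fun m : ℕ => (1 : ℝ) / m) atTop (𝓝 0) :=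
      tendsto_one_div_atTop_nhds_zero_nat
    have key : Tendsto (fun m : ℕ => |δ| / Real.log 2 * (Real.log m / m) +
        (|δ| * (Real.log (2 * (A + 1)) / Real.log 2 + 1) + 4 * |δ| + 1 / 2) * (1 / m))
        atTop (𝓝 0) := by
      simpa using (hlog.const_mul (|δ| / Real.log 2)).add
        (h0.const_mul (|δ| * (Real.log (2 * (A + 1)) / Real.log 2 + 1) + 4 * |δ| + 1 / 2))
    filter_upwards [key.eventually_lt_const hε, eventually_gt_atTop 0] with m hm hm0
    have hm0' : (0 : ℝ) < m := by exact_mod_cast hm0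
    have hc : (Nat.clog 2 (A * (2 * m)) : ℝ) ≤
        Real.log m / Real.log 2 + (Real.log (2 * (A + 1)) / Real.log 2 + 1) := by
      have h1 : Nat.clog 2 (A * (2 * m)) ≤ Nat.log 2 (2 * (A + 1) * m) + 1 := by
        refine (Nat.clog_mono_right 2 (?_ : _ ≤ 2 * (A + 1) * m)).trans ?_
        · nlinarith
        · apply Nat.clog_le_of_le_pow
          exact (Nat.lt_pow_succ_log_self (by norm_num) _).le
      have h2 : (Nat.log 2 (2 * (A + 1) * m) : ℝ) ≤ Real.log ((2 * (A + 1)) * m) / Real.log 2 := by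
        have := Real.natLog_le_logb (2 * (A + 1) * m) 2
        rw [Real.logb] at this
        push_cast at this
        exact this
      have h3 : Real.log ((2 * ((A : ℝ) + 1)) * m) = Real.log (2 * (A + 1)) + Real.log m :=
        Real.log_mul (by positivity) hm0'.ne'
      rw [h3, add_div] at h2
      have : (Nat.clog 2 (A * (2 * m)) : ℝ) ≤ Nat.log 2 (2 * (A + 1) * m) + 1 := by
        exact_mod_cast h1
      linarith
    have h5 := mul_le_mul_of_nonneg_left hc (abs_nonneg δ)
    have h6 := mul_lt_mul_of_pos_right hm hm0'
    have h7 : (|δ| / Real.log 2 * (Real.log m / m) +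
        (|δ| * (Real.log (2 * (A + 1)) / Real.log 2 + 1) + 4 * |δ| + 1 / 2) * (1 / m)) * m =
        |δ| * (Real.log m / Real.log 2) +
        (|δ| * (Real.log (2 * (A + 1)) / Real.log 2 + 1) + 4 * |δ| + 1 / 2) := by
      field_simp
    rw [h7] at h6
    nlinarith
  obtain ⟨s₀, hs₀⟩ := eventually_atTop.1 (h₂.and h₃)
  refine ⟨s₀, hε.le, fun m hm => ⟨le_trans ?_ (hs₀ m hm).2, (hs₀ m hm).1⟩⟩
  have := le_abs_self δ
  have := mul_le_mul_of_nonneg_right this (Nat.cast_nonneg (α := ℝ) (Nat.clog 2 (A * (2 * m))))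
  linarith

/-- A path without long excursions that stays outside a large ball has endpoints with large
Gromov product. -/
theorem ShortExcursions.le_gromovProduct (hδ : HasDelta H δ) {ε : ℝ} {A s₀ : ℕ}
    (hth : LargeThreshold δ ε A s₀) {σ : ℕ → V} : ∀ (n a b s : ℕ), b - a = n → a ≤ b →
    (∀ i, a ≤ i → i < b → H.Adj (σ i) (σ (i + 1))) → ShortExcursions H o A s₀ σ a b →
    s₀ ≤ s → (∀ i, a ≤ i → i ≤ b → s ≤ H.dist o (σ i)) →
    (1 - ε) * s ≤ gromovProduct H o (σ a) (σ b) := by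
  intro n
  induction n using Nat.strong_induction_on with
  | _ n ih =>
  intro a b s hn hab hadj hQ hs hout
  -- The point closest to $o$ sets the scale $m\ge s$; the bound is proved with $m$ in place of $s$.
  obtain ⟨c, hc, hcmin⟩ := Finset.exists_min_image (Finset.Icc a b) (fun i => H.dist o (σ i))
    ⟨a, by simp [hab]⟩
  rw [Finset.mem_Icc] at hc
  set m := H.dist o (σ c) with hm
  have hmin : ∀ i, a ≤ i → i ≤ b → m ≤ H.dist o (σ i) := fun i h h' =>
    hcmin i (Finset.mem_Icc.2 ⟨h, h'⟩)
  have hsm : s ≤ m := hout c hc.1 hc.2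
  obtain ⟨hm₁, hm₂⟩ := hth.2 m (hs.trans hsm)
  have hδ0 := hδ.1
  have hε0 := hth.1
  have h1ε : 0 ≤ 1 - ε := by
    by_contra hneg
    push Not at hneg
    have : (1 - ε) * (m : ℝ) ≤ 0 := mul_nonpos_of_nonpos_of_nonneg hneg.le (Nat.cast_nonneg _)
    linarith
  suffices h : (1 - ε) * m ≤ gromovProduct H o (σ a) (σ b) by
    refine le_trans ?_ h
    have : (s : ℝ) ≤ m := by exact_mod_cast hsm
    exact mul_le_mul_of_nonneg_left this h1ε
  -- the first and the last time in the ball of radius `2 m`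
  have hexa : ∃ i, a ≤ i ∧ H.dist o (σ i) ≤ 2 * m := ⟨c, hc.1, by omega⟩
  classical
  obtain ⟨a', ha', ha'min⟩ : ∃ a', (a ≤ a' ∧ a' ≤ c ∧ H.dist o (σ a') ≤ 2 * m) ∧
      ∀ i, a ≤ i → i < a' → 2 * m < H.dist o (σ i) := by
    refine ⟨Nat.find hexa, ⟨(Nat.find_spec hexa).1, Nat.find_min' hexa ⟨hc.1, by omega⟩,
      (Nat.find_spec hexa).2⟩, fun i hi hi' => ?_⟩
    by_contra hcon
    exact Nat.find_min hexa hi' ⟨hi, by omega⟩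
  obtain ⟨b', hb', hb'max⟩ : ∃ b', (c ≤ b' ∧ b' ≤ b ∧ H.dist o (σ b') ≤ 2 * m) ∧
      ∀ i, b' < i → i ≤ b → 2 * m < H.dist o (σ i) := by
    have hP : ∃ k, k ≤ b ∧ H.dist o (σ (b - k)) ≤ 2 * m :=
      ⟨b - c, by omega, by rw [Nat.sub_sub_self hc.2]; omega⟩
    refine ⟨b - Nat.find hP, ⟨?_, by omega, (Nat.find_spec hP).2⟩, fun i hi hi' => ?_⟩
    · have := Nat.find_min' hP
        (m := b - c) ⟨by omega, by rw [Nat.sub_sub_self hc.2]; omega⟩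
      omega
    · by_contra hcon
      have h := Nat.find_spec hP
      refine Nat.find_min hP (m := b - i) (by omega) ⟨by omega, ?_⟩
      rw [Nat.sub_sub_self hi']
      omega
  -- The middle part has at most $2Am$ steps, so its loss is only logarithmic in $m$.
  have hmid : (m : ℝ) - 1 / 2 - Nat.clog 2 (A * (2 * m)) * δ ≤
      gromovProduct H o (σ a') (σ b') := by
    refine hδ.sub_le_gromovProduct_of_path (Nat.clog 2 (A * (2 * m))) a' b' (by omega) ?_
      (fun i hi hi' => hadj i (by omega) (by omega))
      (fun i hi hi' => by exact_mod_cast hmin i (by omega) (by omega))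
    have h₁ := hQ (2 * m) (by omega) a' b' (by omega) (by omega) (by omega) ha'.2.2 hb'.2.2
    have h₂ := Nat.le_pow_clog (b := 2) (by norm_num) (A * (2 * m))
    omega
  -- the two tails
  have hm0 : (0 : ℝ) ≤ m := Nat.cast_nonneg _
  -- The slack $4\delta$ pays for four uses of the four-point inequality, two per tail: one to join
  -- the tail to the edge that enters or leaves the ball of radius $2m$, one to join the result to
  -- the middle part. The induction hypothesis at radius $2m$ has this slack because
  -- $(1-\varepsilon)m\ge 4\delta$.
  have htgt : (1 - ε) * m + 4 * δ ≤ (m : ℝ) - 1 / 2 - Nat.clog 2 (A * (2 * m)) * δ := by linarith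
  have htail : (1 - ε) * m + 4 * δ ≤ (1 - ε) * (2 * m : ℕ) := by push_cast; linarith
  have hstep : ∀ i, a ≤ i → i < b → (m : ℝ) - 1 / 2 ≤ gromovProduct H o (σ i) (σ (i + 1)) := by
    intro i hi hi'
    have h₁ : (m : ℝ) ≤ H.dist o (σ i) := by exact_mod_cast hmin i hi hi'.le
    have h₂ : (m : ℝ) ≤ H.dist o (σ (i + 1)) := by
      exact_mod_cast hmin (i + 1) (by omega) (by omega)
    have h₃ : (H.dist (σ i) (σ (i + 1)) : ℝ) = 1 := by
      rw [SimpleGraph.dist_eq_one_iff_adj.2 (hadj i hi hi')]; simp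
    unfold gromovProduct
    linarith
  have hk : 0 ≤ (Nat.clog 2 (A * (2 * m)) : ℝ) * δ := by positivity
  have hL : (1 - ε) * m + 2 * δ ≤ gromovProduct H o (σ a) (σ b') := by
    rcases ha'.1.eq_or_lt with h | h
    · rw [h]; linarith
    · have h₁ := ih (a' - 1 - a) (by omega) a (a' - 1) (2 * m) rfl (by omega)
        (fun i hi hi' => hadj i hi (by omega)) (hQ.mono le_rfl (by omega)) (by omega)
        (fun i hi hi' => (ha'min i hi (by omega)).le)
      have h₂ := hstep (a' - 1) (by omega) (by omega)
      rw [show a' - 1 + 1 = a' by omega] at h₂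
      have h₃ := hδ.chain (htail.trans h₁) (c := (1 - ε) * m + 4 * δ) (by linarith) (z := σ a')
      have h₄ := hδ.chain (c := (1 - ε) * m + 3 * δ) (by linarith) (by linarith) (x := σ a)
        (y := σ a') (z := σ b')
      linarith
  rcases hb'.2.1.eq_or_lt with h | h
  · rw [← h]; linarith
  · have h₁ := ih (b - (b' + 1)) (by omega) (b' + 1) b (2 * m) rfl (by omega)
      (fun i hi hi' => hadj i (by omega) (by omega)) (hQ.mono (by omega) le_rfl) (by omega)
      (fun i hi hi' => (hb'max i (by omega) hi').le)
    have h₂ := hstep b' (by omega) (by omega)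
    have h₃ := hδ.chain (c := (1 - ε) * m + 2 * δ) hL (z := σ (b' + 1)) (by linarith)
    have h₄ := hδ.chain (c := (1 - ε) * m + δ) (by linarith) (by linarith) (x := σ a)
        (y := σ (b' + 1)) (z := σ b)
    linarith

end

end HypGraph

/-! ### Sequences converging to boundary points, Cannon-Thurston maps of spanning subgraphs -/

namespace HypGraph

variable {V : Type*}

section

variable {H : SimpleGraph V} {o : V} {δ : ℝ}

/-- The Gromov products `(u i|v j)` are eventually at least `R`. -/
def NearAt (H : SimpleGraph V) (o : V) (R : ℝ) (u v : ℕ → V) : Prop :=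
  ∃ N, ∀ i j, N ≤ i → N ≤ j → R ≤ gromovProduct H o (u i) (v j)

theorem NearAt.symm {R : ℝ} {u v : ℕ → V} (h : NearAt H o R u v) : NearAt H o R v u := by
  obtain ⟨N, hN⟩ := h
  exact ⟨N, fun i j hi hj => (hN j i hj hi).trans_eq (gromovProduct_comm _ _)⟩

theorem NearAt.mono {R R' : ℝ} {u v : ℕ → V} (h : NearAt H o R u v) (hR : R' ≤ R) :
    NearAt H o R' u v := by
  obtain ⟨N, hN⟩ := h
  exact ⟨N, fun i j hi hj => hR.trans (hN i j hi hj)⟩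

theorem NearAt.trans (hδ : HasDelta H δ) {R : ℝ} {u v w : ℕ → V} (h : NearAt H o R u v)
    (h' : NearAt H o R v w) : NearAt H o (R - δ) u w := by
  obtain ⟨N, hN⟩ := h
  obtain ⟨N', hN'⟩ := h'
  exact ⟨max N N', fun i j hi hj =>
    hδ.chain (hN i (max N N') (le_of_max_le_left hi) (le_max_left _ _))
      (hN' (max N N') j (le_max_right _ _) (le_of_max_le_right hj))⟩

/-- The sequences `u` and `v` converge to the same point at infinity: their Gromov products tend
to infinity. -/
def Fellow (H : SimpleGraph V) (o : V) (u v : ℕ → V) : Prop :=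
  ∀ R : ℝ, NearAt H o R u v

theorem Fellow.symm {u v : ℕ → V} (h : Fellow H o u v) : Fellow H o v u := fun R => (h R).symm

theorem Fellow.trans (hδ : HasDelta H δ) {u v w : ℕ → V} (h : Fellow H o u v)
    (h' : Fellow H o v w) : Fellow H o u w := fun R => by
  have := (h (R + δ)).trans hδ (h' (R + δ))
  rwa [add_sub_cancel_right] at this

theorem Fellow.nearAt (hδ : HasDelta H δ) {R : ℝ} {u v w : ℕ → V} (h : Fellow H o u v)
    (h' : NearAt H o R v w) : NearAt H o (R - δ) u w :=
  (h R).trans hδ h'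

theorem Fellow.base (hc : H.Connected) {u v : ℕ → V} (h : Fellow H o u v) (o' : V) :
    Fellow H o' u v := fun R => by
  obtain ⟨N, hN⟩ := h (R + H.dist o o')
  refine ⟨N, fun i j hi hj => ?_⟩
  have h₁ := gromovProduct_base_sub_le (o := o) hc o' (u i) (v j)
  have h₂ := hN i j hi hj
  linarith

theorem Fellow.of_dist_le (hδ : HasDelta H δ) (hc : H.Connected) {u v : ℕ → V}
    (hu : Fellow H o u u) (hv : Fellow H o v v) {C : ℕ} (h : ∀ n, H.dist (u n) (v n) ≤ C) :
    Fellow H o u v := fun R => by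
  obtain ⟨N, hN⟩ := hu (R + 2 * δ + C)
  obtain ⟨N', hN'⟩ := hv (R + δ)
  refine ⟨max N N', fun i j hi hj => ?_⟩
  set k := max N N'
  have hC : (H.dist (u k) (v k) : ℝ) ≤ C := by exact_mod_cast h k
  have h₁ := hN i k (le_of_max_le_left hi) (le_max_left _ _)
  have h₂ : R + 2 * δ ≤ gromovProduct H o (u k) (v k) := by
    have h₃ := hN k k (le_max_left _ _) (le_max_left _ _)
    rw [gromovProduct_self] at h₃
    have := gromovProduct_ge_left (o := o) hc (u k) (v k)
    linarith
  have hC0 : (0 : ℝ) ≤ C := Nat.cast_nonneg _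
  have h₃ := hδ.chain (c := R + 2 * δ) (by linarith) h₂ (x := u i)
  have h₄ := hδ.chain (c := R + δ) (by linarith) (hN' k j (le_max_right _ _)
    (le_of_max_le_right hj)) (x := u i)
  linarith

theorem GeodesicRay.dist_of_le (γ : GeodesicRay H) {i j : ℕ} (h : i ≤ j) :
    H.dist (γ.toFun i) (γ.toFun j) = j - i := by
  have := γ.dist_eq i (j - i)
  rwa [Nat.add_sub_cancel' h] at this

theorem GeodesicRay.le_gromovProduct (hc : H.Connected) (γ : GeodesicRay H) {i j n : ℕ}
    (hi : n ≤ i) (hj : n ≤ j) :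
    (n : ℝ) - H.dist o (γ.toFun 0) ≤ gromovProduct H o (γ.toFun i) (γ.toFun j) := by
  wlog hij : i ≤ j generalizing i j
  · rw [gromovProduct_comm]; exact this hj hi (by omega)
  have h₀ := dist_triangle_real hc (γ.toFun 0) o (γ.toFun i)
  have h₁ := dist_triangle_real hc (γ.toFun 0) o (γ.toFun j)
  rw [H.dist_comm (u := γ.toFun 0) (v := o)] at h₀ h₁
  rw [γ.dist_of_le (Nat.zero_le _)] at h₀ h₁
  have h₂ := γ.dist_of_le hij
  have h₃ : (H.dist (γ.toFun i) (γ.toFun j) : ℝ) = j - i := by rw [h₂, Nat.cast_sub hij]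
  have : (n : ℝ) ≤ i := by exact_mod_cast hi
  simp only [Nat.sub_zero] at h₀ h₁
  unfold gromovProduct
  linarith

theorem GeodesicRay.fellow (hc : H.Connected) (γ : GeodesicRay H) :
    Fellow H o γ.toFun γ.toFun := fun R => by
  obtain ⟨n, hn⟩ := exists_nat_ge (R + H.dist o (γ.toFun 0))
  refine ⟨n, fun i j hi hj => ?_⟩
  have := γ.le_gromovProduct (o := o) hc hi hj
  linarith

/-- Translates the definition of the boundary by bounded distance into Gromov products, the only
form in which boundary points are handled afterwards. -/
theorem endpoint_eq_iff_fellow (hδ : HasDelta H δ) (hc : H.Connected) (γ γ' : GeodesicRay H) :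
    γ.endpoint = γ'.endpoint ↔ Fellow H o γ.toFun γ'.toFun := by
  refine (Quotient.eq (r := rayAsymptotic H)).trans ⟨?_, ?_⟩
  · rintro ⟨C, hC⟩
    refine (γ.fellow hc).of_dist_le hδ hc (γ'.fellow hc) (C := C) fun n => ?_
    have := hC n
    rw [← (hc _ _).coe_dist_eq_edist] at this
    exact_mod_cast this
  · intro h
    obtain ⟨N, hN⟩ : ∃ N : ℕ, ∀ n, (H.dist (γ.toFun n) (γ'.toFun n) : ℝ) ≤ N := by
      -- $D$ absorbs the distances from $o$ to the two origins. At time $n$ the Gromov product of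
      -- the rays is at least $n-D-2\delta$, which bounds their distance by $3D+4\delta$.
      set D : ℝ := 2 * H.dist o (γ.toFun 0) + 2 * H.dist o (γ'.toFun 0) with hD
      obtain ⟨N, hN⟩ := exists_nat_ge (3 * D + 4 * δ)
      refine ⟨N, fun n => le_trans ?_ hN⟩
      obtain ⟨M, hM⟩ := h (n - D)
      have h₁ := γ.le_gromovProduct (o := o) hc (i := n) (j := max M n) (n := n) le_rfl
        (le_max_right _ _)
      have h₂ := γ'.le_gromovProduct (o := o) hc (i := max M n) (j := n) (n := n)
        (le_max_right _ _) le_rfl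
      have h₃ := hM (max M n) (max M n) (le_max_left _ _) (le_max_left _ _)
      have n₁ : (0 : ℝ) ≤ H.dist o (γ.toFun 0) := Nat.cast_nonneg _
      have n₂ : (0 : ℝ) ≤ H.dist o (γ'.toFun 0) := Nat.cast_nonneg _
      have h₄ := hδ.chain (c := n - D) (by linarith) h₃
      have h₅ := hδ.chain (c := n - D - δ) h₄ (by linarith [hδ.1])
      have h₆ := dist_triangle_real hc o (γ.toFun 0) (γ.toFun n)
      have h₇ := dist_triangle_real hc o (γ'.toFun 0) (γ'.toFun n)
      rw [γ.dist_of_le (Nat.zero_le _)] at h₆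
      rw [γ'.dist_of_le (Nat.zero_le _)] at h₇
      simp only [Nat.sub_zero] at h₆ h₇
      unfold gromovProduct at h₅
      linarith
    refine ⟨N, fun n => ?_⟩
    rw [← (hc _ _).coe_dist_eq_edist]
    exact_mod_cast hN n

theorem mem_basicNhd_vertex {R : ℝ} {ξ : Boundary H} {v : V} :
    (Compactification.vertex v : Compactification H o) ∈ basicNhd o ξ R ↔
      ∃ γ : GeodesicRay H, γ.endpoint = ξ ∧ NearAt H o R γ.toFun (fun _ => v) := by
  constructor
  · rintro ⟨γ, hγ, u, hu, h⟩
    obtain rfl : u = fun _ => v := funext hu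
    exact ⟨γ, hγ, h⟩
  · rintro ⟨γ, hγ, h⟩
    exact ⟨γ, hγ, fun _ => v, fun _ => rfl, h⟩

theorem mem_basicNhd_bdry {R : ℝ} {ξ ζ : Boundary H} :
    (Compactification.bdry ζ : Compactification H o) ∈ basicNhd o ξ R ↔
      ∃ γ γ' : GeodesicRay H, γ.endpoint = ξ ∧ γ'.endpoint = ζ ∧
        NearAt H o R γ.toFun γ'.toFun := by
  constructor
  · rintro ⟨γ, hγ, u, ⟨γ', hγ', rfl⟩, h⟩
    exact ⟨γ, γ', hγ, hγ', h⟩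
  · rintro ⟨γ, γ', hγ, hγ', h⟩
    exact ⟨γ, hγ, _, ⟨γ', hγ', rfl⟩, h⟩

/-- Convergence of vertices to a boundary point in terms of Gromov products. -/
theorem tendsto_vertex_iff_fellow (hδ : HasDelta H δ) (hc : H.Connected) (γ : GeodesicRay H)
    (v : ℕ → V) :
    Tendsto (fun n => (Compactification.vertex (v n) : Compactification H o)) atTop
      (𝓝 (Compactification.bdry γ.endpoint)) ↔ Fellow H o γ.toFun v := by
  have hf := fun γ₁ γ₂ : GeodesicRay H => (endpoint_eq_iff_fellow (o := o) hδ hc γ₁ γ₂).1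
  constructor
  · intro h R
    obtain ⟨R, rfl⟩ : ∃ R', R = R' - δ := ⟨R + δ, by ring⟩
    set B : Set V := {x | NearAt H o R γ.toFun (fun _ => x)} with hB
    -- The sets `basicNhd` are not open by definition, so an open set is built by hand: the vertices
    -- of $B$, and the boundary points that have all vertices of some basic neighbourhood in $B$.
    -- Passing through an intermediate boundary point costs $2\delta$.
    set O : Set (Compactification H o) := {x | (∃ w ∈ B, x = .vertex w) ∨
      ∃ η, x = .bdry η ∧ ∃ R', ∀ w, Compactification.vertex w ∈ basicNhd o η R' → w ∈ B} with hO
    have hopen : IsOpen O := by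
      intro η hη
      obtain ⟨R', hR'⟩ : ∃ R', ∀ w, Compactification.vertex w ∈ basicNhd o η R' → w ∈ B := by
        rcases hη with ⟨w, -, hw⟩ | ⟨η', h, hR'⟩
        · cases hw
        · cases h; exact hR'
      refine ⟨R' + 2 * δ, ?_⟩
      rintro (w | ζ) hmem
      · obtain ⟨γ₁, hγ₁, hn⟩ := mem_basicNhd_vertex.1 hmem
        exact Or.inl ⟨w, hR' w (mem_basicNhd_vertex.2 ⟨γ₁, hγ₁,
          hn.mono (by linarith [hδ.1])⟩), rfl⟩
      · obtain ⟨γ₁, γ₂, hγ₁, hγ₂, hn⟩ := mem_basicNhd_bdry.1 hmem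
        refine Or.inr ⟨ζ, rfl, R' + 2 * δ, fun w hw => hR' w ?_⟩
        obtain ⟨γ₃, hγ₃, hn'⟩ := mem_basicNhd_vertex.1 hw
        refine mem_basicNhd_vertex.2 ⟨γ₁, hγ₁, ?_⟩
        have h₁ := (hf γ₂ γ₃ (hγ₂.trans hγ₃.symm)).nearAt hδ hn'
        exact ((hn.mono (by linarith [hδ.1])).trans hδ h₁).mono (by linarith)
    have hmem : Compactification.bdry γ.endpoint ∈ O := by
      refine Or.inr ⟨_, rfl, R + δ, fun w hw => ?_⟩
      obtain ⟨γ₁, hγ₁, hn⟩ := mem_basicNhd_vertex.1 hw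
      have := (hf γ γ₁ hγ₁.symm).nearAt hδ hn
      rwa [add_sub_cancel_right] at this
    have hev := h.eventually (hopen.mem_nhds hmem)
    obtain ⟨N, hN⟩ := eventually_atTop.1 hev
    obtain ⟨M, hM⟩ := γ.fellow (o := o) hc R
    refine ⟨max M N, fun i j hi hj => ?_⟩
    rcases hN j (le_of_max_le_right hj) with ⟨w, ⟨K, hK⟩, hw⟩ | ⟨η, hη, -⟩
    · cases hw
      exact hδ.chain (hM i (max M K) (le_of_max_le_left hi) (le_max_left _ _))
        (hK (max M K) K (le_max_right _ _) le_rfl)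
    · cases hη
  · intro h U hU
    obtain ⟨O, hOU, hO, hmem⟩ := mem_nhds_iff.1 hU
    obtain ⟨R, hR⟩ := hO _ hmem
    obtain ⟨N, hN⟩ := h R
    refine mem_map.2 ?_
    filter_upwards [eventually_ge_atTop N] with n hn
    exact hOU (hR ⟨γ, rfl, fun _ => v n, fun _ => rfl, N, fun i j hi hj => hN i n hi hn⟩)

/-! ### Compactness -/

/-- König's lemma for a sequence of paths. -/
theorem exists_cluster_path (p : ℕ → ℕ → V) (hfin : ∀ k, (Set.range fun n => p n k).Finite) :
    ∃ σ : ℕ → V, ∀ k, ∃ᶠ n in atTop, ∀ i ≤ k, p n i = σ i := by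
  let _ : TopologicalSpace V := ⊥
  have : DiscreteTopology V := ⟨rfl⟩
  -- With the discrete topology on $V$ this is a product of finite sets, hence compact. Near a
  -- cluster point in the product topology, finite prefixes coincide.
  have hcomp : IsCompact (Set.univ.pi fun k => Set.range fun n => p n k) :=
    isCompact_univ_pi fun k => (hfin k).isCompact
  obtain ⟨σ, -, hσ⟩ := hcomp.exists_mapClusterPt (f := atTop) (u := p)
    (tendsto_principal.2 (Filter.Eventually.of_forall fun n k _ => ⟨n, rfl⟩))
  refine ⟨σ, fun k => ?_⟩
  have : (Set.pi (Set.Iic k) fun i => {σ i}) ∈ 𝓝 σ :=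
    set_pi_mem_nhds (Set.finite_Iic k) fun i _ => by simp
  exact (hσ.frequently this).mono fun n hn i hi => hn i hi

theorem dist_le_of_chain (σ : ℕ → V) {a b : ℕ} (hab : a ≤ b)
    (h : ∀ i, a ≤ i → i < b → H.Adj (σ i) (σ (i + 1))) : H.dist (σ a) (σ b) ≤ b - a := by
  induction b, hab using Nat.le_induction with
  | base => simp
  | succ b hb ih =>
    have h₁ := ih fun i hi hi' => h i hi (by omega)
    have h₂ := h b hb (by omega)
    have h₃ := h₂.reachable.dist_triangle_right (σ a)
    rw [SimpleGraph.dist_eq_one_iff_adj.2 h₂] at h₃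
    omega

theorem IsWordGeodesic.dist_getVert {x y : V} {p : H.Walk x y} (hp : IsWordGeodesic p)
    {i j : ℕ} (hij : i ≤ j) (hj : j ≤ p.length) :
    H.dist (p.getVert i) (p.getVert j) = j - i := by
  have hadj : ∀ k, k < p.length → H.Adj (p.getVert k) (p.getVert (k + 1)) :=
    fun k hk => p.adj_getVert_succ hk
  have h₁ := dist_le_of_chain p.getVert (Nat.zero_le i) fun k _ hk => hadj k (by omega)
  have h₂ := dist_le_of_chain p.getVert hij fun k _ hk => hadj k (by omega)
  have h₃ := dist_le_of_chain p.getVert hj fun k _ hk => hadj k (by omega)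
  rw [p.getVert_zero] at h₁
  rw [p.getVert_length] at h₃
  have hr : ∀ k, H.Reachable x (p.getVert k) := fun k => ⟨p.take k⟩
  have h₄ := (hr i).dist_triangle_left y
  have h₅ := ((hr i).symm.trans (hr j)).dist_triangle_left y
  unfold IsWordGeodesic at hp
  omega

theorem exists_wordGeodesic (hc : H.Connected) (x y : V) : ∃ p : H.Walk x y, IsWordGeodesic p :=
  hc.exists_walk_length_eq_dist x y

/-- Geodesics from the base-point to a sequence going to infinity accumulate at a ray. -/
theorem exists_ray_of_tendsto (hc : H.Connected) (hb : ∀ r : ℕ, {v | H.dist o v ≤ r}.Finite)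
    {x : ℕ → V} (hx : Tendsto (fun n => H.dist o (x n)) atTop atTop) :
    ∃ γ : GeodesicRay H, ∀ k, ∃ᶠ n in atTop, gromovProduct H o (γ.toFun k) (x n) = k := by
  choose p hp using fun n => exists_wordGeodesic hc o (x n)
  have hlen : ∀ n, (p n).length = H.dist o (x n) := hp
  have hfin : ∀ k, (Set.range fun n => (p n).getVert k).Finite := fun k => by
    refine (hb k).subset ?_
    rintro _ ⟨n, rfl⟩
    change H.dist o ((p n).getVert k) ≤ k
    rcases le_total k (p n).length with h | h
    · have := (hp n).dist_getVert (Nat.zero_le k) h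
      rw [(p n).getVert_zero] at this
      omega
    · rw [(p n).getVert_of_length_le h, ← hlen]; exact h
  obtain ⟨σ, hσ⟩ := exists_cluster_path (fun n k => (p n).getVert k) hfin
  refine ⟨⟨σ, fun m k => ?_⟩, fun k => ?_⟩
  · obtain ⟨n, hn, hn'⟩ := ((hσ (m + k)).and_eventually (hx.eventually_ge_atTop (m + k))).exists
    rw [← hn m (by omega), ← hn (m + k) le_rfl,
      (hp n).dist_getVert (by omega) (by rw [hlen]; exact hn')]
    omega
  · refine ((hσ k).and_eventually (hx.eventually_ge_atTop k)).mono ?_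
    rintro n ⟨hn, hn'⟩
    have h₁ := (hp n).dist_getVert (Nat.zero_le k) (by rw [hlen]; exact hn')
    have h₂ := (hp n).dist_getVert (i := k) (by rw [hlen]; exact hn') le_rfl
    rw [(p n).getVert_zero, hn k le_rfl] at h₁
    rw [(p n).getVert_length, hn k le_rfl, hlen] at h₂
    change gromovProduct H o (σ k) (x n) = k
    unfold gromovProduct
    rw [h₁, h₂, Nat.cast_sub hn', Nat.sub_zero]
    ring

/-- A sequence whose mutual Gromov products tend to infinity converges to the endpoint of a ray. -/
theorem Fellow.exists_ray (hδ : HasDelta H δ) (hc : H.Connected)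
    (hb : ∀ r : ℕ, {v | H.dist o v ≤ r}.Finite) {x : ℕ → V} (hx : Fellow H o x x) :
    ∃ γ : GeodesicRay H, Fellow H o γ.toFun x := by
  have hx' : Tendsto (fun n => H.dist o (x n)) atTop atTop := by
    refine tendsto_atTop.2 fun b => ?_
    obtain ⟨N, hN⟩ := hx b
    filter_upwards [eventually_ge_atTop N] with n hn
    have := hN n n hn hn
    rw [gromovProduct_self] at this
    exact_mod_cast this
  obtain ⟨γ, hγ⟩ := exists_ray_of_tendsto hc hb hx'
  refine ⟨γ, fun R => ?_⟩
  obtain ⟨N, hN⟩ := hx (R + δ)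
  obtain ⟨M, hM⟩ := exists_nat_ge (R + δ)
  refine ⟨max M N, fun i j hi hj => ?_⟩
  obtain ⟨n, hn, hn'⟩ := ((hγ i).and_eventually (eventually_ge_atTop N)).exists
  have hi' : R + δ ≤ (i : ℝ) := hM.trans (by exact_mod_cast le_of_max_le_left hi)
  have := hδ.chain (hi'.trans_eq hn.symm) (hN n j hn' (le_of_max_le_right hj))
  linarith

/-! ### Cannon-Thurston maps -/

/-- Geodesics of the subgraph `T` that are far from `o` have endpoints whose Gromov product in `H`
is large. -/
def GromovTwoProper (T H : SimpleGraph V) (o : V) : Prop :=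
  ∀ R : ℝ, ∃ n : ℕ, ∀ (x y : V) (p : T.Walk x y), IsWordGeodesic p →
    (∀ v ∈ p.support, n ≤ T.dist o v) → R ≤ gromovProduct H o x y

variable {T : SimpleGraph V}

/-- A Gromov product bounds from below the distance from $o$ to a geodesic, so a large product in
$T$ puts a $T$-geodesic far from $o$. -/
theorem GromovTwoProper.le_gromovProduct (hT : T.Connected) (h : GromovTwoProper T H o) (R : ℝ) :
    ∃ n : ℕ, ∀ x y, (n : ℝ) ≤ gromovProduct T o x y → R ≤ gromovProduct H o x y := by
  obtain ⟨n, hn⟩ := h R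
  refine ⟨n, fun x y hxy => ?_⟩
  obtain ⟨p, hp⟩ := exists_wordGeodesic hT x y
  exact hn x y p hp fun v hv => by
    exact_mod_cast hxy.trans (gromovProduct_le_dist_of_mem_geodesic hT hp hv)

theorem GromovTwoProper.fellow (hT : T.Connected) (h : GromovTwoProper T H o) {u v : ℕ → V}
    (huv : Fellow T o u v) : Fellow H o u v := fun R => by
  obtain ⟨n, hn⟩ := h.le_gromovProduct hT R
  obtain ⟨N, hN⟩ := huv n
  exact ⟨N, fun i j hi hj => hn _ _ (hN i j hi hj)⟩

/-- A connected spanning subgraph that satisfies the two-properness condition has a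
Cannon-Thurston map with surjective boundary value. -/
theorem GromovTwoProper.exists_cannonThurstonMap (hδ : HasDelta H δ) (hc : H.Connected)
    (hb : ∀ r : ℕ, {v | H.dist o v ≤ r}.Finite) (hle : T ≤ H) (hT : T.Connected)
    (h : GromovTwoProper T H o) :
    ∃ F φ, IsCannonThurstonMap (SimpleGraph.Hom.ofLE hle) o F ∧ IsBoundaryValue F φ ∧
      Function.Surjective φ := by
  have hdist : ∀ x y, H.dist x y ≤ T.dist x y := fun x y => (hT x y).dist_anti hle
  have hbT : ∀ r : ℕ, {v | T.dist o v ≤ r}.Finite := fun r =>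
    (hb r).subset fun v hv => (hdist o v).trans hv
  have hself : ∀ γ : GeodesicRay T, Fellow H o γ.toFun γ.toFun := fun γ =>
    h.fellow hT (γ.fellow hT)
  choose c hcγ using fun γ : GeodesicRay T => (hself γ).exists_ray hδ hc hb
  have hasym : ∀ γ γ' : GeodesicRay T, γ.endpoint = γ'.endpoint →
      Fellow H o γ.toFun γ'.toFun := fun γ γ' hγ => by
    obtain ⟨C, hC⟩ := (Quotient.eq (r := rayAsymptotic T)).1 hγ
    refine (hself γ).of_dist_le hδ hc (hself γ') (C := C) fun n => ?_
    have := hC n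
    rw [← (hT _ _).coe_dist_eq_edist] at this
    exact (hdist _ _).trans (by exact_mod_cast this)
  have hout : ∀ η : Boundary T, ∃ γ : GeodesicRay T, γ.endpoint = η := Quotient.exists_rep
  choose r hr using hout
  -- A $T$-ray converges in $H$ since its mutual Gromov products tend to infinity, and asymptotic
  -- $T$-rays have the same limit. So $\varphi$ does not depend on the chosen representative, as
  -- `hφγ` records.
  set φ : Boundary T → Boundary H := fun η => (c (r η)).endpoint with hφ
  have hφγ : ∀ γ : GeodesicRay T, Fellow H o (c (r γ.endpoint)).toFun γ.toFun := fun γ =>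
    (hcγ _).trans hδ (hasym _ _ (hr _))
  let F : Compactification T o → Compactification H (SimpleGraph.Hom.ofLE hle o) := fun x =>
    match x with
    | .vertex v => .vertex v
    | .bdry η => .bdry (φ η)
  refine ⟨F, φ, ⟨?_, fun v => rfl⟩, fun η => rfl, ?_⟩
  · refine ⟨fun U hU => ?_⟩
    intro η hη
    obtain ⟨R, hR⟩ := hU (φ η) hη
    -- Each replacement of a $T$-ray by the $H$-ray with the same limit costs $\delta$; a
    -- neighbourhood relation between two boundary points needs two of them.
    obtain ⟨n, hn⟩ := h.le_gromovProduct hT (R + 2 * δ)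
    refine ⟨n, ?_⟩
    rintro x ⟨γ, rfl, u, hu, N, hN⟩
    have hnear : NearAt H o (R + 2 * δ) γ.toFun u := ⟨N, fun i j hi hj => hn _ _ (hN i j hi hj)⟩
    have hnear' := (hφγ γ).nearAt hδ hnear
    apply hR
    cases x with
    | vertex v =>
      obtain rfl : u = fun _ => v := funext hu
      exact mem_basicNhd_vertex.2 ⟨_, rfl, hnear'.mono (by linarith [hδ.1])⟩
    | bdry ζ =>
      obtain ⟨γ', rfl, rfl⟩ := hu
      refine mem_basicNhd_bdry.2 ⟨_, _, rfl, rfl, ?_⟩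
      exact (((hφγ γ').nearAt hδ hnear'.symm).symm).mono (by linarith)
  · intro ξ
    obtain ⟨γ, rfl⟩ : ∃ γ : GeodesicRay H, γ.endpoint = ξ := Quotient.exists_rep ξ
    have hγ := γ.fellow (o := o) hc
    -- Surjectivity: $T$-geodesics from $o$ to $\gamma(n)$ accumulate at a $T$-ray $\gamma'$. Its
    -- points have large $T$-product, hence large $H$-product, with infinitely many $\gamma(n)$.
    have hx : Tendsto (fun n => T.dist o (γ.toFun n)) atTop atTop := by
      refine tendsto_atTop.2 fun b => ?_
      obtain ⟨N, hN⟩ := hγ b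
      filter_upwards [eventually_ge_atTop N] with n hn
      have := hN n n hn hn
      rw [gromovProduct_self] at this
      exact le_trans (by exact_mod_cast this) (hdist _ _)
    obtain ⟨γ', hγ'⟩ := exists_ray_of_tendsto hT hbT hx
    have hfel : Fellow H o γ'.toFun γ.toFun := fun R => by
      obtain ⟨N, hN⟩ := hγ (R + δ)
      obtain ⟨M, hM⟩ := h.le_gromovProduct hT (R + δ)
      refine ⟨max M N, fun i j hi hj => ?_⟩
      obtain ⟨n, hn, hn'⟩ := ((hγ' i).and_eventually (eventually_ge_atTop N)).exists
      have hi' : (M : ℝ) ≤ i := by exact_mod_cast le_of_max_le_left hi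
      have := hδ.chain (hM _ _ (hi'.trans_eq hn.symm)) (hN n j hn' (le_of_max_le_right hj))
      linarith
    refine ⟨γ'.endpoint, ?_⟩
    exact (endpoint_eq_iff_fellow (o := o) hδ hc _ _).2 ((hφγ γ').trans hδ hfel)

/-! ### Moduli of properness -/

/-- Turns "for every $m$, all large $n$ are good" into a modulus: take the largest admissible $m\le
n$. -/
theorem exists_tendsto_modulus (P : ℕ → ℕ → Prop) (h₀ : ∀ n, P n 0)
    (h : ∀ m, ∃ N, ∀ n, N ≤ n → P n m) :
    ∃ M : ℕ → ℕ, Tendsto M atTop atTop ∧ ∀ n, P n (M n) := by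
  classical
  refine ⟨fun n => Nat.findGreatest (P n) n, tendsto_atTop.2 fun m => ?_,
    fun n => Nat.findGreatest_spec (m := 0) (Nat.zero_le n) (h₀ n)⟩
  obtain ⟨N, hN⟩ := h m
  filter_upwards [eventually_ge_atTop (max N m)] with n hn
  exact Nat.le_findGreatest (le_of_max_le_right hn) (hN n (le_of_max_le_left hn))

/-- Only finiteness of the balls of $H$ matters: the distance $d_T(o,\cdot)$ is bounded on each of
them. -/
theorem isProperEmbedding_ofLE (hb : ∀ r : ℕ, {v | H.dist o v ≤ r}.Finite) (hle : T ≤ H) :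
    IsProperEmbedding (SimpleGraph.Hom.ofLE hle) o := by
  refine ⟨Function.injective_id, ?_⟩
  obtain ⟨M, hM, h⟩ := exists_tendsto_modulus
    (fun n m => ∀ y, n ≤ T.dist o y → m ≤ H.dist o y) (fun _ _ _ => Nat.zero_le _) fun m => by
      obtain ⟨N, hN⟩ := ((hb m).image fun v => T.dist o v).bddAbove
      refine ⟨N + 1, fun n hn y hy => ?_⟩
      by_contra hcon
      have := hN ⟨y, (by omega : H.dist o y ≤ m), rfl⟩
      simp only at this
      omega
  exact ⟨M, hM, h⟩

theorem GromovTwoProper.isTwoProper (hc : H.Connected) (hle : T ≤ H)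
    (h : GromovTwoProper T H o) : IsTwoProper (SimpleGraph.Hom.ofLE hle) o := by
  obtain ⟨M, hM, h⟩ := exists_tendsto_modulus
    (fun n m => ∀ (x y : V) (p : T.Walk x y) (q : H.Walk x y), IsWordGeodesic p →
      IsWordGeodesic q → (∀ v ∈ p.support, n ≤ T.dist o v) → ∀ w ∈ q.support, m ≤ H.dist o w)
    (fun _ _ _ _ _ _ _ _ _ _ => Nat.zero_le _) fun m => by
      obtain ⟨N, hN⟩ := h m
      refine ⟨N, fun n hn x y p q hp hq hv w hw => ?_⟩
      exact_mod_cast (hN x y p hp fun v h => hn.trans (hv v h)).trans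
        (gromovProduct_le_dist_of_mem_geodesic hc hq hw)
  exact ⟨M, hM, h⟩

end

end HypGraph

/-! ### Trees given by a parent function -/

namespace HypGraph

variable {V : Type*} {T : SimpleGraph V} {π : V → V}

/-- A walk in a graph whose edges join vertices to their parents contains the orbits of its
endpoints up to a common ancestor. -/
theorem exists_common_ancestor (h : ∀ u v, T.Adj u v → π u = v ∨ π v = u) {x y : V}
    (p : T.Walk x y) : ∃ a b, π^[a] x = π^[b] y ∧ (∀ i ≤ a, π^[i] x ∈ p.support) ∧
      ∀ j ≤ b, π^[j] y ∈ p.support := by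
  induction p with
  | nil => exact ⟨0, 0, rfl, by simp, by simp⟩
  | @cons x x' y hadj p ih =>
    obtain ⟨a, b, hab, ha, hb⟩ := ih
    have hb' : ∀ j ≤ b, π^[j] y ∈ (SimpleGraph.Walk.cons hadj p).support := fun j hj =>
      List.mem_cons_of_mem _ (hb j hj)
    rcases h _ _ hadj with hπ | hπ
    · refine ⟨a + 1, b, by rw [Function.iterate_succ_apply, hπ, hab], fun i hi => ?_, hb'⟩
      cases i with
      | zero => simp
      | succ i =>
        rw [Function.iterate_succ_apply, hπ]
        exact List.mem_cons_of_mem _ (ha i (by omega))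
    · cases a with
      | zero =>
        refine ⟨0, b + 1, ?_, fun i hi => ?_, fun j hj => ?_⟩
        · rw [Function.iterate_succ_apply', ← hab]
          exact hπ.symm
        · obtain rfl : i = 0 := by omega
          simp
        · rcases Nat.lt_or_ge b j with hj' | hj'
          · obtain rfl : j = b + 1 := by omega
            rw [Function.iterate_succ_apply', ← hab, Function.iterate_zero, id, hπ]
            simp
          · exact hb' j hj'
      | succ a =>
        refine ⟨a, b, ?_, fun i hi => ?_, hb'⟩
        · rw [← hab, Function.iterate_succ_apply, hπ]
        · have := ha (i + 1) (by omega)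
          rw [Function.iterate_succ_apply, hπ] at this
          exact List.mem_cons_of_mem _ this

/-- Connectedness is the merging of orbits. For acyclicity every edge $\{u,\pi u\}$ is a bridge:
without it $u$ becomes a root of the remaining parent structure, so a path from $\pi u$ back to $u$
would make $u$ its own proper ancestor. -/
theorem isTree_of_parent [Nonempty V]
    (hadj : ∀ u v, T.Adj u v ↔ u ≠ v ∧ (π u = v ∨ π v = u))
    (hper : ∀ v n, π^[n + 1] v = v → π v = v)
    (hmerge : ∀ u v, ∃ a b, π^[a] u = π^[b] v) : T.IsTree := by
  classical
  have hreach : ∀ u a, T.Reachable u (π^[a] u) := by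
    intro u a
    induction a with
    | zero => exact SimpleGraph.Reachable.refl _
    | succ a ih =>
      refine ih.trans ?_
      rw [Function.iterate_succ_apply']
      by_cases h : π^[a] u = π (π^[a] u)
      · rw [← h]
      · exact ((hadj _ _).2 ⟨h, Or.inl rfl⟩).reachable
  refine ⟨(SimpleGraph.connected_iff _).2 ⟨fun u v => ?_, inferInstance⟩, ?_⟩
  · obtain ⟨a, b, hab⟩ := hmerge u v
    exact (hreach u a).trans (hab ▸ (hreach v b).symm)
  · suffices hbr : ∀ u v, T.Adj u v → π u = v → T.IsBridge s(u, v) by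
      rw [SimpleGraph.isAcyclic_iff_forall_adj_isBridge]
      intro u v huv
      rcases ((hadj u v).1 huv).2 with h | h
      · exact hbr u v huv h
      · rw [Sym2.eq_swap]
        exact hbr v u huv.symm h
    rintro u _ huv rfl
    rw [SimpleGraph.isBridge_iff]
    rintro ⟨p⟩
    -- The edges left after deleting $\{u,\pi u\}$ still join vertices to their $\pi'$-parents, and
    -- $u$ is fixed by $\pi'$.
    set π' := Function.update π u u with hπ'
    obtain ⟨a, b, hab, -, -⟩ := exists_common_ancestor (π := π') (fun x y hxy => by
      rw [SimpleGraph.deleteEdges_adj] at hxy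
      have hne : s(x, y) ≠ s(u, π u) := by simpa using hxy.2
      rcases ((hadj x y).1 hxy.1).2 with h | h
      · left
        rw [hπ', Function.update_of_ne, h]
        rintro rfl
        exact hne (by rw [h])
      · right
        rw [hπ', Function.update_of_ne, h]
        rintro rfl
        exact hne (by rw [h, Sym2.eq_swap])) p
    have h₁ : π'^[a] u = u := Function.iterate_fixed (by simp [hπ']) a
    have h₂ : ∀ b w, ∃ c, π'^[b] w = π^[c] w := by
      intro b w
      induction b with
      | zero => exact ⟨0, rfl⟩
      | succ b ih =>
        obtain ⟨c, hc⟩ := ih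
        rw [Function.iterate_succ_apply', hc]
        by_cases h : π^[c] w = u
        · exact ⟨c, by rw [h, hπ', Function.update_self]⟩
        · exact ⟨c + 1, by rw [hπ', Function.update_of_ne h, Function.iterate_succ_apply']⟩
    obtain ⟨c, hc⟩ := h₂ b (π u)
    rw [h₁, hc, ← Function.iterate_succ_apply] at hab
    exact huv.ne (hper u c hab.symm).symm

end HypGraph

/-! ### Passage times, uniqueness of geodesics -/

namespace FPP

open HypGraph

variable {V : Type*} {Γ : SimpleGraph V} {ω : Config Γ}

open Classical in
/-- The length of an edge, extended by zero to all pairs of vertices. -/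
noncomputable def edgeTime (ω : Config Γ) (e : Sym2 V) : ℝ≥0 :=
  if h : e ∈ Γ.edgeSet then ω ⟨e, h⟩ else 0

theorem edgeTime_of_mem {e : Sym2 V} (h : e ∈ Γ.edgeSet) : edgeTime ω e = ω ⟨e, h⟩ :=
  dif_pos h

theorem passageTime_eq_sum_edges {x y : V} (p : Γ.Walk x y) :
    passageTime ω p = (p.edges.map (edgeTime ω)).sum := by
  unfold passageTime
  rw [SimpleGraph.Walk.edges, List.map_map]
  congr 1
  refine List.map_congr_left fun d _ => ?_
  exact (edgeTime_of_mem _).symm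

@[simp]
theorem passageTime_nil (x : V) : passageTime ω (SimpleGraph.Walk.nil : Γ.Walk x x) = 0 := rfl

theorem passageTime_cons {x y z : V} (h : Γ.Adj x y) (p : Γ.Walk y z) :
    passageTime ω (.cons h p) = edgeTime ω s(x, y) + passageTime ω p := by
  simp [passageTime_eq_sum_edges]

theorem passageTime_append {x y z : V} (p : Γ.Walk x y) (q : Γ.Walk y z) :
    passageTime ω (p.append q) = passageTime ω p + passageTime ω q := by
  simp [passageTime_eq_sum_edges, SimpleGraph.Walk.edges_append]

theorem passageTime_concat {x y z : V} (p : Γ.Walk x y) (h : Γ.Adj y z) :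
    passageTime ω (p.concat h) = passageTime ω p + edgeTime ω s(y, z) := by
  simp [passageTime_eq_sum_edges, SimpleGraph.Walk.edges_concat]

theorem passageTime_reverse {x y : V} (p : Γ.Walk x y) :
    passageTime ω p.reverse = passageTime ω p := by
  simp [passageTime_eq_sum_edges]

theorem fppDist_le {x y : V} (p : Γ.Walk x y) : fppDist ω x y ≤ passageTime ω p :=
  ciInf_le (OrderBot.bddBelow _) p

@[simp]
theorem fppDist_self (x : V) : fppDist ω x x = 0 :=
  le_antisymm (fppDist_le .nil) (zero_le)

theorem fppDist_le_edgeTime {x y : V} (h : Γ.Adj x y) : fppDist ω x y ≤ edgeTime ω s(x, y) := by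
  simpa [passageTime_cons] using fppDist_le (ω := ω) (.cons h .nil)

theorem fppDist_comm (x y : V) : fppDist ω x y = fppDist ω y x := by
  unfold fppDist
  refine (Equiv.iInf_congr ⟨SimpleGraph.Walk.reverse, SimpleGraph.Walk.reverse,
    SimpleGraph.Walk.reverse_reverse, SimpleGraph.Walk.reverse_reverse⟩ fun p => ?_)
  exact passageTime_reverse p

theorem fppDist_triangle (hc : Γ.Connected) (x y z : V) :
    fppDist ω x z ≤ fppDist ω x y + fppDist ω y z := by
  have : ∀ u v, Nonempty (Γ.Walk u v) := fun u v => hc u v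
  unfold fppDist
  exact NNReal.le_iInf_add_iInf fun p q =>
    (fppDist_le (p.append q)).trans_eq (passageTime_append p q)

open Classical in
/-- The set of edges of a walk. -/
noncomputable def walkEdges {x y : V} (p : Γ.Walk x y) : Finset Γ.edgeSet :=
  (p.darts.map fun d => (⟨d.edge, d.edge_mem⟩ : Γ.edgeSet)).toFinset

theorem mem_walkEdges {x y : V} {p : Γ.Walk x y} {e : Γ.edgeSet} :
    e ∈ walkEdges p ↔ (e : Sym2 V) ∈ p.edges := by
  simp only [walkEdges, List.mem_toFinset, List.mem_map, SimpleGraph.Walk.edges, Subtype.ext_iff]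

theorem nodup_edgeList {x y : V} {p : Γ.Walk x y} (hp : p.IsPath) :
    (p.darts.map fun d => (⟨d.edge, d.edge_mem⟩ : Γ.edgeSet)).Nodup := by
  have : (List.map Subtype.val
      (p.darts.map fun d => (⟨d.edge, d.edge_mem⟩ : Γ.edgeSet))).Nodup := by
    rw [List.map_map]
    exact hp.isTrail.edges_nodup
  exact List.Nodup.of_map _ this

theorem sum_walkEdges {x y : V} {p : Γ.Walk x y} (hp : p.IsPath) :
    ∑ e ∈ walkEdges p, ω e = passageTime ω p := by
  classical
  unfold walkEdges passageTime
  rw [List.sum_toFinset _ (nodup_edgeList hp), List.map_map]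
  rfl

theorem card_walkEdges {x y : V} {p : Γ.Walk x y} (hp : p.IsPath) :
    (walkEdges p).card = p.length := by
  classical
  unfold walkEdges
  rw [List.toFinset_card_of_nodup (nodup_edgeList hp)]
  simp

/-- A path is determined by its set of edges. -/
theorem eq_of_edges_iff {x y : V} {p q : Γ.Walk x y} (hp : p.IsPath) (hq : q.IsPath)
    (h : ∀ e, e ∈ p.edges ↔ e ∈ q.edges) : p = q := by
  induction p with
  | nil => exact (SimpleGraph.Walk.eq_nil_iff_nil.2 (SimpleGraph.Walk.isPath_iff_nil.1 hq)).symm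
  | @cons x z y hadj p ih =>
    rw [SimpleGraph.Walk.cons_isPath_iff] at hp
    cases q with
    | nil => exact absurd p.end_mem_support hp.2
    | @cons _ z' _ hadj' q =>
      rw [SimpleGraph.Walk.cons_isPath_iff] at hq
      simp only [SimpleGraph.Walk.edges_cons, List.mem_cons] at h
      have hz : z = z' := by
        rcases (h s(x, z)).1 (Or.inl rfl) with h' | h'
        · simpa [hadj'.ne] using h'
        · exact absurd (q.fst_mem_support_of_mem_edges h') hq.2
      subst hz
      rw [ih hp.1 hq.1 fun e => ?_]
      constructor
      · intro he
        refine ((h e).1 (Or.inr he)).resolve_left ?_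
        rintro rfl
        exact hp.2 (p.fst_mem_support_of_mem_edges he)
      · intro he
        refine ((h e).2 (Or.inr he)).resolve_left ?_
        rintro rfl
        exact hq.2 (q.fst_mem_support_of_mem_edges he)

/-- Distinct finite sets of edges have distinct total lengths. -/
def Generic (ω : Config Γ) : Prop :=
  ∀ P P' : Finset Γ.edgeSet, ∑ e ∈ P, ω e = ∑ e ∈ P', ω e → P = P'

theorem Generic.pos (h : Generic ω) (e : Γ.edgeSet) : 0 < ω e := by
  refine pos_iff_ne_zero.2 fun h0 => ?_
  have := h {e} ∅ (by simpa using h0)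
  simp at this

theorem Generic.edgeTime_pos (h : Generic ω) {x y : V} (hxy : Γ.Adj x y) :
    0 < edgeTime ω s(x, y) := by
  rw [edgeTime_of_mem ((Γ.mem_edgeSet).2 hxy)]
  exact h.pos _

theorem passageTime_bypass_le [DecidableEq V] {x y : V} (p : Γ.Walk x y) :
    passageTime ω p.bypass ≤ passageTime ω p := by
  rw [passageTime_eq_sum_edges, passageTime_eq_sum_edges]
  exact (p.edges_bypass_sublist_edges.map _).sum_le_sum fun _ _ => zero_le

theorem passageTime_lt_of_sublist (h : Generic ω) : ∀ {l l' : List (Sym2 V)},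
    l.Sublist l' → (∀ e ∈ l', e ∈ Γ.edgeSet) → l.length < l'.length →
    (l.map (edgeTime ω)).sum < (l'.map (edgeTime ω)).sum := by
  intro l l' hs
  induction hs with
  | slnil => simp
  | @cons l l' e hs ih =>
    intro he _
    have h₁ : 0 < edgeTime ω e := by
      rw [edgeTime_of_mem (he e (by simp))]; exact h.pos _
    have h₂ : (l.map (edgeTime ω)).sum ≤ (l'.map (edgeTime ω)).sum :=
      (hs.map _).sum_le_sum fun _ _ => zero_le
    simp only [List.map_cons, List.sum_cons]
    exact lt_of_le_of_lt h₂ (lt_add_of_pos_left _ h₁)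
  | @cons_cons l l' e hs ih =>
    intro he hl
    simp only [List.map_cons, List.sum_cons]
    have := ih (fun e' he' => he e' (List.mem_cons_of_mem _ he')) (by simpa using hl)
    gcongr

/-- Cutting out a loop drops at least one edge, whose length is positive. -/
theorem Generic.isPath (h : Generic ω) {x y : V} {p : Γ.Walk x y} (hp : IsFPPGeodesic ω p) :
    p.IsPath := by
  classical
  by_contra hcon
  have hlt : p.bypass.length < p.length := by
    by_contra hle
    rw [← p.bypass_eq_self_of_length_le_length_bypass (not_lt.1 hle)] at hcon
    exact hcon p.bypass_isPath
  have h₁ : passageTime ω p.bypass < passageTime ω p := by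
    rw [passageTime_eq_sum_edges, passageTime_eq_sum_edges]
    exact passageTime_lt_of_sublist h p.edges_bypass_sublist_edges
      (fun e he => p.edges_subset_edgeSet he) (by simpa using hlt)
  exact absurd (fppDist_le p.bypass) (not_le.2 (hp ▸ h₁))

/-- Two geodesics have equal total length, hence equal edge sets by genericity, and a self-avoiding
path is determined by its edges. -/
theorem Generic.unique (h : Generic ω) {x y : V} {p q : Γ.Walk x y} (hp : IsFPPGeodesic ω p)
    (hq : IsFPPGeodesic ω q) : p = q := by
  have hpp := h.isPath hp
  have hqp := h.isPath hq
  have hE := h (walkEdges p) (walkEdges q) (by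
    rw [sum_walkEdges hpp, sum_walkEdges hqp]
    exact hp.trans hq.symm)
  refine eq_of_edges_iff hpp hqp fun e => ?_
  have key : ∀ {p q : Γ.Walk x y}, walkEdges p = walkEdges q → e ∈ p.edges → e ∈ q.edges := by
    intro p q hpq he
    have : (⟨e, p.edges_subset_edgeSet he⟩ : Γ.edgeSet) ∈ walkEdges p := mem_walkEdges.2 he
    rw [hpq] at this
    exact mem_walkEdges.1 this
  exact ⟨key hE, key hE.symm⟩

/-! ### Geodesic segments as sequences of vertices -/

/-- The sum of the edge lengths along the sequence `σ` from time `a` to time `b`. -/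
noncomputable def chainTime (ω : Config Γ) (σ : ℕ → V) (a b : ℕ) : ℝ≥0 :=
  ∑ k ∈ Finset.Ico a b, edgeTime ω s(σ k, σ (k + 1))

theorem chainTime_add (σ : ℕ → V) {a b c : ℕ} (hab : a ≤ b) (hbc : b ≤ c) :
    chainTime ω σ a b + chainTime ω σ b c = chainTime ω σ a c :=
  Finset.sum_Ico_consecutive _ hab hbc

/-- The sequence `σ` on the interval `[a, b]` is an edge path. -/
def IsChain (Γ : SimpleGraph V) (σ : ℕ → V) (a b : ℕ) : Prop :=
  ∀ i, a ≤ i → i < b → Γ.Adj (σ i) (σ (i + 1))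

theorem IsChain.mono {σ : ℕ → V} {a b a' b' : ℕ} (h : IsChain Γ σ a b) (ha : a ≤ a')
    (hb : b' ≤ b) : IsChain Γ σ a' b' :=
  fun i hi hi' => h i (ha.trans hi) (by omega)

theorem IsChain.exists_walk {σ : ℕ → V} {a b : ℕ} (hab : a ≤ b) (h : IsChain Γ σ a b)
    (ω : Config Γ) : ∃ p : Γ.Walk (σ a) (σ b), p.length = b - a ∧
      (∀ k ≤ b - a, p.getVert k = σ (a + k)) ∧ passageTime ω p = chainTime ω σ a b := by
  induction b, hab using Nat.le_induction with
  | base => exact ⟨.nil, by simp, by simp, by simp [chainTime]⟩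
  | succ b hb ih =>
    obtain ⟨p, hl, hv, ht⟩ := ih (h.mono le_rfl (by omega))
    have hadj := h b hb (by omega)
    refine ⟨p.concat hadj, by simp [hl]; omega, fun k hk => ?_, ?_⟩
    · rcases Nat.lt_or_ge k (b + 1 - a) with hk' | hk'
      · rw [SimpleGraph.Walk.concat_eq_append, SimpleGraph.Walk.getVert_append]
        split_ifs with hlt
        · exact hv k (by omega)
        · rw [show k - p.length = 0 by omega, SimpleGraph.Walk.getVert_zero]
          congr 1
          omega
      · rw [SimpleGraph.Walk.getVert_of_length_le _ (by simp [hl]; omega)]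
        congr 1
        omega
    · rw [passageTime_concat, ht, chainTime, chainTime, Finset.sum_Ico_succ_top hb]

theorem IsChain.fppDist_le {σ : ℕ → V} {a b : ℕ} (hab : a ≤ b) (h : IsChain Γ σ a b) :
    fppDist ω (σ a) (σ b) ≤ chainTime ω σ a b := by
  obtain ⟨p, -, -, hp⟩ := h.exists_walk hab ω
  exact hp ▸ FPP.fppDist_le p

/-- The sequence `σ` on the interval `[a, b]` is an `ω`-geodesic. -/
def IsSeg (ω : Config Γ) (σ : ℕ → V) (a b : ℕ) : Prop :=
  IsChain Γ σ a b ∧ ∀ i j, a ≤ i → i ≤ j → j ≤ b → chainTime ω σ i j = fppDist ω (σ i) (σ j)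

theorem IsSeg.mono {σ : ℕ → V} {a b a' b' : ℕ} (h : IsSeg ω σ a b) (ha : a ≤ a') (hb : b' ≤ b) :
    IsSeg ω σ a' b' :=
  ⟨h.1.mono ha hb, fun i j hi hij hj => h.2 i j (ha.trans hi) hij (hj.trans hb)⟩

/-- By the triangle inequality, a strict gain on a subinterval would be a strict gain between the
endpoints. So being a geodesic need only be checked at the two ends. -/
theorem isSeg_of_chainTime_le (hc : Γ.Connected) {σ : ℕ → V} {a b : ℕ} (h : IsChain Γ σ a b)
    (ht : chainTime ω σ a b ≤ fppDist ω (σ a) (σ b)) : IsSeg ω σ a b := by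
  refine ⟨h, fun i j hi hij hj => le_antisymm ?_ ((h.mono hi hj).fppDist_le hij)⟩
  have h₁ := (h.mono le_rfl (hij.trans hj)).fppDist_le (ω := ω) hi
  have h₂ := (h.mono (hi.trans hij) le_rfl).fppDist_le (ω := ω) hj
  have h₃ := fppDist_triangle (ω := ω) hc (σ a) (σ i) (σ b)
  have h₄ := fppDist_triangle (ω := ω) hc (σ i) (σ j) (σ b)
  rw [← chainTime_add σ (hi.trans hij) hj, ← chainTime_add σ hi hij] at ht
  rw [← NNReal.coe_le_coe] at *
  push_cast at *
  linarith

theorem passageTime_eq_chainTime {x y : V} (p : Γ.Walk x y) :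
    passageTime ω p = chainTime ω p.getVert 0 p.length := by
  induction p with
  | nil => simp [chainTime]
  | cons h p ih =>
    rw [passageTime_cons, ih]
    unfold chainTime
    rw [SimpleGraph.Walk.length_cons, Finset.sum_eq_sum_Ico_succ_bot (Nat.succ_pos _),
      ← Finset.sum_Ico_add' _ 0 p.length 1]
    simp

theorem isChain_getVert {x y : V} (p : Γ.Walk x y) : IsChain Γ p.getVert 0 p.length :=
  fun _ _ hi => p.adj_getVert_succ hi

theorem IsFPPGeodesic.isSeg (hc : Γ.Connected) {x y : V} {p : Γ.Walk x y}
    (hp : IsFPPGeodesic ω p) : IsSeg ω p.getVert 0 p.length :=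
  isSeg_of_chainTime_le hc (isChain_getVert p) (by
    rw [← passageTime_eq_chainTime, p.getVert_zero, p.getVert_length]
    exact hp.le)

theorem IsSeg.exists_geodesic {σ : ℕ → V} {a b : ℕ} (hab : a ≤ b) (h : IsSeg ω σ a b) :
    ∃ p : Γ.Walk (σ a) (σ b), IsFPPGeodesic ω p ∧ p.length = b - a ∧
      (∀ k ≤ b - a, p.getVert k = σ (a + k)) ∧ passageTime ω p = chainTime ω σ a b := by
  obtain ⟨p, h₁, h₂, h₃⟩ := h.1.exists_walk hab ω
  exact ⟨p, h₃.trans (h.2 a b le_rfl hab le_rfl), h₁, h₂, h₃⟩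

theorem IsSeg.injOn (hg : Generic ω) {σ : ℕ → V} {a b : ℕ} (h : IsSeg ω σ a b) {i j : ℕ}
    (hi : a ≤ i) (hij : i < j) (hj : j ≤ b) : σ i ≠ σ j := by
  intro he
  have h₁ := h.2 i j hi hij.le hj
  have h₂ : 0 < edgeTime ω s(σ i, σ (i + 1)) := hg.edgeTime_pos (h.1 i hi (by omega))
  have h₃ : edgeTime ω s(σ i, σ (i + 1)) ≤ chainTime ω σ i j :=
    Finset.single_le_sum (f := fun k => edgeTime ω s(σ k, σ (k + 1))) (fun _ _ => zero_le)
      (Finset.mem_Ico.2 ⟨le_rfl, hij⟩)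
  have h₄ : fppDist ω (σ i) (σ j) = 0 := by rw [he, fppDist_self]
  rw [h₁, h₄] at h₃
  exact absurd h₃ (not_le.2 h₂)

theorem Generic.isSeg_unique (hg : Generic ω) {σ τ : ℕ → V} {a b a' b' : ℕ} (hab : a ≤ b)
    (hab' : a' ≤ b') (hσ : IsSeg ω σ a b) (hτ : IsSeg ω τ a' b') (h₁ : σ a = τ a')
    (h₂ : σ b = τ b') : b - a = b' - a' ∧ ∀ k ≤ b - a, σ (a + k) = τ (a' + k) := by
  obtain ⟨p, hp, hpl, hpv, -⟩ := hσ.exists_geodesic hab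
  obtain ⟨q, hq, hql, hqv, -⟩ := hτ.exists_geodesic hab'
  have key : ∀ {x y x' y' : V} (p : Γ.Walk x y) (q : Γ.Walk x' y'), x = x' → y = y' →
      IsFPPGeodesic ω p → IsFPPGeodesic ω q → p.length = q.length ∧
        ∀ k, p.getVert k = q.getVert k := by
    rintro x y _ _ p q rfl rfl hp hq
    rw [hg.unique hp hq]
    exact ⟨rfl, fun _ => rfl⟩
  obtain ⟨h₃, h₄⟩ := key p q h₁ h₂ hp hq
  refine ⟨by omega, fun k hk => ?_⟩
  rw [← hpv k hk, h₄, hqv k (by omega)]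

theorem isFPPRay_iff {σ : ℕ → V} : IsFPPRay ω σ ↔ ∀ n, IsSeg ω σ 0 n := by
  constructor
  · rintro ⟨h, h'⟩ n
    refine ⟨fun i _ _ => h i, fun i j _ hij _ => ?_⟩
    rw [← h' i j hij]
    exact Finset.sum_congr rfl fun k _ => edgeTime_of_mem _
  · intro h
    refine ⟨fun n => (h (n + 1)).1 n (Nat.zero_le _) (by omega), fun m n hmn => ?_⟩
    rw [← (h n).2 m n (Nat.zero_le _) hmn le_rfl]
    exact Finset.sum_congr rfl fun k _ => (edgeTime_of_mem _).symm

theorem IsSeg.shift {σ : ℕ → V} {a b c : ℕ} (h : IsSeg ω σ (a + c) (b + c)) :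
    IsSeg ω (fun n => σ (n + c)) a b := by
  refine ⟨fun i hi hi' => ?_, fun i j hi hij hj => ?_⟩
  · have := h.1 (i + c) (by omega) (by omega)
    rwa [show i + c + 1 = i + 1 + c by omega] at this
  · rw [← h.2 (i + c) (j + c) (by omega) (by omega) (by omega)]
    unfold chainTime
    rw [← Finset.sum_Ico_add' _ i j c]
    refine Finset.sum_congr rfl fun k _ => ?_
    rw [show k + c + 1 = k + 1 + c by omega]

theorem IsFPPRay.shift {σ : ℕ → V} (h : IsFPPRay ω σ) (c : ℕ) :
    IsFPPRay ω fun n => σ (n + c) :=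
  isFPPRay_iff.2 fun n => ((isFPPRay_iff.1 h (n + c)).mono (Nat.zero_le _) le_rfl).shift

end FPP

/-! ### Trees of geodesics under coarse estimates -/

namespace FPP

open HypGraph

variable {V : Type*} {Γ : SimpleGraph V} {ω : Config Γ} {o : V}

/-- From scale `s₀` on, the points within distance `s` of `o` have passage time at most `C * s`
from `o`, and self-avoiding paths of length `A * s` from these points take time more
than `2 * C * s`. -/
def Coarse (ω : Config Γ) (o : V) (A : ℕ) (C : ℝ≥0) (s₀ : ℕ) : Prop :=
  ∀ s, s₀ ≤ s → (∀ u, Γ.dist o u ≤ s → fppDist ω o u ≤ C * s) ∧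
    ∀ u v, Γ.dist o u ≤ s → ∀ p : Γ.Walk u v, p.IsPath → p.length = A * s →
      2 * C * s < passageTime ω p

theorem Coarse.mono {A : ℕ} {C : ℝ≥0} {s₀ s₁ : ℕ} (h : Coarse ω o A C s₀) (hs : s₀ ≤ s₁) :
    Coarse ω o A C s₁ :=
  fun s hs' => h s (hs.trans hs')

theorem chainTime_mono {σ : ℕ → V} {a b c : ℕ} (hbc : b ≤ c) :
    chainTime ω σ a b ≤ chainTime ω σ a c :=
  Finset.sum_le_sum_of_subset (Finset.Ico_subset_Ico le_rfl hbc)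

/-- Under coarse estimates geodesics make no long excursions. -/
theorem Coarse.shortExcursions (hc : Γ.Connected) {A : ℕ} {C : ℝ≥0} {s₀ : ℕ}
    (h : Coarse ω o A C s₀) (hg : Generic ω) {σ : ℕ → V} {a b : ℕ} (hσ : IsSeg ω σ a b) :
    ShortExcursions Γ o A s₀ σ a b := by
  intro s hs i j hi hij hj hdi hdj
  by_contra hcon
  have hle : i + A * s ≤ j := by omega
  -- The first $As$ steps of the excursion already cost more than the detour through $o$, which
  -- costs at most $2Cs$.
  obtain ⟨p, hp, hpl, -, hpt⟩ := (hσ.mono hi (hle.trans hj)).exists_geodesic (by omega)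
  have h₁ := (h s hs).2 _ _ hdi p (hg.isPath hp) (by omega)
  rw [hpt] at h₁
  have h₂ := (chainTime_mono hle).trans_eq (hσ.2 i j hi hij hj)
  have h₃ := fppDist_triangle (ω := ω) hc (σ i) o (σ j)
  rw [fppDist_comm (σ i) o] at h₃
  have h₄ := add_le_add ((h s hs).1 _ hdi) ((h s hs).1 _ hdj)
  have h₅ : (C * s + C * s : ℝ≥0) = 2 * C * s := by ring
  exact absurd (h₂.trans (h₃.trans (h₄.trans_eq h₅))) (not_le.2 h₁)

/-- Standing assumptions on a configuration: the graph is a proper hyperbolic space, the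
configuration is generic and satisfies coarse estimates at a large scale. -/
structure Regular (ω : Config Γ) (o : V) (δ : ℝ) (A : ℕ) (C : ℝ≥0) (s₀ : ℕ) : Prop where
  conn : Γ.Connected
  hasDelta : HasDelta Γ δ
  finite_ball : ∀ (x : V) (r : ℕ), {v | Γ.dist x v ≤ r}.Finite
  generic : Generic ω
  coarse : Coarse ω o A C s₀
  large : LargeThreshold δ (1 / 2) A s₀
  pos : 0 < C

theorem finite_walks (hb : ∀ (x : V) (r : ℕ), {v | Γ.dist x v ≤ r}.Finite) (x y : V) (n : ℕ) :
    {p : Γ.Walk x y | p.length < n}.Finite := by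
  classical
  have : Γ.LocallyFinite := fun v => ((hb v 1).subset fun w hw =>
    (SimpleGraph.dist_eq_one_iff_adj.2 hw).le).fintype
  exact Set.Finite.ofFinset (Γ.finsetWalkLengthLT n x y) fun p =>
    SimpleGraph.mem_finsetWalkLengthLT_iff

namespace Regular

variable {δ : ℝ} {A : ℕ} {C : ℝ≥0} {s₀ : ℕ}

/-- The infimum over infinitely many walks is attained because, for $s$ large, a self-avoiding walk
with at least $As$ edges costs more than a fixed competitor. Only finitely many walks remain. -/
theorem exists_geodesic (h : Regular ω o δ A C s₀) (x y : V) :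
    ∃ p : Γ.Walk x y, IsFPPGeodesic ω p := by
  classical
  obtain ⟨p₀⟩ := h.conn x y
  obtain ⟨s, hs, hsx, hsT⟩ : ∃ s, s₀ ≤ s ∧ Γ.dist o x ≤ s ∧ passageTime ω p₀ ≤ 2 * C * s := by
    obtain ⟨n, hn⟩ := exists_nat_ge (passageTime ω p₀ / (2 * C))
    refine ⟨max n (max s₀ (Γ.dist o x)), by omega, by omega, ?_⟩
    have hC : (0 : ℝ≥0) < 2 * C := mul_pos two_pos h.pos
    rw [div_le_iff₀' hC] at hn
    refine hn.trans ?_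
    gcongr
    exact le_max_left _ _
  have hlong : ∀ p : Γ.Walk x y, p.IsPath → passageTime ω p ≤ 2 * C * s →
      p.length < A * s := by
    intro p hp ht
    by_contra hlen
    have h₁ := (h.coarse s hs).2 x _ hsx (p.take (A * s)) (hp.take _) (by
      rw [SimpleGraph.Walk.take_length]; omega)
    have h₂ : passageTime ω (p.take (A * s)) ≤ passageTime ω p := by
      conv_rhs => rw [← p.append_take_drop_eq (A * s), passageTime_append]
      exact le_self_add
    exact absurd (h₁.trans_le (h₂.trans ht)) (lt_irrefl _)
  obtain ⟨m, hm, hmin⟩ := Set.exists_min_image _ (fun p => passageTime ω p)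
    (finite_walks h.finite_ball x y (A * s)) ⟨p₀.bypass, hlong _ p₀.bypass_isPath
      ((passageTime_bypass_le p₀).trans hsT)⟩
  refine ⟨m, le_antisymm ?_ (fppDist_le m)⟩
  have : Nonempty (Γ.Walk x y) := ⟨p₀⟩
  refine le_ciInf fun p => ?_
  rcases le_total (passageTime ω p.bypass) (2 * C * s) with ht | ht
  · exact (hmin _ (hlong _ p.bypass_isPath ht)).trans (passageTime_bypass_le p)
  · exact ((hmin _ (hlong _ p₀.bypass_isPath ((passageTime_bypass_le p₀).trans hsT))).trans
      ((passageTime_bypass_le p₀).trans hsT)).trans (ht.trans (passageTime_bypass_le p))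

theorem le_gromovProduct (h : Regular ω o δ A C s₀) {σ : ℕ → V} {a b s : ℕ} (hab : a ≤ b)
    (hσ : IsSeg ω σ a b) (hs : s₀ ≤ s) (hout : ∀ i, a ≤ i → i ≤ b → s ≤ Γ.dist o (σ i)) :
    (s : ℝ) / 2 ≤ gromovProduct Γ o (σ a) (σ b) := by
  have := (h.coarse.shortExcursions h.conn h.generic hσ).le_gromovProduct h.hasDelta h.large
    (b - a) a b s rfl hab hσ.1 hs hout
  linarith

/-- A connected spanning subgraph in which the ancestors of every vertex form an `ω`-geodesic. -/
theorem gromovTwoProper (h : Regular ω o δ A C s₀) {T : SimpleGraph V} {π : V → V}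
    (hadj : ∀ u v, T.Adj u v → π u = v ∨ π v = u)
    (hseg : ∀ x a, (∀ i ≤ a, π^[i] x ≠ o) → IsSeg ω (fun i => π^[i] x) 0 a) :
    GromovTwoProper T Γ o := by
  intro R
  obtain ⟨s, hs⟩ := exists_nat_ge (2 * (R + δ))
  set r := max s s₀ with hr
  -- A $T$-geodesic at $T$-distance more than $N$ from $o$ avoids the $\Gamma$-ball of radius $r$,
  -- since that ball is finite. It also avoids $o$, so the orbits inside it are $\omega$-geodesics.
  -- The factor $2$ in the choice of $s$ comes from $\varepsilon=1/2$.
  obtain ⟨N, hN⟩ := ((h.finite_ball o r).image fun v => T.dist o v).bddAbove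
  refine ⟨N + 1, fun x y p hp hfar => ?_⟩
  have hfar' : ∀ v ∈ p.support, r ≤ Γ.dist o v := fun v hv => by
    by_contra hcon
    have h₁ := hN ⟨v, (by omega : Γ.dist o v ≤ r), rfl⟩
    have h₂ := hfar v hv
    simp only at h₁
    omega
  have hne : ∀ v ∈ p.support, v ≠ o := by
    rintro v hv rfl
    have := hfar v hv
    simp at this
  obtain ⟨a, b, hab, ha, hb⟩ := exists_common_ancestor hadj p
  have hx := h.le_gromovProduct (Nat.zero_le a) (hseg x a fun i hi => hne _ (ha i hi))
    (le_max_right s s₀) fun i _ hi => hfar' _ (ha i hi)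
  have hy := h.le_gromovProduct (Nat.zero_le b) (hseg y b fun i hi => hne _ (hb i hi))
    (le_max_right s s₀) fun i _ hi => hfar' _ (hb i hi)
  simp only [Function.iterate_zero, id] at hx hy
  rw [gromovProduct_comm, ← hab] at hy
  have h₁ := h.hasDelta.chain hx hy
  have h₂ : (s : ℝ) ≤ (max s s₀ : ℕ) := by exact_mod_cast le_max_left s s₀
  linarith

/-! ### The forward tree -/

/-- An edge on a geodesic from $o$ accounts for the difference of the distances of its ends;
conversely, when it does, appending it to a geodesic to the nearer end gives a geodesic. -/
theorem forwardTree_adj_iff (h : Regular ω o δ A C s₀) (u v : V) :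
    (forwardTree o ω).Adj u v ↔ Γ.Adj u v ∧
      (fppDist ω o v = fppDist ω o u + edgeTime ω s(u, v) ∨
        fppDist ω o u = fppDist ω o v + edgeTime ω s(u, v)) := by
  constructor
  · rintro ⟨g, p, hp, he⟩
    refine ⟨p.adj_of_mem_edges he, ?_⟩
    obtain ⟨i, hi, hiv⟩ := (p.mk_mem_edges_iff_exists).1 he
    have hseg := hp.isSeg h.conn
    have key : fppDist ω o (p.getVert (i + 1)) = fppDist ω o (p.getVert i) +
        edgeTime ω s(p.getVert i, p.getVert (i + 1)) := by
      have h₁ := hseg.2 0 i le_rfl (Nat.zero_le _) hi.le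
      have h₂ := hseg.2 0 (i + 1) le_rfl (Nat.zero_le _) hi
      rw [p.getVert_zero] at h₁ h₂
      rw [← h₁, ← h₂, chainTime, chainTime, Finset.sum_Ico_succ_top (Nat.zero_le _)]
    rw [hiv] at key
    rcases Sym2.eq_iff.1 hiv with ⟨rfl, rfl⟩ | ⟨rfl, rfl⟩
    · exact Or.inl key
    · exact Or.inr key
  · rintro ⟨hadj, huv⟩
    have key : ∀ {u v : V}, Γ.Adj u v → fppDist ω o v = fppDist ω o u + edgeTime ω s(u, v) →
        (forwardTree o ω).Adj u v := by
      intro u v hadj huv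
      obtain ⟨p, hp⟩ := h.exists_geodesic o u
      refine ⟨v, p.concat hadj, ?_, by simp [SimpleGraph.Walk.edges_concat]⟩
      rw [IsFPPGeodesic, passageTime_concat, huv, hp]
    rcases huv with huv | huv
    · exact key hadj huv
    · rw [Sym2.eq_swap] at huv
      exact (key hadj.symm huv).symm

theorem forward_unique (h : Regular ω o δ A C s₀) {u u' v : V} (hu : Γ.Adj u v)
    (hu' : Γ.Adj u' v) (h₁ : fppDist ω o v = fppDist ω o u + edgeTime ω s(u, v))
    (h₂ : fppDist ω o v = fppDist ω o u' + edgeTime ω s(u', v)) : u = u' := by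
  obtain ⟨p, hp⟩ := h.exists_geodesic o u
  obtain ⟨q, hq⟩ := h.exists_geodesic o u'
  have hpq : p.concat hu = q.concat hu' := h.generic.unique
    (by rw [IsFPPGeodesic, passageTime_concat, h₁, hp])
    (by rw [IsFPPGeodesic, passageTime_concat, h₂, hq])
  have := congrArg SimpleGraph.Walk.penultimate hpq
  simpa using this

/-- The parent is the penultimate vertex of the geodesic from $o$. By uniqueness the truncated
geodesic is the one chosen for the parent, so the number of edges decreases until $o$ is reached. -/
theorem exists_forward_parent (h : Regular ω o δ A C s₀) : ∃ π : V → V, π o = o ∧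
    (∀ v, v ≠ o → Γ.Adj (π v) v ∧ fppDist ω o v = fppDist ω o (π v) + edgeTime ω s(π v, v)) ∧
    ∀ v, ∃ a, π^[a] v = o := by
  classical
  choose p hp using h.exists_geodesic o
  have hex : ∀ v, v ≠ o → ∃ u, Γ.Adj u v ∧
      fppDist ω o v = fppDist ω o u + edgeTime ω s(u, v) ∧ (p u).length < (p v).length := by
    intro v hv
    have hnil : ¬ (p v).Nil := SimpleGraph.Walk.not_nil_of_ne hv.symm
    have hadj := SimpleGraph.Walk.adj_penultimate hnil
    have hlen : 0 < (p v).length := by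
      rw [Nat.pos_iff_ne_zero]
      exact fun h0 => hnil (SimpleGraph.Walk.length_eq_zero_iff.1 h0)
    have hcat := SimpleGraph.Walk.concat_dropLast hadj
    have ht : passageTime ω (p v).dropLast + edgeTime ω s((p v).penultimate, v) =
        fppDist ω o v := by
      rw [← hp v]
      conv_rhs => rw [← hcat, passageTime_concat]
    have hge : IsFPPGeodesic ω (p v).dropLast := by
      refine le_antisymm ?_ (fppDist_le _)
      have h₁ := fppDist_triangle (ω := ω) h.conn o (p v).penultimate v
      have h₂ := h₁.trans (add_le_add_right (fppDist_le_edgeTime hadj) _)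
      rw [← ht] at h₂
      exact le_of_add_le_add_right h₂
    refine ⟨(p v).penultimate, hadj, ?_, ?_⟩
    · rw [← ht, hge]
    · rw [h.generic.unique (hp _) hge]
      have := congrArg SimpleGraph.Walk.length hcat
      rw [SimpleGraph.Walk.length_concat] at this
      omega
  choose! π hπ using hex
  refine ⟨fun v => if v = o then o else π v, if_pos rfl, fun v hv => ?_, fun v => ?_⟩
  · simp only [if_neg hv]
    exact ⟨(hπ v hv).1, (hπ v hv).2.1⟩
  · generalize hn : (p v).length = n
    induction n using Nat.strong_induction_on generalizing v with
    | _ n ih =>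
      by_cases hv : v = o
      · exact ⟨0, hv⟩
      · obtain ⟨a, ha⟩ := ih _ (hn ▸ (hπ v hv).2.2) (π v) rfl
        refine ⟨a + 1, ?_⟩
        rw [Function.iterate_succ_apply, if_neg hv]
        exact ha

/-- The distance $d_\omega(o,\cdot)$ drops strictly from a vertex other than $o$ to its parent,
which excludes cycles, and the orbits merge at $o$. The drops add up along an orbit, so before $o$
it is a geodesic run backwards. -/
theorem forwardTree_isTree_and_gromovTwoProper (h : Regular ω o δ A C s₀) :
    (forwardTree o ω).IsTree ∧ GromovTwoProper (forwardTree o ω) Γ o := by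
  obtain ⟨π, hπo, hπ, hreach⟩ := h.exists_forward_parent
  have hadj : ∀ u v, (forwardTree o ω).Adj u v ↔ u ≠ v ∧ (π u = v ∨ π v = u) := by
    have key : ∀ {u v}, Γ.Adj u v → fppDist ω o v = fppDist ω o u + edgeTime ω s(u, v) →
        π v = u := by
      intro u v huv ht
      have hv : v ≠ o := by
        rintro rfl
        have := h.generic.edgeTime_pos huv
        rw [fppDist_self] at ht
        exact this.ne' (by simpa using (add_eq_zero.1 ht.symm).2)
      exact h.forward_unique (hπ v hv).1 huv (hπ v hv).2 ht
    have key' : ∀ {u v}, u ≠ v → π u = v → (forwardTree o ω).Adj u v := by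
      rintro u v huv rfl
      have hu : u ≠ o := by
        rintro rfl
        exact huv hπo.symm
      rw [SimpleGraph.adj_comm, h.forwardTree_adj_iff]
      exact ⟨(hπ u hu).1, Or.inl (hπ u hu).2⟩
    intro u v
    constructor
    · intro huv
      refine ⟨huv.ne, ?_⟩
      obtain ⟨huv, ht | ht⟩ := (h.forwardTree_adj_iff u v).1 huv
      · exact Or.inr (key huv ht)
      · rw [Sym2.eq_swap] at ht
        exact Or.inl (key huv.symm ht)
    · rintro ⟨hne, huv | huv⟩
      · exact key' hne huv
      · exact (key' hne.symm huv).symm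
  have hle : ∀ v, fppDist ω o (π v) ≤ fppDist ω o v := fun v => by
    by_cases hv : v = o
    · rw [hv, hπo]
    · rw [(hπ v hv).2]; exact le_self_add
  have : Nonempty V := ⟨o⟩
  constructor
  · refine isTree_of_parent hadj (fun v n hv => ?_) fun u v => ?_
    · by_contra hne
      have hvo : v ≠ o := by
        rintro rfl
        exact hne hπo
      have h₁ : ∀ n w, fppDist ω o (π^[n] w) ≤ fppDist ω o w := by
        intro n w
        induction n with
        | zero => exact le_rfl
        | succ n ih => rw [Function.iterate_succ_apply']; exact (hle _).trans ih
      have h₂ := h₁ n (π v)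
      rw [← Function.iterate_succ_apply, hv, (hπ v hvo).2] at h₂
      have h₃ := h.generic.edgeTime_pos (hπ v hvo).1
      exact absurd h₂ (not_le.2 (lt_add_of_pos_right _ h₃))
    · obtain ⟨a, ha⟩ := hreach u
      obtain ⟨b, hb⟩ := hreach v
      exact ⟨a, b, ha.trans hb.symm⟩
  · refine h.gromovTwoProper (fun u v huv => ((hadj u v).1 huv).2) fun x a hxa => ?_
    have hst : ∀ i ≤ a, Γ.Adj (π^[i] x) (π^[i + 1] x) ∧ fppDist ω o (π^[i] x) =
        fppDist ω o (π^[i + 1] x) + edgeTime ω s(π^[i] x, π^[i + 1] x) := fun i hi => by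
      have := hπ _ (hxa i hi)
      rw [Function.iterate_succ_apply', Sym2.eq_swap]
      exact ⟨this.1.symm, this.2⟩
    refine isSeg_of_chainTime_le h.conn (fun i _ hi => (hst i hi.le).1) ?_
    have hsum : ∀ i ≤ a, chainTime ω (fun i => π^[i] x) 0 i + fppDist ω o (π^[i] x) =
        fppDist ω o x := by
      intro i hi
      induction i with
      | zero => simp [chainTime]
      | succ i ih =>
        rw [← ih (by omega), (hst i (by omega)).2, chainTime, chainTime,
          Finset.sum_Ico_succ_top (Nat.zero_le _)]
        ring
    have h₁ := fppDist_triangle (ω := ω) h.conn o (π^[a] x) x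
    rw [← hsum a le_rfl, add_comm] at h₁
    simpa only [Function.iterate_zero, id, fppDist_comm] using le_of_add_le_add_left h₁

/-! ### Rays and the backward tree -/

theorem lt_dist_of_lt (h : Regular ω o δ A C s₀) {σ : ℕ → V} {n : ℕ} (hσ : IsSeg ω σ 0 n)
    {s : ℕ} (hs : s₀ ≤ s) (hs' : Γ.dist o (σ 0) ≤ s) {i : ℕ} (hi : A * s < i) (hin : i ≤ n) :
    s < Γ.dist o (σ i) := by
  by_contra hcon
  have := h.coarse.shortExcursions h.conn h.generic hσ s hs 0 i le_rfl (Nat.zero_le _) hin hs'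
    (not_lt.1 hcon)
  omega

/-- After $Ar$ steps the ray has left the ball of radius $r$ for good, so its later points have
Gromov product at least $r/2$. -/
theorem fellow_ray (h : Regular ω o δ A C s₀) {σ : ℕ → V} (hσ : IsFPPRay ω σ) :
    Fellow Γ o σ σ := by
  intro R
  obtain ⟨s, hs⟩ := exists_nat_ge (2 * R)
  set r := max s (max s₀ (Γ.dist o (σ 0))) with hr
  have hsr : (s : ℝ) ≤ r := by exact_mod_cast le_max_left _ _
  refine ⟨A * r + 1, fun i j hi hj => ?_⟩
  wlog hij : i ≤ j generalizing i j
  · rw [gromovProduct_comm]; exact this j i hj hi (by omega)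
  have hseg := isFPPRay_iff.1 hσ j
  have := h.le_gromovProduct hij (hseg.mono (Nat.zero_le _) le_rfl) (s := r) (by omega)
    fun k hk hk' => (h.lt_dist_of_lt hseg (by omega) (by omega) (by omega) hk').le
  linarith

/-- An $\omega$-geodesic ray converges, so one accumulation point in the boundary is already the
limit. -/
theorem hasDirection_iff (h : Regular ω o δ A C s₀) {σ : ℕ → V} (hσ : IsFPPRay ω σ)
    (γ : GeodesicRay Γ) : HasDirection o σ γ.endpoint ↔ Fellow Γ o γ.toFun σ := by
  have hself := h.fellow_ray hσ
  have key : ∀ γ' : GeodesicRay Γ, AccumulatesOn o σ γ'.endpoint → Fellow Γ o γ'.toFun σ := by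
    rintro γ' ⟨v, hv, ht⟩
    rw [tendsto_vertex_iff_fellow h.hasDelta h.conn] at ht
    choose k hk using hv
    intro R
    obtain ⟨N, hN⟩ := hself (R + δ)
    obtain ⟨M, hM⟩ := ht (R + δ)
    -- The points $v_n$ go to infinity, so they eventually leave the initial piece of $\sigma$ up to
    -- time $N$, which is contained in the ball of radius $B$.
    obtain ⟨B, hB⟩ := ((Set.finite_Iic N).image fun i => Γ.dist o (σ i)).bddAbove
    obtain ⟨K, hK⟩ := ht (B + 1)
    have hkN : N ≤ k (max K M) := by
      by_contra hcon
      have h₁ := hB ⟨k (max K M), (not_le.1 hcon).le, rfl⟩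
      have h₂ := (hK (max K M) (max K M) (le_max_left _ _) (le_max_left _ _)).trans
        (gromovProduct_le_right h.conn _ _)
      rw [← hk] at h₂
      have h₃ : B + 1 ≤ Γ.dist o (σ (k (max K M))) := by exact_mod_cast h₂
      simp only at h₁
      omega
    refine ⟨max M N, fun i j hi hj => ?_⟩
    have h₁ := hM i (max K M) (le_of_max_le_left hi) (le_max_right _ _)
    rw [← hk] at h₁
    have := h.hasDelta.chain h₁ (hN _ j hkN (le_of_max_le_right hj))
    linarith
  constructor
  · intro hd
    exact key γ ((hd _).2 rfl)
  · intro hf ξ'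
    obtain ⟨γ', rfl⟩ : ∃ γ' : GeodesicRay Γ, γ'.endpoint = ξ' := Quotient.exists_rep ξ'
    constructor
    · intro hacc
      exact (endpoint_eq_iff_fellow (o := o) h.hasDelta h.conn _ _).2
        ((key γ' hacc).trans h.hasDelta hf.symm)
    · intro he
      rw [he]
      exact ⟨σ, fun n => ⟨n, rfl⟩, (tendsto_vertex_iff_fellow h.hasDelta h.conn γ σ).2 hf⟩

theorem hasDirection_shift (h : Regular ω o δ A C s₀) {σ : ℕ → V} (hσ : IsFPPRay ω σ)
    {ξ : Boundary Γ} (hd : HasDirection o σ ξ) (c : ℕ) : HasDirection o (fun n => σ (n + c)) ξ := by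
  obtain ⟨γ, rfl⟩ : ∃ γ : GeodesicRay Γ, γ.endpoint = ξ := Quotient.exists_rep ξ
  rw [h.hasDirection_iff hσ] at hd
  rw [h.hasDirection_iff (hσ.shift c)]
  intro R
  obtain ⟨N, hN⟩ := hd R
  exact ⟨N, fun i j hi hj => hN i (j + c) hi (by omega)⟩

/-- From every vertex there is a geodesic ray in a given direction. -/
theorem exists_ray (h : Regular ω o δ A C s₀) (v : V) (ξ : Boundary Γ) :
    ∃ σ : ℕ → V, σ 0 = v ∧ IsFPPRay ω σ ∧ HasDirection o σ ξ := by
  obtain ⟨γ, rfl⟩ : ∃ γ : GeodesicRay Γ, γ.endpoint = ξ := Quotient.exists_rep ξ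
  choose p hp using fun n => h.exists_geodesic v (γ.toFun n)
  have hfin : ∀ k, (Set.range fun n => (p n).getVert k).Finite := fun k => by
    refine (h.finite_ball v k).subset ?_
    rintro _ ⟨n, rfl⟩
    change Γ.dist v ((p n).getVert k) ≤ k
    refine (SimpleGraph.dist_le ((p n).take k)).trans ?_
    rw [SimpleGraph.Walk.take_length]
    omega
  obtain ⟨σ, hσ⟩ := exists_cluster_path (fun n k => (p n).getVert k) hfin
  have hlen : Tendsto (fun n => (p n).length) atTop atTop := by
    refine tendsto_atTop.2 fun b => ?_
    filter_upwards [eventually_ge_atTop (b + Γ.dist v (γ.toFun 0))] with n hn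
    have h₁ := SimpleGraph.dist_le (p n)
    have h₂ := h.conn.dist_triangle (u := γ.toFun 0) (v := v) (w := γ.toFun n)
    rw [γ.dist_of_le (Nat.zero_le n), Γ.dist_comm] at h₂
    omega
  have hσ0 : σ 0 = v := by
    obtain ⟨n, hn⟩ := (hσ 0).exists
    rw [← hn 0 le_rfl, (p n).getVert_zero]
  have hseg : ∀ k, IsSeg ω σ 0 k := by
    intro k
    obtain ⟨n, hn, hn'⟩ := ((hσ k).and_eventually (hlen.eventually_ge_atTop k)).exists
    have hs := ((hp n).isSeg h.conn).mono le_rfl hn'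
    refine ⟨fun i hi hi' => ?_, fun i j hi hij hj => ?_⟩
    · rw [← hn i hi'.le, ← hn (i + 1) hi']
      exact hs.1 i hi hi'
    · rw [← hn i (hij.trans hj), ← hn j hj, ← hs.2 i j hi hij hj]
      refine Finset.sum_congr rfl fun l hl => ?_
      rw [Finset.mem_Ico] at hl
      rw [hn l (by omega), hn (l + 1) (by omega)]
  have hray := isFPPRay_iff.2 hseg
  refine ⟨σ, hσ0, hray, (h.hasDirection_iff hray γ).2 (Fellow.symm fun R => ?_)⟩
  -- $\sigma(i)$ lies on an $\omega$-geodesic from $v$ to some far $\gamma(n)$. For $i>Ar$ the part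
  -- after $\sigma(i)$ is outside the ball of radius $r$, so $(\sigma(i)|\gamma(n))$ is large.
  obtain ⟨N, hN⟩ := γ.fellow (o := o) h.conn (R + δ)
  obtain ⟨s, hs⟩ := exists_nat_ge (2 * (R + δ))
  set r := max s (max s₀ (Γ.dist o v)) with hr
  have hsr : (s : ℝ) ≤ r := by exact_mod_cast le_max_left _ _
  refine ⟨max N (A * r + 1), fun i j hi hj => ?_⟩
  obtain ⟨n, ⟨hn, hn'⟩, hn''⟩ := (((hσ i).and_eventually
    (hlen.eventually_ge_atTop i)).and_eventually
    (eventually_ge_atTop N)).exists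
  have hs' := (hp n).isSeg h.conn
  have h₁ := h.le_gromovProduct hn' (hs'.mono (Nat.zero_le _) le_rfl) (s := r) (by omega)
    fun k hk hk' => (h.lt_dist_of_lt hs' (by omega) (by rw [(p n).getVert_zero]; omega)
      (by omega) hk').le
  rw [(p n).getVert_length, hn i le_rfl] at h₁
  have := h.hasDelta.chain (c := R + δ) (by linarith) (hN n j hn'' (le_of_max_le_left hj))
    (x := σ i)
  linarith

theorem ray_injective (hg : Generic ω) {σ : ℕ → V} (hσ : IsFPPRay ω σ) :
    Function.Injective σ := by
  intro i j hij
  rcases lt_trichotomy i j with hlt | rfl | hlt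
  · exact absurd hij ((isFPPRay_iff.1 hσ j).injOn hg (Nat.zero_le _) hlt le_rfl)
  · rfl
  · exact absurd hij.symm ((isFPPRay_iff.1 hσ i).injOn hg (Nat.zero_le _) hlt le_rfl)

/-- The parent is the next vertex on the unique ray to $\xi$. A tail of that ray is the ray from its
own first vertex, so the parent orbits are exactly the rays: injective, geodesic, and merging by
coalescence. -/
theorem backwardTree_isTree_and_gromovTwoProper (h : Regular ω o δ A C s₀) {ξ : Boundary Γ}
    (hξ : ω ∈ coalescenceEvent o ξ) :
    (backwardTree o ξ ω).IsTree ∧ GromovTwoProper (backwardTree o ξ ω) Γ o := by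
  obtain ⟨hex, hco⟩ := hξ
  choose r hr hru using hex
  have hsh : ∀ v n, r (r v n) = fun m => r v (m + n) := fun v n =>
    (hru (r v n) _ ⟨by simp, (hr v).2.1.shift n, h.hasDirection_shift (hr v).2.1 (hr v).2.2 n⟩).symm
  set π : V → V := fun v => r v 1 with hπ
  have hit : ∀ v n, π^[n] v = r v n := by
    intro v n
    induction n with
    | zero => exact (hr v).1.symm
    | succ n ih =>
      rw [Function.iterate_succ_apply', ih, hπ]
      simp only [hsh, Nat.add_comm 1 n]
  have hadj : ∀ u v, (backwardTree o ξ ω).Adj u v ↔ u ≠ v ∧ (π u = v ∨ π v = u) := by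
    intro u v
    constructor
    · intro huv
      refine ⟨huv.ne, ?_⟩
      obtain ⟨σ, hσ, hd, n, he⟩ := huv
      have hσn : r (σ n) = fun m => σ (m + n) :=
        (hru (σ n) _ ⟨by simp, hσ.shift n, h.hasDirection_shift hσ hd n⟩).symm
      have : π (σ n) = σ (n + 1) := by simp only [hπ, hσn, Nat.add_comm 1 n]
      rcases Sym2.eq_iff.1 he with ⟨rfl, rfl⟩ | ⟨rfl, rfl⟩
      · exact Or.inl this
      · exact Or.inr this
    · have key : ∀ u, (backwardTree o ξ ω).Adj u (π u) := fun u =>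
        ⟨r u, (hr u).2.1, (hr u).2.2, 0, by rw [(hr u).1]⟩
      rintro ⟨-, rfl | rfl⟩
      · exact key u
      · exact (key v).symm
  have : Nonempty V := ⟨o⟩
  refine ⟨isTree_of_parent hadj (fun v n hv => ?_) fun u v => ?_,
    h.gromovTwoProper (fun u v huv => ((hadj u v).1 huv).2) fun x a _ => ?_⟩
  · rw [hit] at hv
    have := ray_injective h.generic (hr v).2.1 (hv.trans (hr v).1.symm)
    omega
  · obtain ⟨a, b, hab⟩ := hco _ _ (hr u).2.1 (hr u).2.2 (hr v).2.1 (hr v).2.2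
    exact ⟨a, b, by rw [hit, hit]; exact hab 0⟩
  · rw [show (fun i => π^[i] x) = r x from funext fun i => hit x i]
    exact isFPPRay_iff.1 (hr x).2.1 a

end Regular

end FPP

/-! ### Barriers: configurations that force geodesics through a vertex -/

namespace FPP

open HypGraph

variable {V : Type*} {Γ : SimpleGraph V} {ω : Config Γ}

/-- Around `γ N`, the edges of the ray `γ` at distance less than `L` are shorter than all
other edges. -/
structure Barrier (ω : Config Γ) (γ : GeodesicRay Γ) (N L K : ℕ) (l h H : ℝ≥0) : Prop where
  low : ∀ i, N - L ≤ i → i < N + L → edgeTime ω s(γ.toFun i, γ.toFun (i + 1)) ≤ l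
  high : ∀ u v, Γ.Adj u v → Γ.dist (γ.toFun N) u ≤ K → Γ.dist (γ.toFun N) v ≤ K →
    (∀ i, N - L ≤ i → i < N + L → s(u, v) ≠ s(γ.toFun i, γ.toFun (i + 1))) →
      h ≤ edgeTime ω s(u, v)
  upper : ∀ u v, Γ.Adj u v → Γ.dist (γ.toFun N) u ≤ K → Γ.dist (γ.toFun N) v ≤ K →
    edgeTime ω s(u, v) ≤ H

theorem fppDist_le_mul_dist (hc : Γ.Connected) {o x y : V} {K : ℕ} {H : ℝ≥0}
    (hH : ∀ u v, Γ.Adj u v → Γ.dist o u ≤ K → Γ.dist o v ≤ K → edgeTime ω s(u, v) ≤ H)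
    (hK : Γ.dist o x + Γ.dist x y ≤ K) : fppDist ω x y ≤ H * Γ.dist x y := by
  obtain ⟨p, hp⟩ := exists_wordGeodesic hc x y
  refine (fppDist_le p).trans ?_
  rw [passageTime_eq_chainTime, chainTime, ← hp]
  have hball : ∀ k, k ≤ p.length → Γ.dist o (p.getVert k) ≤ K := by
    intro k hk
    have h₁ := hp.dist_getVert (Nat.zero_le k) hk
    have h₂ := hc.dist_triangle (u := o) (v := x) (w := p.getVert k)
    rw [p.getVert_zero] at h₁
    have : p.length = Γ.dist x y := hp
    omega
  calc _ ≤ ∑ _k ∈ Finset.Ico 0 p.length, H := Finset.sum_le_sum fun k hk => by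
        rw [Finset.mem_Ico] at hk
        exact hH _ _ (p.adj_getVert_succ hk.2) (hball k hk.2.le) (hball (k + 1) hk.2)
    _ = _ := by simp [mul_comm]

theorem adj_of_dist_eq_one {γ : GeodesicRay Γ} (i : ℕ) : Γ.Adj (γ.toFun i) (γ.toFun (i + 1)) :=
  SimpleGraph.dist_eq_one_iff_adj.1 (γ.dist_eq i 1)

/-- An `ω`-geodesic ray that crosses a barrier passes through its centre. -/
theorem Barrier.exists_eq (hc : Γ.Connected) {δ ε : ℝ} (hδ : HasDelta Γ δ) (hg : Generic ω)
    {γ : GeodesicRay Γ} {N L K A : ℕ} {C l h H : ℝ≥0} (hB : Barrier ω γ N L K l h H)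
    (hco : Coarse ω (γ.toFun N) A C L) (hth : LargeThreshold δ ε A L) (hK : (A + 2) * L ≤ K)
    (hlh : l < h) (hnum : 2 * ((H : ℝ) + h) * (2 * ε * L + 4 * δ) < (h - l) * L) (hhH : h ≤ H)
    (hL : 0 < L) (hLN : L ≤ N) {σ : ℕ → V} (hσ : IsFPPRay ω σ) (hf : Fellow Γ (γ.toFun N) γ.toFun σ)
    (hleft : Γ.dist (γ.toFun N) (σ 0) = Γ.dist (γ.toFun (N - L)) (σ 0) + L)
    (hfar : L < Γ.dist (γ.toFun N) (σ 0)) : ∃ n, σ n = γ.toFun N := by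
  set o := γ.toFun N with ho
  -- $\kappa$ bounds how far from $\gamma(N\pm L)$ the ray enters and leaves the ball of radius $L$:
  -- points at distance $L$ from $o$ with Gromov product at least $(1-\varepsilon)L-2\delta$ are at
  -- most $2\varepsilon L+4\delta$ apart.
  set κ : ℝ := 2 * ε * L + 4 * δ with hκ
  have hδ0 := hδ.1
  have hε0 := hth.1
  have hL0 : (0 : ℝ) < L := by exact_mod_cast hL
  have hlh' : (l : ℝ) < h := by exact_mod_cast hlh
  have hl0 : (0 : ℝ) ≤ l := l.2
  have hhH' : (h : ℝ) ≤ H := by exact_mod_cast hhH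
  have hκ0 : 0 ≤ κ := by positivity
  have hκL : 2 * κ < L := by
    by_contra hcon
    have h₁ : (h - l : ℝ) * L ≤ (H + h) * L := by gcongr; linarith
    have h₂ : ((H : ℝ) + h) * L ≤ (H + h) * (2 * κ) := by
      gcongr
      exact not_lt.1 hcon
    linarith
  have hoL : Γ.dist o (γ.toFun (N - L)) = L := by
    rw [Γ.dist_comm, ho, γ.dist_of_le (by omega)]; omega
  have hoR : Γ.dist o (γ.toFun (N + L)) = L := by rw [ho, γ.dist_of_le (by omega)]; omega
  have hLR : Γ.dist (γ.toFun (N - L)) (γ.toFun (N + L)) = L + L := by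
    rw [γ.dist_of_le (by omega)]; omega
  have hgl : gromovProduct Γ o (γ.toFun (N - L)) (σ 0) = L := by
    unfold gromovProduct
    rw [hleft, hoL]
    push_cast
    ring
  -- the ray is eventually on the right
  obtain ⟨J, hJ⟩ : ∃ J, ∀ j, J ≤ j →
      (L : ℝ) - δ ≤ gromovProduct Γ o (σ j) (γ.toFun (N + L)) ∧ L < Γ.dist o (σ j) := by
    obtain ⟨J, hJ⟩ := hf (L + 1)
    refine ⟨J, fun j hj => ⟨?_, ?_⟩⟩
    · obtain ⟨M, hM₁, hM₂⟩ : ∃ M, J ≤ M ∧ N + L ≤ M := ⟨_, le_max_left _ _, le_max_right _ _⟩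
      have h₁ := hJ M j hM₁ hj
      rw [gromovProduct_comm] at h₁
      have h₂ : gromovProduct Γ o (γ.toFun M) (γ.toFun (N + L)) = L := by
        unfold gromovProduct
        rw [hoR, Γ.dist_comm (u := γ.toFun M), γ.dist_of_le hM₂, ho,
          γ.dist_of_le (by omega), Nat.cast_sub (by omega), Nat.cast_sub (by omega)]
        push_cast
        ring
      exact hδ.chain (by linarith) h₂.ge
    · have h₁ := (hJ J j le_rfl hj).trans (gromovProduct_le_right hc _ _)
      have : (L : ℝ) < Γ.dist o (σ j) := by linarith
      exact_mod_cast this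
  have hseg : ∀ n, IsSeg ω σ 0 n := isFPPRay_iff.1 hσ
  have hadj : ∀ n, Γ.Adj (σ n) (σ (n + 1)) := fun n => (hseg (n + 1)).1 n (Nat.zero_le _) (by omega)
  have hexc : ∀ n, ShortExcursions Γ o A L σ 0 n := fun n =>
    hco.shortExcursions hc hg (hseg n)
  have hout : ∀ i j, i ≤ j → (∀ k, i ≤ k → k ≤ j → L ≤ Γ.dist o (σ k)) →
      (1 - ε) * L ≤ gromovProduct Γ o (σ i) (σ j) := fun i j hij hk =>
    ((hexc j).mono (Nat.zero_le i) le_rfl).le_gromovProduct hδ hth (j - i) i j L rfl hij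
      (fun k _ _ => hadj k) le_rfl hk
  have hstep : ∀ k, Γ.dist o (σ k) ≤ Γ.dist o (σ (k + 1)) + 1 ∧
      Γ.dist o (σ (k + 1)) ≤ Γ.dist o (σ k) + 1 := fun k => by
    have h₁ := (hadj k).diff_dist_adj (u := o)
    omega
  classical
  have hεL0 : 0 ≤ ε * L := by positivity
  have hεL : 2 * (ε * L) + 4 * δ ≤ κ := by rw [hκ]; linarith
  -- the ray enters the ball of radius `L`
  have hhit : ∃ i, Γ.dist o (σ i) ≤ L := by
    -- A ray avoiding the ball would join the two sides with positive Gromov product, but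
    -- $\gamma(N-L)$ and $\gamma(N+L)$ have product $0$ as seen from the point $o=\gamma(N)$ between
    -- them.
    by_contra! hcon
    have h₁ := hout 0 J (Nat.zero_le _) fun k _ _ => (hcon k).le
    have h₂ := hδ.chain (c := (1 - ε) * L) (x := γ.toFun (N - L)) (by rw [hgl]; linarith) h₁
    have h₃ := hδ.chain (c := (1 - ε) * L - δ) h₂ (z := γ.toFun (N + L))
      (by linarith [(hJ J le_rfl).1])
    have h₄ : gromovProduct Γ o (γ.toFun (N - L)) (γ.toFun (N + L)) = 0 := by
      unfold gromovProduct
      rw [hoL, hoR, hLR]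
      push_cast
      ring
    rw [h₄] at h₃
    linarith
  set a := Nat.find hhit with ha
  have haL : Γ.dist o (σ a) ≤ L := Nat.find_spec hhit
  have hamin : ∀ i, i < a → L < Γ.dist o (σ i) := fun i hi => not_le.1 (Nat.find_min hhit hi)
  obtain ⟨b, hab, hbL, hbmax⟩ : ∃ b, a ≤ b ∧ Γ.dist o (σ b) ≤ L ∧
      ∀ i, b < i → L < Γ.dist o (σ i) := by
    have hJ' : ∀ i, Γ.dist o (σ i) ≤ L → i ≤ J := fun i hi => by
      by_contra hcon
      exact absurd (hJ i (by omega)).2 (not_lt.2 hi)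
    refine ⟨Nat.findGreatest (fun i => Γ.dist o (σ i) ≤ L) J, Nat.le_findGreatest (hJ' a haL) haL,
      Nat.findGreatest_spec (P := fun i => Γ.dist o (σ i) ≤ L) (hJ' a haL) haL, fun i hi => ?_⟩
    by_contra hcon
    exact absurd (Nat.le_findGreatest (P := fun i => Γ.dist o (σ i) ≤ L) (hJ' i (not_lt.1 hcon))
      (not_lt.1 hcon)) (not_le.2 hi)
  have haL' : Γ.dist o (σ a) = L := by
    refine le_antisymm haL ?_
    have ha0 : a ≠ 0 := fun h0 => by rw [h0] at haL; omega
    have h₁ := hamin (a - 1) (by omega)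
    have h₂ := hstep (a - 1)
    rw [Nat.sub_add_cancel (by omega)] at h₂
    omega
  have hbL' : Γ.dist o (σ b) = L := by
    have h₁ := hbmax (b + 1) (by omega)
    have h₂ := hstep b
    omega
  have hda : (Γ.dist (σ a) (γ.toFun (N - L)) : ℝ) ≤ κ := by
    have h₁ := hout 0 a (Nat.zero_le _) fun k _ hk => by
      rcases hk.eq_or_lt with rfl | hk
      · exact haL'.ge
      · exact (hamin k hk).le
    have h₂ := hδ.chain (c := (1 - ε) * L) (x := γ.toFun (N - L)) (by rw [hgl]; linarith) h₁
    unfold gromovProduct at h₂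
    rw [haL', hoL, Γ.dist_comm] at h₂
    linarith
  have hdb : (Γ.dist (γ.toFun (N + L)) (σ b) : ℝ) ≤ κ := by
    have h₁ := hout b (max b J) (le_max_left _ _) fun k hk _ => by
      rcases hk.eq_or_lt with rfl | hk
      · exact hbL'.ge
      · exact (hbmax k hk).le
    have h₂ := hδ.chain (c := (1 - ε) * L - δ) (by linarith) (z := γ.toFun (N + L))
      (by linarith [(hJ (max b J) (le_max_right _ _)).1]) (x := σ b) (y := σ (max b J))
    unfold gromovProduct at h₂
    rw [hbL', hoR, Γ.dist_comm] at h₂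
    linarith
  -- At most $AL$ steps are made inside, so this part stays within $(A+1)L$; the spare $L$ in $K$
  -- leaves room for the connecting word geodesics of length at most $\kappa$.
  have hball : ∀ k, a ≤ k → k ≤ b → Γ.dist o (σ k) ≤ (A + 1) * L := by
    intro k hk hk'
    have h₁ := hexc b L le_rfl a b (Nat.zero_le _) hab le_rfl haL hbL
    have h₂ := dist_le_of_chain σ hk fun i _ _ => hadj i
    have h₃ := hc.dist_triangle (u := o) (v := σ a) (w := σ k)
    have : (A + 1) * L = A * L + L := by ring
    omega
  by_contra! hno
  -- the last visit to the left half of the segment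
  obtain ⟨i, p, κ₁, hai, hib, hp1, hpL, hd₁, hκ₁0, hκ₁, hcase₁, hlast⟩ : ∃ (i p : ℕ) (κ₁ : ℝ),
      a ≤ i ∧ i ≤ b ∧ 1 ≤ p ∧ p ≤ L ∧ (Γ.dist (σ i) (γ.toFun (N - p)) : ℝ) ≤ κ₁ ∧ 0 ≤ κ₁ ∧ κ₁ ≤ κ ∧
      (κ₁ = 0 ∨ p = L) ∧ ∀ k, i < k → k ≤ b → ∀ p, 1 ≤ p → p ≤ L → σ k ≠ γ.toFun (N - p) := by
    by_cases hex : ∃ k, (a ≤ k ∧ k ≤ b) ∧ ∃ p, 1 ≤ p ∧ p ≤ L ∧ σ k = γ.toFun (N - p)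
    · obtain ⟨k, ⟨⟨hk₁, hk₂⟩, p, hp1, hpL, hk₃⟩, hmax⟩ : ∃ k, ((a ≤ k ∧ k ≤ b) ∧
          ∃ p, 1 ≤ p ∧ p ≤ L ∧ σ k = γ.toFun (N - p)) ∧ ∀ k', k < k' → ¬ ((a ≤ k' ∧ k' ≤ b) ∧
          ∃ p, 1 ≤ p ∧ p ≤ L ∧ σ k' = γ.toFun (N - p)) := by
        obtain ⟨k₀, hk₀⟩ := hex
        set P : ℕ → Prop := fun k => (a ≤ k ∧ k ≤ b) ∧
          ∃ p, 1 ≤ p ∧ p ≤ L ∧ σ k = γ.toFun (N - p) with hP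
        refine ⟨Nat.findGreatest P b, Nat.findGreatest_spec (P := P) hk₀.1.2 hk₀,
          fun k' hk' hP' => ?_⟩
        exact absurd (Nat.le_findGreatest (P := P) hP'.1.2 hP') (not_le.2 hk')
      refine ⟨k, p, 0, hk₁, hk₂, hp1, hpL, by rw [hk₃]; simp, le_rfl, hκ0, Or.inl rfl,
        fun k' hk' hk'b p' hp' hp'L he => ?_⟩
      exact hmax k' hk' ⟨⟨by omega, hk'b⟩, p', hp', hp'L, he⟩
    · refine ⟨a, L, κ, le_rfl, hab, hL, le_rfl, hda, hκ0, le_rfl, Or.inr rfl,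
        fun k' hk' hk'b p' hp' hp'L he => ?_⟩
      exact hex ⟨k', ⟨hk'.le, hk'b⟩, p', hp', hp'L, he⟩
  -- the next visit to the right half of the segment
  obtain ⟨j, q, κ₂, hij, hjb, hq1, hqL, hd₂, hκ₂0, hκ₂, hcase₂, hfirst⟩ : ∃ (j q : ℕ) (κ₂ : ℝ),
      i ≤ j ∧ j ≤ b ∧ 1 ≤ q ∧ q ≤ L ∧ (Γ.dist (γ.toFun (N + q)) (σ j) : ℝ) ≤ κ₂ ∧ 0 ≤ κ₂ ∧ κ₂ ≤ κ ∧
      (κ₂ = 0 ∨ q = L) ∧ ∀ k, i ≤ k → k < j → ∀ q, 1 ≤ q → q ≤ L → σ k ≠ γ.toFun (N + q) := by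
    by_cases hex : ∃ k, (i ≤ k ∧ k ≤ b) ∧ ∃ q, 1 ≤ q ∧ q ≤ L ∧ σ k = γ.toFun (N + q)
    · obtain ⟨⟨hk₁, hk₂⟩, q, hq1, hqL, hk₃⟩ := Nat.find_spec hex
      refine ⟨Nat.find hex, q, 0, hk₁, hk₂, hq1, hqL, by rw [hk₃]; simp, le_rfl, hκ0, Or.inl rfl,
        fun k' hk' hk'b q' hq' hq'L he => ?_⟩
      exact Nat.find_min hex hk'b ⟨⟨hk', by omega⟩, q', hq', hq'L, he⟩
    · refine ⟨b, L, κ, hib, le_rfl, hL, le_rfl, hdb, hκ0, le_rfl, Or.inr rfl,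
        fun k' hk' hk'b q' hq' hq'L he => ?_⟩
      exact hex ⟨k', ⟨hk', hk'b.le⟩, q', hq', hq'L, he⟩
  have hK' : (A + 2) * L = (A + 1) * L + L := by ring
  -- in between only long edges are used
  have hhigh : ∀ k, i ≤ k → k < j → h ≤ edgeTime ω s(σ k, σ (k + 1)) := by
    intro k hik hkj
    have hb₁ := hball k (by omega) (by omega)
    have hb₂ := hball (k + 1) (by omega) (by omega)
    refine hB.high _ _ (hadj k) (by rw [← ho]; omega) (by rw [← ho]; omega) fun m hm hm' he => ?_
    have hnl : ∀ x, N - L ≤ x → x ≤ N → σ (k + 1) ≠ γ.toFun x := by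
      intro x hx hx' he
      rcases hx'.eq_or_lt with rfl | hx'
      · exact hno _ he
      · exact hlast (k + 1) (by omega) (by omega) (N - x) (by omega) (by omega)
          (by rw [he]; congr 1; omega)
    have hnr : ∀ x, N ≤ x → x ≤ N + L → σ k ≠ γ.toFun x := by
      intro x hx hx' he
      rcases hx.eq_or_lt with rfl | hx
      · exact hno _ he
      · exact hfirst k hik hkj (x - N) (by omega) (by omega) (by rw [he]; congr 1; omega)
    rcases Sym2.eq_iff.1 he with ⟨h₁, h₂⟩ | ⟨h₁, h₂⟩
    · have : ¬ m + 1 ≤ N := fun hx => hnl (m + 1) (by omega) hx h₂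
      exact hnr m (by omega) (by omega) h₁
    · have : ¬ m ≤ N := fun hx => hnl m (by omega) hx h₂
      exact hnr (m + 1) (by omega) (by omega) h₁
  have hlower : (h : ℝ) * (j - i : ℕ) ≤ chainTime ω σ i j := by
    have : h * (j - i : ℕ) ≤ chainTime ω σ i j := by
      calc h * (j - i : ℕ) = ∑ _k ∈ Finset.Ico i j, h := by simp [mul_comm]
        _ ≤ _ := Finset.sum_le_sum fun k hk => by
          rw [Finset.mem_Ico] at hk
          exact hhigh k hk.1 hk.2
    exact_mod_cast this
  rw [(hseg j).2 i j (Nat.zero_le _) hij le_rfl] at hlower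
  have hup₁ : (fppDist ω (σ i) (γ.toFun (N - p)) : ℝ) ≤ H * κ₁ := by
    have h₀ := hball i hai hib
    have h₁ : Γ.dist (σ i) (γ.toFun (N - p)) ≤ L := by
      have : (Γ.dist (σ i) (γ.toFun (N - p)) : ℝ) ≤ L := by linarith
      exact_mod_cast this
    have h₂ := fppDist_le_mul_dist (ω := ω) hc (y := γ.toFun (N - p)) hB.upper (x := σ i)
      (by rw [← ho]; omega)
    have h₃ : (fppDist ω (σ i) (γ.toFun (N - p)) : ℝ) ≤ H * Γ.dist (σ i) (γ.toFun (N - p)) := by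
      exact_mod_cast h₂
    exact h₃.trans (mul_le_mul_of_nonneg_left hd₁ H.2)
  have hup₂ : (fppDist ω (γ.toFun (N + q)) (σ j) : ℝ) ≤ H * κ₂ := by
    have h₀ := hball j (by omega) hjb
    have h₁ : Γ.dist (γ.toFun (N + q)) (σ j) ≤ L := by
      have : (Γ.dist (γ.toFun (N + q)) (σ j) : ℝ) ≤ L := by linarith
      exact_mod_cast this
    have h₂ := fppDist_le_mul_dist (ω := ω) hc (y := γ.toFun (N + q)) hB.upper (x := σ j)
      (by rw [← ho, Γ.dist_comm (u := σ j)]; omega)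
    rw [fppDist_comm, Γ.dist_comm] at h₂
    have h₃ : (fppDist ω (γ.toFun (N + q)) (σ j) : ℝ) ≤ H * Γ.dist (γ.toFun (N + q)) (σ j) := by
      exact_mod_cast h₂
    exact h₃.trans (mul_le_mul_of_nonneg_left hd₂ H.2)
  have hmid : (fppDist ω (γ.toFun (N - p)) (γ.toFun (N + q)) : ℝ) ≤ l * (p + q) := by
    have hch : IsChain Γ γ.toFun (N - p) (N + q) := fun i _ _ => adj_of_dist_eq_one i
    have h₁ : chainTime ω γ.toFun (N - p) (N + q) ≤ ∑ _k ∈ Finset.Ico (N - p) (N + q), l :=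
      Finset.sum_le_sum fun k hk => by
        rw [Finset.mem_Ico] at hk
        exact hB.low k (by omega) (by omega)
    have h₂ := (hch.fppDist_le (ω := ω) (by omega)).trans h₁
    rw [Finset.sum_const, Nat.card_Ico, show N + q - (N - p) = p + q by omega, nsmul_eq_mul,
      mul_comm] at h₂
    exact_mod_cast h₂
  have htri : (fppDist ω (σ i) (σ j) : ℝ) ≤ fppDist ω (σ i) (γ.toFun (N - p)) +
      fppDist ω (γ.toFun (N - p)) (γ.toFun (N + q)) + fppDist ω (γ.toFun (N + q)) (σ j) := by
    have h₁ := fppDist_triangle (ω := ω) hc (σ i) (γ.toFun (N - p)) (σ j)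
    have h₂ := fppDist_triangle (ω := ω) hc (γ.toFun (N - p)) (γ.toFun (N + q)) (σ j)
    have := h₁.trans (add_le_add_right h₂ _)
    rw [← add_assoc] at this
    exact_mod_cast this
  have hlen : (p : ℝ) + q - κ₁ - κ₂ ≤ (j - i : ℕ) := by
    have h₁ : (Γ.dist (σ i) (σ j) : ℝ) ≤ (j - i : ℕ) := by
      exact_mod_cast dist_le_of_chain σ hij fun k _ _ => hadj k
    have h₂ := dist_triangle_real hc (γ.toFun (N - p)) (σ i) (γ.toFun (N + q))
    have h₃ := dist_triangle_real hc (σ i) (σ j) (γ.toFun (N + q))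
    rw [γ.dist_of_le (by omega), show N + q - (N - p) = p + q by omega,
      Γ.dist_comm (u := γ.toFun (N - p))] at h₂
    rw [Γ.dist_comm (u := σ j)] at h₃
    push_cast at h₂
    linarith
  -- The ray pays at least $h$ for each of its $j-i\ge p+q-\kappa_1-\kappa_2$ steps, while the
  -- detour along $\gamma$ costs at most $l(p+q)+H(\kappa_1+\kappa_2)$. With two genuine visits the
  -- right side vanishes; otherwise $p+q\ge L$, against the numerical hypothesis.
  have hfin : ((h : ℝ) - l) * (p + q) ≤ (H + h) * (κ₁ + κ₂) := by
    have := mul_le_mul_of_nonneg_left hlen h.2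
    change (h : ℝ) * _ ≤ h * _ at this
    linarith
  have hp1' : (1 : ℝ) ≤ p := by exact_mod_cast hp1
  have hq1' : (1 : ℝ) ≤ q := by exact_mod_cast hq1
  have hbig : (L : ℝ) ≤ p + q → False := fun hpq => by
    have h₁ : ((h : ℝ) - l) * L ≤ (h - l) * (p + q) :=
      mul_le_mul_of_nonneg_left hpq (by linarith)
    have h₂ : ((H : ℝ) + h) * (κ₁ + κ₂) ≤ (H + h) * (2 * κ) :=
      mul_le_mul_of_nonneg_left (by linarith) (by positivity)
    linarith
  rcases hcase₁ with rfl | rfl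
  · rcases hcase₂ with rfl | rfl
    · have : 0 < ((h : ℝ) - l) * (p + q) := mul_pos (by linarith) (by linarith)
      rw [add_zero, mul_zero] at hfin
      exact absurd this (not_lt.2 hfin)
    · exact hbig (by linarith)
  · exact hbig (by linarith)

end FPP

/-! ### Independent edge lengths -/

namespace FPP

open ProbabilityTheory

section Product

variable {ι : Type*} (ρ : Measure ℝ≥0) [IsProbabilityMeasure ρ]

/-- The law of a family of independent lengths. -/
noncomputable abbrev prodLaw (ι : Type*) (ρ : Measure ℝ≥0) [IsProbabilityMeasure ρ] :
    Measure (ι → ℝ≥0) :=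
  Measure.infinitePi (fun _ : ι => ρ)

/-- The event `E` depends only on the coordinates in `F`. -/
def IsLocal (E : Set (ι → ℝ≥0)) (F : Finset ι) : Prop :=
  ∀ ω ω' : ι → ℝ≥0, (∀ e ∈ F, ω e = ω' e) → ω ∈ E → ω' ∈ E

theorem IsLocal.mono {E : Set (ι → ℝ≥0)} {F F' : Finset ι} (h : IsLocal E F) (hF : F ⊆ F') :
    IsLocal E F' :=
  fun ω ω' hω => h ω ω' fun e he => hω e (hF he)

theorem IsLocal.inter {E E' : Set (ι → ℝ≥0)} {F : Finset ι} (h : IsLocal E F)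
    (h' : IsLocal E' F) : IsLocal (E ∩ E') F :=
  fun ω ω' hω hmem => ⟨h ω ω' hω hmem.1, h' ω ω' hω hmem.2⟩

theorem IsLocal.iInter {κ : Sort*} {E : κ → Set (ι → ℝ≥0)} {F : Finset ι}
    (h : ∀ k, IsLocal (E k) F) : IsLocal (⋂ k, E k) F :=
  fun ω ω' hω hmem => Set.mem_iInter.2 fun k => h k ω ω' hω (Set.mem_iInter.1 hmem k)

theorem iIndepFun_coord : iIndepFun (fun (e : ι) (ω : ι → ℝ≥0) => ω e) (prodLaw ι ρ) :=
  iIndepFun_infinitePi (X := fun _ : ι => (id : ℝ≥0 → ℝ≥0)) fun _ => measurable_id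

/-- A local measurable event is the preimage of a measurable event of finitely many coordinates,
obtained by extending these coordinates by zero. -/
theorem IsLocal.measure_inter {E E' : Set (ι → ℝ≥0)} {F F' : Finset ι} (hE : MeasurableSet E)
    (hE' : MeasurableSet E') (h : IsLocal E F) (h' : IsLocal E' F') (hd : Disjoint F F') :
    prodLaw ι ρ (E ∩ E') = prodLaw ι ρ E * prodLaw ι ρ E' := by
  classical
  have hind := (iIndepFun_coord (ι := ι) ρ).indepFun_finset F F' hd fun e => measurable_pi_apply e
  have key : ∀ {E : Set (ι → ℝ≥0)} {F : Finset ι}, MeasurableSet E → IsLocal E F →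
      ∃ E₀ : Set (F → ℝ≥0), MeasurableSet E₀ ∧
        E = (fun (ω : ι → ℝ≥0) (e : F) => ω e) ⁻¹' E₀ := by
    intro E F hE h
    let ext : (F → ℝ≥0) → ι → ℝ≥0 := fun x e => if he : e ∈ F then x ⟨e, he⟩ else 0
    have hext : Measurable ext := by
      refine measurable_pi_lambda _ fun e => ?_
      by_cases he : e ∈ F
      · simpa only [ext, dif_pos he] using measurable_pi_apply _
      · simpa only [ext, dif_neg he] using measurable_const
    refine ⟨ext ⁻¹' E, hext hE, ?_⟩
    ext ω
    have hag : ∀ e ∈ F, ω e = ext (fun e : F => ω e) e := fun e he => by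
      simp only [ext, dif_pos he]
    exact ⟨fun hω => h _ _ hag hω, fun hω => h _ _ (fun e he => (hag e he).symm) hω⟩
  obtain ⟨E₀, hE₀, rfl⟩ := key hE h
  obtain ⟨E₁, hE₁, rfl⟩ := key hE' h'
  exact hind.measure_inter_preimage_eq_mul _ _ hE₀ hE₁

theorem iIndepSet_of_isLocal {E : ℕ → Set (ι → ℝ≥0)} {F : ℕ → Finset ι}
    (hE : ∀ k, MeasurableSet (E k)) (h : ∀ k, IsLocal (E k) (F k))
    (hd : ∀ j k, j < k → Disjoint (F j) (F k)) : iIndepSet E (prodLaw ι ρ) := by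
  classical
  have hd' : ∀ j k, j ≠ k → Disjoint (F j) (F k) := fun j k hjk => by
    rcases lt_or_gt_of_ne hjk with hlt | hlt
    · exact hd j k hlt
    · exact (hd k j hlt).symm
  rw [iIndepSet_iff_meas_biInter hE]
  intro s
  induction s using Finset.induction_on with
  | empty => simp
  | insert k s hk ih =>
    rw [Finset.set_biInter_insert, Finset.prod_insert hk, ← ih]
    refine (h k).measure_inter (F' := s.biUnion F) ρ (hE k)
      (Finset.measurableSet_biInter s fun j _ => hE j) ?_ ?_
    · exact IsLocal.iInter fun j => IsLocal.iInter fun hj =>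
        (h j).mono (Finset.subset_biUnion_of_mem F hj)
    · rw [Finset.disjoint_biUnion_right]
      intro j hj
      exact hd' k j fun hkj => hk (hkj ▸ hj)

theorem measurable_sum_coord (P : Finset ι) : Measurable fun ω : ι → ℝ≥0 => ∑ e ∈ P, ω e :=
  Finset.measurable_sum P fun e _ => measurable_pi_apply e

theorem map_coord (e : ι) : (prodLaw ι ρ).map (fun ω => ω e) = ρ :=
  (measurePreserving_eval_infinitePi (fun _ : ι => ρ) e).map_eq

/-- Fubini: the joint law is a product, and each fibre of the diagonal is a single point. -/
theorem measure_eq_zero_of_indepFun {Ω : Type*} [MeasurableSpace Ω] {μ : Measure Ω}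
    [IsProbabilityMeasure μ] {X Y : Ω → ℝ} (hX : Measurable X) (hY : Measurable Y)
    (h : IndepFun X Y μ) (hat : ∀ x, μ.map X {x} = 0) : μ {ω | X ω = Y ω} = 0 := by
  have : IsProbabilityMeasure (μ.map Y) := Measure.isProbabilityMeasure_map hY.aemeasurable
  have : IsProbabilityMeasure (μ.map X) := Measure.isProbabilityMeasure_map hX.aemeasurable
  have hprod := (indepFun_iff_map_prod_eq_prod_map_map hX.aemeasurable hY.aemeasurable).1
    h.symm.symm
  have hms : MeasurableSet {p : ℝ × ℝ | p.1 = p.2} :=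
    measurableSet_eq_fun measurable_fst measurable_snd
  have h₁ : μ {ω | X ω = Y ω} = μ.map (fun ω => (X ω, Y ω)) {p : ℝ × ℝ | p.1 = p.2} := by
    rw [Measure.map_apply (hX.prodMk hY) hms]
    rfl
  rw [h₁, hprod, Measure.prod_apply_symm hms,
    lintegral_eq_zero_iff (measurable_measure_prodMk_right hms)]
  filter_upwards with y
  have : (fun x => (x, y)) ⁻¹' {p : ℝ × ℝ | p.1 = p.2} = {y} := by ext; simp
  rw [this, hat]
  rfl

/-- For an edge $e$ in just one of the two sets, equality of the sums expresses $\omega(e)$ through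
other coordinates; $\omega(e)$ is independent of these and has no atoms. -/
theorem measure_sum_eq_sum (hρ : ∀ x, ρ {x} = 0) {P P' : Finset ι} (hPP : P ≠ P') :
    prodLaw ι ρ {ω | ∑ e ∈ P, ω e = ∑ e ∈ P', ω e} = 0 := by
  classical
  have key : ∀ {P P' : Finset ι} (e : ι), e ∈ P → e ∉ P' →
      prodLaw ι ρ {ω | ∑ e ∈ P, ω e = ∑ e ∈ P', ω e} = 0 := by
    intro P P' e he he'
    set F := (P ∪ P').erase e with hF
    let g : (F → ℝ≥0) → ℝ := fun x => ∑ i : F, ((if (i : ι) ∈ P' then (x i : ℝ) else 0) -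
      if (i : ι) ∈ P then (x i : ℝ) else 0)
    have hg : Measurable g := by
      refine Finset.measurable_sum _ fun i _ => Measurable.sub ?_ ?_
      · split_ifs
        · exact measurable_coe_nnreal_real.comp (measurable_pi_apply i)
        · exact measurable_const
      · split_ifs
        · exact measurable_coe_nnreal_real.comp (measurable_pi_apply i)
        · exact measurable_const
    have hind := (iIndepFun_coord (ι := ι) ρ).indepFun_finset {e} F (by simp [hF])
      fun e => measurable_pi_apply e
    have hind' := hind.comp (φ := fun x : ({e} : Finset ι) → ℝ≥0 =>
      ((x ⟨e, Finset.mem_singleton_self e⟩ : ℝ≥0) : ℝ)) (ψ := g)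
      (measurable_coe_nnreal_real.comp (measurable_pi_apply _)) hg
    have hmX : Measurable fun ω : ι → ℝ≥0 => (ω e : ℝ) :=
      measurable_coe_nnreal_real.comp (measurable_pi_apply e)
    have hmY : Measurable fun ω : ι → ℝ≥0 => g fun i : F => ω i :=
      hg.comp (measurable_pi_lambda _ fun i => measurable_pi_apply _)
    have h0 := measure_eq_zero_of_indepFun (μ := prodLaw ι ρ) hmX hmY hind' fun x => by
      rw [Measure.map_apply hmX (measurableSet_singleton x)]
      have h₁ : (fun ω : ι → ℝ≥0 => (ω e : ℝ)) ⁻¹' {x} ⊆ (fun ω => ω e) ⁻¹' {x.toNNReal} := by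
        intro ω hω
        simp only [Set.mem_preimage, Set.mem_singleton_iff] at hω ⊢
        rw [← hω, Real.toNNReal_coe]
      refine measure_mono_null h₁ ?_
      rw [← Measure.map_apply (measurable_pi_apply e) (measurableSet_singleton _), map_coord, hρ]
    refine measure_mono_null (fun ω hω => ?_) h0
    simp only [Set.mem_ofPred_eq] at hω ⊢
    have hω' : ∑ i ∈ P, (ω i : ℝ) = ∑ i ∈ P', (ω i : ℝ) := by exact_mod_cast hω
    have hsum : ∀ Q : Finset ι, Q.erase e ⊆ F →
        ∑ i : F, (if (i : ι) ∈ Q then (ω i : ℝ) else 0) = ∑ i ∈ Q.erase e, (ω i : ℝ) := by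
      intro Q hQ
      rw [Finset.sum_coe_sort F fun i => if i ∈ Q then (ω i : ℝ) else 0, ← Finset.sum_filter]
      congr 1
      ext i
      simp only [Finset.mem_filter, Finset.mem_erase]
      constructor
      · rintro ⟨h₁, h₂⟩
        exact ⟨(Finset.mem_erase.1 h₁).1, h₂⟩
      · rintro ⟨h₁, h₂⟩
        exact ⟨hQ (Finset.mem_erase.2 ⟨h₁, h₂⟩), h₂⟩
    have h₁ := hsum P (Finset.erase_subset_erase _ Finset.subset_union_left)
    have h₂ := hsum P' (Finset.erase_subset_erase _ Finset.subset_union_right)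
    rw [Finset.erase_eq_of_notMem he'] at h₂
    simp only [g, Finset.sum_sub_distrib]
    rw [h₁, h₂, ← hω', ← Finset.add_sum_erase P _ he]
    ring
  by_cases h : P ⊆ P'
  · obtain ⟨e, he, he'⟩ := Finset.not_subset.1 fun h' => hPP (h.antisymm h')
    simpa only [eq_comm] using key e he he'
  · obtain ⟨e, he, he'⟩ := Finset.not_subset.1 h
    exact key e he he'

/-! ### Chernoff bounds for sums of edge lengths. -/

/-- The moment generating function of the edge lengths. -/
noncomputable def edgeMgf (t : ℝ) : ℝ := mgf (fun x : ℝ≥0 => (x : ℝ)) ρ t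

theorem edgeMgf_nonneg (ρ : Measure ℝ≥0) (t : ℝ) : 0 ≤ edgeMgf ρ t := mgf_nonneg

theorem measurable_coe_coord (e : ι) : Measurable fun ω : ι → ℝ≥0 => (ω e : ℝ) :=
  measurable_coe_nnreal_real.comp (measurable_pi_apply e)

theorem mgf_coord (t : ℝ) (e : ι) :
    mgf (fun ω : ι → ℝ≥0 => (ω e : ℝ)) (prodLaw ι ρ) t = edgeMgf ρ t := by
  have := mgf_map (μ := prodLaw ι ρ) (Y := fun ω : ι → ℝ≥0 => ω e)
    (X := fun x : ℝ≥0 => (x : ℝ)) (measurable_pi_apply e).aemeasurable (t := t)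
    (by fun_prop)
  rw [map_coord] at this
  exact this.symm

theorem integrable_exp_coord {t : ℝ} (ht : Integrable (fun x : ℝ≥0 => Real.exp (t * x)) ρ) (e : ι) :
    Integrable (fun ω : ι → ℝ≥0 => Real.exp (t * ω e)) (prodLaw ι ρ) :=
  (measurePreserving_eval_infinitePi (fun _ : ι => ρ) e).integrable_comp_of_integrable ht

theorem iIndepFun_coe : iIndepFun (fun (e : ι) (ω : ι → ℝ≥0) => (ω e : ℝ)) (prodLaw ι ρ) :=
  iIndepFun_infinitePi (X := fun _ : ι => fun x : ℝ≥0 => (x : ℝ)) fun _ =>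
    measurable_coe_nnreal_real

theorem mgf_sum_coord (t : ℝ) (P : Finset ι) :
    mgf (∑ e ∈ P, fun ω : ι → ℝ≥0 => (ω e : ℝ)) (prodLaw ι ρ) t = edgeMgf ρ t ^ P.card := by
  rw [(iIndepFun_coe ρ).mgf_sum measurable_coe_coord,
    Finset.prod_congr rfl fun e _ => mgf_coord ρ t e,
    Finset.prod_const]

theorem integrable_exp_sum {t : ℝ} (ht : Integrable (fun x : ℝ≥0 => Real.exp (t * x)) ρ)
    (P : Finset ι) : Integrable (fun ω => Real.exp (t *
      (∑ e ∈ P, fun ω : ι → ℝ≥0 => (ω e : ℝ)) ω)) (prodLaw ι ρ) :=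
  (iIndepFun_coe ρ).integrable_exp_mul_sum measurable_coe_coord fun e _ =>
    integrable_exp_coord ρ ht e

theorem measureReal_le_sum {a : ℝ} (ha : 0 ≤ a)
    (hint : Integrable (fun x : ℝ≥0 => Real.exp (a * x)) ρ) (P : Finset ι) (x : ℝ) :
    (prodLaw ι ρ).real {ω | x ≤ ∑ e ∈ P, (ω e : ℝ)} ≤ Real.exp (-a * x) * edgeMgf ρ a ^ P.card := by
  have := measure_ge_le_exp_mul_mgf (X := ∑ e ∈ P, fun ω : ι → ℝ≥0 => (ω e : ℝ)) x ha
    (integrable_exp_sum ρ hint P)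
  rw [mgf_sum_coord] at this
  simpa only [Finset.sum_apply] using this

theorem integrable_exp_neg {t : ℝ} (ht : 0 ≤ t) :
    Integrable (fun x : ℝ≥0 => Real.exp (-t * x)) ρ := by
  refine Integrable.of_bound (C := 1) (by fun_prop) ?_
  filter_upwards with x
  rw [Real.norm_eq_abs, Real.abs_exp, Real.exp_le_one_iff]
  have := mul_nonneg ht x.2
  change -t * (x : ℝ) ≤ 0
  have h2 : (x : ℝ) = x.1 := rfl
  rw [h2]
  linarith

theorem measureReal_sum_le {t : ℝ} (ht : 0 ≤ t) (P : Finset ι) (x : ℝ) :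
    (prodLaw ι ρ).real {ω | ∑ e ∈ P, (ω e : ℝ) ≤ x} ≤
      Real.exp (t * x) * edgeMgf ρ (-t) ^ P.card := by
  have := measure_le_le_exp_mul_mgf (X := ∑ e ∈ P, fun ω : ι → ℝ≥0 => (ω e : ℝ)) x
    (by linarith : -t ≤ 0) (integrable_exp_sum ρ (integrable_exp_neg ρ ht) P)
  rw [mgf_sum_coord, neg_neg] at this
  simpa only [Finset.sum_apply] using this

/-- Dominated convergence; without an atom at $0$, $e^{-tx}\to0$ almost everywhere. This smallness
is what beats the exponential number of paths. -/
theorem tendsto_edgeMgf_neg (hρ : ρ {0} = 0) :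
    Tendsto (fun t : ℝ => edgeMgf ρ (-t)) atTop (𝓝 0) := by
  have h := tendsto_integral_filter_of_dominated_convergence (μ := ρ) (l := atTop)
    (F := fun (t : ℝ) (x : ℝ≥0) => Real.exp (-t * x)) (f := fun _ => 0) (fun _ => 1)
    (Eventually.of_forall fun t => by fun_prop) ?_ (integrable_const 1) ?_
  · rw [integral_zero] at h
    exact h
  · filter_upwards [eventually_ge_atTop 0] with t ht
    filter_upwards with x
    rw [Real.norm_eq_abs, Real.abs_exp, Real.exp_le_one_iff]
    have := mul_nonneg ht x.coe_nonneg
    linarith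
  · have hpos : ∀ᵐ x ∂ρ, x ≠ 0 := by
      rw [ae_iff]
      simpa using hρ
    filter_upwards [hpos] with x hx
    have hx' : (0 : ℝ) < x := by exact_mod_cast pos_iff_ne_zero.2 hx
    refine Real.tendsto_exp_atBot.comp ?_
    simp only [neg_mul]
    exact tendsto_neg_atTop_atBot.comp (tendsto_id.atTop_mul_const hx')

/-- A law without atoms has at least two points in its support; $l<h$ are chosen strictly between
them. -/
theorem exists_two_ranges (hρ : ∀ x, ρ {x} = 0) :
    ∃ l h H : ℝ≥0, l < h ∧ h ≤ H ∧ 0 < ρ (Set.Iic l) ∧ 0 < ρ (Set.Icc h H) := by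
  have hsupp : ρ.support.Nontrivial := by
    by_contra hcon
    rw [Set.not_nontrivial_iff] at hcon
    have h₁ : ρ ρ.supportᶜ = 0 := Measure.measure_compl_support
    have h₂ : ρ ρ.support = 0 := by
      rcases hcon.eq_empty_or_singleton with h | ⟨x, h⟩
      · rw [h, measure_empty]
      · rw [h, hρ]
    have h₃ : ρ Set.univ ≤ ρ ρ.support + ρ ρ.supportᶜ := by
      rw [← Set.union_compl_self ρ.support]
      exact measure_union_le _ _
    rw [h₁, h₂, measure_univ] at h₃
    simp at h₃
  obtain ⟨x, hx, y, hy, hxy⟩ := hsupp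
  wlog hlt : x < y generalizing x y
  · exact this y hy x hx hxy.symm (lt_of_le_of_ne (not_lt.1 hlt) hxy.symm)
  obtain ⟨l, hxl, hly⟩ := exists_between hlt
  obtain ⟨h, hlh, hhy⟩ := exists_between hly
  refine ⟨l, h, y + 1, hlh, hhy.le.trans le_self_add, ?_, ?_⟩
  · exact (Measure.mem_support_iff_forall x).1 hx _ (Iic_mem_nhds hxl)
  · exact (Measure.mem_support_iff_forall y).1 hy _ (Icc_mem_nhds hhy (lt_add_one y))

end Product

end FPP

/-! ### Counting paths and coarse estimates with high probability -/

namespace FPP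

open HypGraph ProbabilityTheory

variable {V : Type*} {Γ : SimpleGraph V}

/-- All vertices have at most `D` neighbours. -/
def DegreeLE (Γ : SimpleGraph V) (D : ℕ) : Prop :=
  ∀ u, ∃ S : Finset V, S.card ≤ D ∧ ∀ v, Γ.Adj u v → v ∈ S

theorem DegreeLE.exists_ball {D : ℕ} (hD : DegreeLE Γ D) (hc : Γ.Connected) (r : ℕ) (x : V) :
    ∃ B : Finset V, B.card ≤ (D + 1) ^ r ∧ ∀ v, v ∈ B ↔ Γ.dist x v ≤ r := by
  classical
  suffices h : ∃ B : Finset V, B.card ≤ (D + 1) ^ r ∧ ∀ v, Γ.dist x v ≤ r → v ∈ B by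
    obtain ⟨B, hB, hmem⟩ := h
    exact ⟨B.filter fun v => Γ.dist x v ≤ r, (Finset.card_filter_le _ _).trans hB, fun v =>
      ⟨fun hv => (Finset.mem_filter.1 hv).2, fun hv => Finset.mem_filter.2 ⟨hmem v hv, hv⟩⟩⟩
  induction r generalizing x with
  | zero =>
    exact ⟨{x}, by simp, fun v hv => by
      rw [Finset.mem_singleton, ← (hc.dist_eq_zero_iff (u := x) (v := v)).1 (by omega)]⟩
  | succ r ih =>
    choose B hB hmem using ih
    obtain ⟨S, hS, hadj⟩ := hD x
    refine ⟨(insert x S).biUnion B, ?_, fun v hv => ?_⟩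
    · refine (Finset.card_biUnion_le_card_mul _ _ _ fun w _ => hB w).trans ?_
      rw [pow_succ, mul_comm]
      exact Nat.mul_le_mul_left _ ((Finset.card_insert_le _ _).trans (by omega))
    · obtain ⟨p, hp⟩ := exists_wordGeodesic hc x v
      have hp' : p.length ≤ r + 1 := by rw [hp]; exact hv
      rw [Finset.mem_biUnion]
      cases p with
      | nil => exact ⟨x, Finset.mem_insert_self _ _, hmem _ _ (by simp)⟩
      | cons h p =>
        refine ⟨_, Finset.mem_insert_of_mem (hadj _ h), hmem _ _ ((SimpleGraph.dist_le p).trans ?_)⟩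
        simpa using hp'

theorem DegreeLE.finite_ball {D : ℕ} (hD : DegreeLE Γ D) (hc : Γ.Connected) (x : V) (r : ℕ) :
    {v | Γ.dist x v ≤ r}.Finite := by
  obtain ⟨B, -, hB⟩ := hD.exists_ball hc r x
  exact B.finite_toSet.subset fun v hv => (hB v).2 hv

theorem DegreeLE.exists_edgeBall {D : ℕ} (hD : DegreeLE Γ D) (hc : Γ.Connected) (r : ℕ) (x : V) :
    ∃ F : Finset Γ.edgeSet, F.card ≤ ((D + 1) ^ r) ^ 2 ∧
      ∀ e : Γ.edgeSet, e ∈ F ↔ ∀ v ∈ (e : Sym2 V), Γ.dist x v ≤ r := by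
  classical
  obtain ⟨B, hB, hmem⟩ := hD.exists_ball hc r x
  refine ⟨((B ×ˢ B).image fun p => s(p.1, p.2)).subtype fun e => e ∈ Γ.edgeSet, ?_, ?_⟩
  · rw [Finset.card_subtype]
    refine (Finset.card_filter_le _ _).trans (Finset.card_image_le.trans ?_)
    rw [Finset.card_product, sq]
    exact Nat.mul_le_mul hB hB
  · rintro ⟨e, he⟩
    rw [Finset.mem_subtype, Finset.mem_image]
    induction e with | _ u v
    constructor
    · rintro ⟨⟨a, b⟩, hab, h⟩ w hw
      rw [Finset.mem_product] at hab
      simp only at hw h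
      rw [← h, Sym2.mem_iff] at hw
      rcases hw with rfl | rfl
      · exact (hmem _).1 hab.1
      · exact (hmem _).1 hab.2
    · intro h
      exact ⟨(u, v), Finset.mem_product.2 ⟨(hmem u).2 (h u (Sym2.mem_mk_left u v)),
        (hmem v).2 (h v (Sym2.mem_mk_right u v))⟩, rfl⟩

theorem DegreeLE.exists_pathEdges {D : ℕ} (hD : DegreeLE Γ D) (n : ℕ) (u : V) :
    ∃ Ps : Finset (Finset Γ.edgeSet), Ps.card ≤ D ^ n ∧
      ∀ v (p : Γ.Walk u v), p.length = n → walkEdges p ∈ Ps := by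
  classical
  induction n generalizing u with
  | zero =>
    refine ⟨{∅}, by simp, fun v p hp => ?_⟩
    cases p with
    | nil => simp [walkEdges]
    | cons h p => simp at hp
  | succ n ih =>
    choose Ps hPs hmem using ih
    obtain ⟨S, hS, hadj⟩ := hD u
    refine ⟨S.biUnion fun w => (Ps w).image fun P =>
      if h : Γ.Adj u w then insert ⟨s(u, w), h⟩ P else P, ?_, fun v p hp => ?_⟩
    · refine (Finset.card_biUnion_le_card_mul _ _ _ fun w _ =>
        Finset.card_image_le.trans (hPs w)).trans ?_
      rw [pow_succ, mul_comm]
      exact Nat.mul_le_mul_left _ hS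
    · cases p with
      | nil => simp at hp
      | @cons _ w _ h p =>
        rw [Finset.mem_biUnion]
        refine ⟨w, hadj w h, Finset.mem_image.2 ⟨walkEdges p, hmem w v p (by simpa using hp), ?_⟩⟩
        rw [dif_pos h]
        ext e
        simp [mem_walkEdges, Subtype.ext_iff]

/-- The edge sets of self-avoiding paths of length `n` that start in a ball. -/
theorem DegreeLE.exists_paths {D : ℕ} (hD : DegreeLE Γ D) (hc : Γ.Connected) (o : V) (s n : ℕ) :
    ∃ Ps : Finset (Finset Γ.edgeSet), Ps.card ≤ (D + 1) ^ s * D ^ n ∧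
      ∀ P, P ∈ Ps ↔ ∃ u v, Γ.dist o u ≤ s ∧ ∃ p : Γ.Walk u v, p.IsPath ∧ p.length = n ∧
        P = walkEdges p := by
  classical
  obtain ⟨B, hB, hmem⟩ := hD.exists_ball hc s o
  choose Ps hPs hmem' using fun u => hD.exists_pathEdges n u
  refine ⟨(B.biUnion Ps).filter fun P => ∃ u v, Γ.dist o u ≤ s ∧
    ∃ p : Γ.Walk u v, p.IsPath ∧ p.length = n ∧ P = walkEdges p, ?_, fun P => ?_⟩
  · exact (Finset.card_filter_le _ _).trans ((Finset.card_biUnion_le_card_mul _ _ _ fun w _ =>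
      hPs w).trans (Nat.mul_le_mul_right _ hB))
  · rw [Finset.mem_filter, and_iff_right_iff_imp]
    rintro ⟨u, v, hu, p, -, hpl, rfl⟩
    exact Finset.mem_biUnion.2 ⟨u, (hmem u).2 hu, hmem' u v p hpl⟩

theorem dist_le_of_mem_walkEdges (hc : Γ.Connected) {o u v : V} {s : ℕ} (hu : Γ.dist o u ≤ s)
    {p : Γ.Walk u v} {e : Γ.edgeSet} (he : e ∈ walkEdges p) {x : V} (hx : x ∈ (e : Sym2 V)) :
    Γ.dist o x ≤ s + p.length := by
  classical
  have hxs : x ∈ p.support := by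
    obtain ⟨e, he'⟩ := e
    induction e with | _ a b
    have he := mem_walkEdges.1 he
    rcases Sym2.mem_iff.1 hx with rfl | rfl
    · exact p.fst_mem_support_of_mem_edges he
    · exact p.snd_mem_support_of_mem_edges he
  have h₁ := SimpleGraph.dist_le (p.takeUntil x hxs)
  have h₂ := p.length_takeUntil_le_length hxs
  have h₃ := hc.dist_triangle (u := o) (v := u) (w := x)
  omega

/-! ### Good events at a single scale. -/

/-- A choice of a word geodesic for every pair of vertices, as a set of edges. -/
def IsGeodesicChoice (Q : V → V → Finset Γ.edgeSet) : Prop :=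
  ∀ o u, ∃ p : Γ.Walk o u, IsWordGeodesic p ∧ Q o u = walkEdges p

theorem exists_isGeodesicChoice (hc : Γ.Connected) :
    ∃ Q : V → V → Finset Γ.edgeSet, IsGeodesicChoice Q := by
  choose p hp using exists_wordGeodesic hc
  exact ⟨fun o u => walkEdges (p o u), fun o u => ⟨p o u, hp o u, rfl⟩⟩

open Classical in
/-- The coarse estimates at scale `s` around `o`, where the lengths of the edges of `B` are
replaced by bounds. -/
def goodSet (Q : V → V → Finset Γ.edgeSet) (o : V) (A : ℕ) (c C h : ℝ≥0)
    (B Z : Finset Γ.edgeSet) (s : ℕ) : Set (Config Γ) :=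
  {ω | (∀ u, Γ.dist o u ≤ s → ∑ e ∈ Q o u \ B, ω e ≤ c * s) ∧
    ∀ u v, Γ.dist o u ≤ s → ∀ p : Γ.Walk u v, p.IsPath → p.length = A * s →
      2 * C * s < h * ((walkEdges p ∩ B) \ Z).card + ∑ e ∈ walkEdges p \ B, ω e}

section

variable {Q : V → V → Finset Γ.edgeSet} {o : V} {A : ℕ} {c C h : ℝ≥0} {B Z : Finset Γ.edgeSet}
  {s : ℕ}

open Classical in
-- The edges of $B$ enter only through their number, never through their lengths; hence independence
-- of any prescription of lengths on $B$.
theorem goodSet_isLocal (hc : Γ.Connected) (hQ : IsGeodesicChoice Q)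
    {F : Finset Γ.edgeSet} {r : ℕ} (hr : (A + 1) * s ≤ r)
    (hF : ∀ e : Γ.edgeSet, (∀ v ∈ (e : Sym2 V), Γ.dist o v ≤ r) → e ∈ F) :
    IsLocal (goodSet Q o A c C h B Z s) (F \ B) := by
  rintro ω ω' hω ⟨h₁, h₂⟩
  have hr' : A * s + s ≤ r := by
    have : (A + 1) * s = A * s + s := by ring
    omega
  constructor
  · intro u hu
    rw [← Finset.sum_congr rfl fun e he => hω e ?_]
    · convert h₁ u hu
    · rw [Finset.mem_sdiff] at he ⊢
      refine ⟨hF e fun x hx => ?_, he.2⟩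
      obtain ⟨p, hp, hQp⟩ := hQ o u
      rw [hQp] at he
      have := dist_le_of_mem_walkEdges hc (o := o) (s := 0) (by simp) he.1 hx
      have hpl : p.length = Γ.dist o u := hp
      omega
  · intro u v hu p hp hpl
    rw [← Finset.sum_congr rfl fun e he => hω e ?_]
    · convert h₂ u v hu p hp hpl
    · rw [Finset.mem_sdiff] at he ⊢
      refine ⟨hF e fun x hx => ?_, he.2⟩
      have := dist_le_of_mem_walkEdges hc hu he.1 hx
      omega

open Classical in
theorem goodSet_eq {U : Finset V} (hU : ∀ v, v ∈ U ↔ Γ.dist o v ≤ s)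
    {Ps : Finset (Finset Γ.edgeSet)} (hPs : ∀ P, P ∈ Ps ↔ ∃ u v, Γ.dist o u ≤ s ∧
      ∃ p : Γ.Walk u v, p.IsPath ∧ p.length = A * s ∧ P = walkEdges p) :
    goodSet Q o A c C h B Z s = (⋂ u ∈ U, {ω | ∑ e ∈ Q o u \ B, ω e ≤ c * s}) ∩
      ⋂ P ∈ Ps, {ω | 2 * C * s < h * ((P ∩ B) \ Z).card + ∑ e ∈ P \ B, ω e} := by
  ext ω
  simp only [goodSet, Set.mem_ofPred_eq, Set.mem_inter_iff, Set.mem_iInter, hU, hPs]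
  refine and_congr (forall₂_congr fun u _ => by congr!) ?_
  constructor
  · rintro h₂ P ⟨u, v, hu, p, hp, hpl, rfl⟩
    convert h₂ u v hu p hp hpl
  · intro h₂ u v hu p hp hpl
    convert h₂ _ ⟨u, v, hu, p, hp, hpl, rfl⟩

theorem measurableSet_goodSet {D : ℕ} (hD : DegreeLE Γ D) (hc : Γ.Connected) :
    MeasurableSet (goodSet Q o A c C h B Z s) := by
  classical
  obtain ⟨U, -, hU⟩ := hD.exists_ball hc s o
  obtain ⟨Ps, -, hPs⟩ := hD.exists_paths hc o s (A * s)
  rw [goodSet_eq hU hPs]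
  refine MeasurableSet.inter (Finset.measurableSet_biInter _ fun u _ => ?_)
    (Finset.measurableSet_biInter _ fun P _ => ?_)
  · exact measurableSet_le (measurable_sum_coord _) measurable_const
  · exact measurableSet_lt measurable_const ((measurable_sum_coord _).const_add _)

/-- The constants `A`, `c`, `C`, `h` are adapted to the degree and to the law of the lengths. -/
structure Adapted (ρ : Measure ℝ≥0) (D A : ℕ) (c C h : ℝ≥0) : Prop where
  two_le : 2 ≤ A
  upper : ∃ a : ℝ, 0 ≤ a ∧ Integrable (fun x : ℝ≥0 => Real.exp (a * x)) ρ ∧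
    (D + 1) * (Real.exp (-a * c) * edgeMgf ρ a) ≤ 1 / 4
  lower : ∃ t : ℝ, 0 ≤ t ∧ edgeMgf ρ (-t) ≤ 1 / (2 * (D + 1)) ∧
    Real.exp (-t * h) ≤ 1 / (2 * (D + 1)) ∧
    (D + 1) ^ 3 * Real.exp (2 * t * C) * 4 ≤ 2 ^ (A - 2)

theorem one_le_edgeMgf {ρ : Measure ℝ≥0} [IsProbabilityMeasure ρ] {a : ℝ} (ha : 0 ≤ a)
    (hint : Integrable (fun x : ℝ≥0 => Real.exp (a * x)) ρ) : 1 ≤ edgeMgf ρ a := by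
  have h₁ : ∫ _x : ℝ≥0, (1 : ℝ) ∂ρ ≤ ∫ x : ℝ≥0, Real.exp (a * x) ∂ρ :=
    integral_mono (integrable_const 1) hint fun x =>
      Real.one_le_exp (mul_nonneg ha x.coe_nonneg)
  rw [integral_const, probReal_univ, one_smul] at h₁
  exact h₁

instance (ρ : Measure ℝ≥0) [IsProbabilityMeasure ρ] : IsProbabilityMeasure (law Γ ρ) :=
  inferInstanceAs (IsProbabilityMeasure (prodLaw Γ.edgeSet ρ))

/-- Union bound over at most $(D+1)^s$ vertices and $(D+1)^sD^{As}$ paths. Discarding the at most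
$2s$ edges of $Z$ leaves $(A-2)s$ edges on each path; every edge contributes a factor at most
$\theta$, by $e^{-th}$ inside $B$ and by the moment generating function outside. The factor
$(D+1)^3$ in `Adapted` accounts for the starting point and the $2s$ lost edges. -/
theorem measureReal_compl_goodSet_le {ρ : Measure ℝ≥0} [IsProbabilityMeasure ρ] {D : ℕ}
    (hD : DegreeLE Γ D) (hc : Γ.Connected) (hQ : IsGeodesicChoice Q)
    (hA : Adapted ρ D A c C h) (hZ : Z.card ≤ 2 * s) :
    (law Γ ρ).real (goodSet Q o A c C h B Z s)ᶜ ≤ 2 * (1 / 4) ^ s := by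
  classical
  obtain ⟨a, ha, hint, hac⟩ := hA.upper
  obtain ⟨t, ht, hφ, hth, htC⟩ := hA.lower
  obtain ⟨U, hUcard, hU⟩ := hD.exists_ball hc s o
  obtain ⟨Ps, hPscard, hPs⟩ := hD.exists_paths hc o s (A * s)
  set θ : ℝ := 1 / (2 * (D + 1)) with hθ
  have hD0 : (0 : ℝ) < D + 1 := by positivity
  have hθ0 : 0 ≤ θ := by positivity
  have hθ1 : θ ≤ 1 := by
    rw [hθ, div_le_one (by positivity)]
    have : (0 : ℝ) ≤ D := Nat.cast_nonneg _
    linarith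
  have hm1 := one_le_edgeMgf ha hint
  have hsub : (goodSet Q o A c C h B Z s)ᶜ ⊆
      (⋃ u ∈ U, {ω | (c * s : ℝ) ≤ ∑ e ∈ Q o u \ B, (ω e : ℝ)}) ∪
      ⋃ P ∈ Ps, {ω | ∑ e ∈ P \ B, (ω e : ℝ) ≤ 2 * C * s - h * ((P ∩ B) \ Z).card} := by
    rw [goodSet_eq hU hPs, Set.compl_inter, Set.compl_iInter₂, Set.compl_iInter₂]
    refine Set.union_subset_union (Set.iUnion₂_mono fun u _ => ?_)
      (Set.iUnion₂_mono fun P _ => ?_)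
    · intro ω hω
      have h₁ : (c * s : ℝ≥0) < ∑ e ∈ Q o u \ B, ω e := not_le.1 (Set.notMem_of_mem_compl hω)
      have h₂ := h₁.le
      simp only [Set.mem_ofPred_eq]
      exact_mod_cast h₂
    · intro ω hω
      have h₁ : h * ((P ∩ B) \ Z).card + ∑ e ∈ P \ B, ω e ≤ 2 * C * s := not_lt.1 hω
      have h₂ : (h : ℝ) * ((P ∩ B) \ Z).card + ∑ e ∈ P \ B, (ω e : ℝ) ≤ 2 * C * s := by
        exact_mod_cast h₁
      simp only [Set.mem_ofPred_eq]
      linarith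
  have hup : (law Γ ρ).real (⋃ u ∈ U, {ω : Config Γ | (c * s : ℝ) ≤ ∑ e ∈ Q o u \ B, (ω e : ℝ)}) ≤
      (1 / 4) ^ s := by
    refine (measureReal_biUnion_finset_le U _).trans ?_
    have hone : ∀ u ∈ U, (law Γ ρ).real {ω : Config Γ | (c * s : ℝ) ≤ ∑ e ∈ Q o u \ B, (ω e : ℝ)} ≤
        (Real.exp (-a * c) * edgeMgf ρ a) ^ s := by
      intro u hu
      refine (measureReal_le_sum ρ ha hint (Q o u \ B) (c * s)).trans ?_
      rw [mul_pow, ← Real.exp_nat_mul, show -a * (c * s : ℝ) = s * (-a * c) by ring]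
      gcongr
      obtain ⟨p, hp, hQp⟩ := hQ o u
      refine (Finset.card_le_card Finset.sdiff_subset).trans ?_
      rw [hQp, card_walkEdges (p.isPath_of_length_eq_dist hp)]
      exact (show p.length = _ from hp).trans_le ((hU u).1 hu)
    refine (Finset.sum_le_card_nsmul _ _ _ hone).trans ?_
    rw [nsmul_eq_mul]
    calc (U.card : ℝ) * (Real.exp (-a * c) * edgeMgf ρ a) ^ s
        ≤ (D + 1) ^ s * (Real.exp (-a * c) * edgeMgf ρ a) ^ s := by
          refine mul_le_mul_of_nonneg_right (by exact_mod_cast hUcard) ?_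
          exact pow_nonneg (mul_nonneg (Real.exp_nonneg _) (edgeMgf_nonneg ρ a)) _
      _ = ((D + 1) * (Real.exp (-a * c) * edgeMgf ρ a)) ^ s := (mul_pow _ _ _).symm
      _ ≤ (1 / 4) ^ s := by
          refine pow_le_pow_left₀ (mul_nonneg hD0.le (mul_nonneg (Real.exp_nonneg _) (by linarith)))
            hac s
  have hlo : (law Γ ρ).real (⋃ P ∈ Ps, {ω : Config Γ |
      ∑ e ∈ P \ B, (ω e : ℝ) ≤ 2 * C * s - h * ((P ∩ B) \ Z).card}) ≤ (1 / 4) ^ s := by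
    refine (measureReal_biUnion_finset_le Ps _).trans ?_
    have hone : ∀ P ∈ Ps, (law Γ ρ).real {ω : Config Γ |
        ∑ e ∈ P \ B, (ω e : ℝ) ≤ 2 * C * s - h * ((P ∩ B) \ Z).card} ≤
        (Real.exp (2 * t * C) * θ ^ (A - 2)) ^ s := by
      intro P hP
      refine (measureReal_sum_le ρ ht (P \ B) _).trans ?_
      have hcard : (A - 2) * s ≤ ((P ∩ B) \ Z).card + (P \ B).card := by
        obtain ⟨u, v, -, p, hp, hpl, rfl⟩ := (hPs P).1 hP
        have h₁ : (walkEdges p).card = A * s := (card_walkEdges hp).trans hpl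
        have h₂ := Finset.card_inter_add_card_sdiff (walkEdges p) B
        have h₃ := Finset.le_card_sdiff Z (walkEdges p ∩ B)
        rw [Nat.sub_mul]
        omega
      rw [show t * (2 * C * s - h * ((P ∩ B) \ Z).card : ℝ) =
        s * (2 * t * C) + ((P ∩ B) \ Z).card * (-t * h) by ring, Real.exp_add, Real.exp_nat_mul,
        Real.exp_nat_mul, mul_pow, mul_assoc, ← pow_mul]
      gcongr
      calc _ ≤ θ ^ ((P ∩ B) \ Z).card * θ ^ (P \ B).card := by
            gcongr
            · exact pow_nonneg (edgeMgf_nonneg ρ _) _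
            · exact edgeMgf_nonneg ρ _
        _ = θ ^ (((P ∩ B) \ Z).card + (P \ B).card) := (pow_add _ _ _).symm
        _ ≤ θ ^ ((A - 2) * s) := pow_le_pow_of_le_one hθ0 hθ1 hcard
    refine (Finset.sum_le_card_nsmul _ _ _ hone).trans ?_
    rw [nsmul_eq_mul]
    have hA2 := hA.two_le
    have hDpow : ((D : ℝ) + 1) ^ A = (D + 1) ^ 2 * (D + 1) ^ (A - 2) := by
      rw [← pow_add, Nat.add_sub_cancel' hA2]
    have hθD : ((D : ℝ) + 1) ^ (A - 2) * θ ^ (A - 2) * 2 ^ (A - 2) = 1 := by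
      rw [← mul_pow, ← mul_pow, hθ, show ((D : ℝ) + 1) * (1 / (2 * (D + 1))) * 2 = 1 by
        field_simp, one_pow]
    calc (Ps.card : ℝ) * (Real.exp (2 * t * C) * θ ^ (A - 2)) ^ s
        ≤ ((D + 1) ^ s * (D + 1) ^ (A * s)) * (Real.exp (2 * t * C) * θ ^ (A - 2)) ^ s := by
          gcongr
          have h₁ : (Ps.card : ℝ) ≤ (D + 1) ^ s * D ^ (A * s) := by exact_mod_cast hPscard
          refine h₁.trans ?_
          gcongr
          linarith
      _ = ((D + 1) ^ 3 * Real.exp (2 * t * C) * ((D + 1) ^ (A - 2) * θ ^ (A - 2))) ^ s := by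
          rw [pow_mul, ← mul_pow, ← mul_pow, hDpow]
          ring
      _ ≤ (1 / 4) ^ s := by
          refine pow_le_pow_left₀ (by positivity) ?_ s
          have h2 : (0 : ℝ) < 2 ^ (A - 2) := by positivity
          have h3 : ((D : ℝ) + 1) ^ (A - 2) * θ ^ (A - 2) = 1 / 2 ^ (A - 2) := by
            rw [eq_div_iff h2.ne']; exact hθD
          rw [h3, mul_one_div, div_le_div_iff₀ h2 (by norm_num)]
          linarith
  calc _ ≤ _ := measureReal_mono hsub (measure_ne_top _ _)
    _ ≤ _ := measureReal_union_le _ _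
    _ ≤ (1 / 4) ^ s + (1 / 4) ^ s := add_le_add hup hlo
    _ = _ := by ring

theorem measure_iUnion_compl_goodSet_le {ρ : Measure ℝ≥0} [IsProbabilityMeasure ρ] {D : ℕ}
    (hD : DegreeLE Γ D) (hc : Γ.Connected) (hQ : IsGeodesicChoice Q)
    (hA : Adapted ρ D A c C h) (s₀ : ℕ) (hZ : Z.card ≤ 2 * s₀) :
    law Γ ρ (⋃ i, (goodSet Q o A c C h B Z (s₀ + i))ᶜ) ≤ ENNReal.ofReal (4 * (1 / 4) ^ s₀) := by
  refine (measure_iUnion_le _).trans ?_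
  have hsum : HasSum (fun i : ℕ => 2 * (1 / 4 : ℝ) ^ s₀ * (1 / 4) ^ i)
      (2 * (1 / 4) ^ s₀ * (1 - 1 / 4)⁻¹) :=
    (hasSum_geometric_of_lt_one (by norm_num) (by norm_num)).mul_left _
  calc _ ≤ ∑' i : ℕ, ENNReal.ofReal (2 * (1 / 4 : ℝ) ^ s₀ * (1 / 4) ^ i) := by
        refine ENNReal.tsum_le_tsum fun i => ?_
        rw [← ofReal_measureReal, mul_assoc, ← pow_add]
        exact ENNReal.ofReal_le_ofReal
          (measureReal_compl_goodSet_le hD hc hQ hA (by omega))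
    _ = ENNReal.ofReal (2 * (1 / 4) ^ s₀ * (1 - 1 / 4)⁻¹) := by
        rw [← ENNReal.ofReal_tsum_of_nonneg (fun i => by positivity) hsum.summable, hsum.tsum_eq]
    _ ≤ _ := by
        refine ENNReal.ofReal_le_ofReal ?_
        have : (0 : ℝ) ≤ (1 / 4) ^ s₀ := by positivity
        norm_num
        linarith

open Classical in
/-- The coarse estimates hold at all scales if the estimates `goodSet` do. -/
theorem coarse_of_goodSet (hQ : IsGeodesicChoice Q) {H : ℝ≥0}
    (hC : C = c + H) {s₀ : ℕ} {ω : Config Γ} (hω : ∀ s, s₀ ≤ s → ω ∈ goodSet Q o A c C h B Z s)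
    (hup : ∀ e ∈ B, ω e ≤ H) (hlo : ∀ e ∈ B \ Z, h ≤ ω e) : Coarse ω o A C s₀ := by
  intro s hs
  constructor
  · intro u hu
    obtain ⟨p, hp, hQp⟩ := hQ o u
    refine (fppDist_le p).trans ?_
    have hpath := p.isPath_of_length_eq_dist hp
    rw [← sum_walkEdges hpath, ← Finset.sum_inter_add_sum_sdiff (walkEdges p) B]
    have h₁ : ∑ e ∈ walkEdges p \ B, ω e ≤ c * s := by
      have := (hω s hs).1 u hu
      rw [hQp] at this
      convert this
    have h₂ : ∑ e ∈ walkEdges p ∩ B, ω e ≤ s * H := by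
      refine (Finset.sum_le_card_nsmul _ _ H fun e he => hup e (Finset.mem_inter.1 he).2).trans ?_
      rw [nsmul_eq_mul]
      gcongr
      refine (Finset.card_le_card Finset.inter_subset_left).trans ?_
      rw [card_walkEdges hpath]
      exact (show p.length = _ from hp).trans_le hu
    calc _ ≤ s * H + c * s := add_le_add h₂ h₁
      _ = C * s := by rw [hC]; ring
  · intro u v hu p hp hpl
    have h₁ := (hω s hs).2 u v hu p hp hpl
    refine lt_of_lt_of_le h₁ ?_
    rw [← sum_walkEdges hp, ← Finset.sum_inter_add_sum_sdiff (walkEdges p) B]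
    refine add_le_add ?_ (le_of_eq (by congr!))
    calc _ = ((walkEdges p ∩ B) \ Z).card • h := by
          rw [nsmul_eq_mul, mul_comm]
      _ ≤ ∑ e ∈ (walkEdges p ∩ B) \ Z, ω e := Finset.card_nsmul_le_sum _ _ _ fun e he => by
          simp only [Finset.mem_sdiff, Finset.mem_inter] at he
          exact hlo e (Finset.mem_sdiff.2 ⟨he.1.2, he.2⟩)
      _ ≤ _ := Finset.sum_le_sum_of_subset Finset.sdiff_subset

end

/-- Adapted constants exist for lengths with exponential moments and without atom at zero. -/
theorem exists_adapted (ρ : Measure ℝ≥0) [IsProbabilityMeasure ρ] (hρ : ρ {0} = 0)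
    (hexp : ∃ a : ℝ, 0 < a ∧ Integrable (fun x : ℝ≥0 => Real.exp (a * x)) ρ) (D : ℕ)
    {h : ℝ≥0} (hh : 0 < h) (H : ℝ≥0) :
    ∃ (A : ℕ) (c : ℝ≥0), Adapted ρ D A c (c + H) h ∧ 0 < c := by
  obtain ⟨a, ha, hint⟩ := hexp
  have hm := one_le_edgeMgf ha.le hint
  obtain ⟨c, hc0, hc⟩ : ∃ c : ℝ≥0, 0 < c ∧
      (D + 1) * (Real.exp (-a * c) * edgeMgf ρ a) ≤ 1 / 4 := by
    have h₁ : Tendsto (fun x : ℝ => (D + 1) * (Real.exp (-a * x) * edgeMgf ρ a)) atTop (𝓝 0) := by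
      have h₂ : Tendsto (fun x : ℝ => Real.exp (-a * x)) atTop (𝓝 0) :=
        Real.tendsto_exp_atBot.comp (tendsto_id.const_mul_atTop_of_neg (by linarith))
      simpa using (h₂.mul_const (edgeMgf ρ a)).const_mul ((D : ℝ) + 1)
    obtain ⟨x, hx, hx0⟩ := ((h₁.eventually_le_const (by norm_num : (0 : ℝ) < 1 / 4)).and
      (eventually_gt_atTop 0)).exists
    exact ⟨⟨x, hx0.le⟩, hx0, hx⟩
  have hθ : (0 : ℝ) < 1 / (2 * (D + 1)) := by positivity
  obtain ⟨t, ht0, ht₁, ht₂⟩ : ∃ t : ℝ, 0 ≤ t ∧ edgeMgf ρ (-t) ≤ 1 / (2 * (D + 1)) ∧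
      Real.exp (-t * h) ≤ 1 / (2 * (D + 1)) := by
    have h₁ : Tendsto (fun t : ℝ => Real.exp (-t * h)) atTop (𝓝 0) := by
      refine Real.tendsto_exp_atBot.comp ?_
      simp only [neg_mul]
      exact tendsto_neg_atTop_atBot.comp (tendsto_id.atTop_mul_const (by exact_mod_cast hh))
    obtain ⟨t, h₂, h₃, h₄⟩ := (((tendsto_edgeMgf_neg ρ hρ).eventually_le_const hθ).and
      ((h₁.eventually_le_const hθ).and (eventually_ge_atTop 0))).exists
    exact ⟨t, h₄, h₂, h₃⟩
  obtain ⟨n, hn⟩ := pow_unbounded_of_one_lt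
    (((D : ℝ) + 1) ^ 3 * Real.exp (2 * t * (c + H : ℝ≥0)) * 4) (by norm_num : (1 : ℝ) < 2)
  exact ⟨n + 2, c, ⟨by omega, ⟨a, ha.le, hint, hc⟩, ⟨t, ht0, ht₁, ht₂, by
    simpa using hn.le⟩⟩, hc0⟩

end FPP

/-! ### Almost sure properties of the edge lengths -/

namespace FPP

open HypGraph ProbabilityTheory

variable {V : Type*} {Γ : SimpleGraph V} {ρ : Measure ℝ≥0} [IsProbabilityMeasure ρ]

theorem ae_generic [Countable V] (hρ : ∀ x, ρ {x} = 0) : ∀ᵐ ω ∂(law Γ ρ), Generic ω := by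
  have : Countable (Sym2 V) := Quot.mk_surjective.countable
  refine ae_all_iff.2 fun P => ae_all_iff.2 fun P' => ?_
  by_cases hPP : P = P'
  · exact ae_of_all _ fun _ _ => hPP
  · filter_upwards [measure_eq_zero_iff_ae_notMem.1 (measure_sum_eq_sum ρ hρ hPP)] with ω hω h
    exact (hω h).elim

section

variable {Q : V → V → Finset Γ.edgeSet} {A D : ℕ} {c C h : ℝ≥0}

/-- First Borel–Cantelli: failure at some scale from $s_0+k$ on has probability at most
$4\cdot4^{-(s_0+k)}$. The centre may vary with $k$; this serves both the fixed base-point and the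
barriers along a ray. -/
theorem ae_eventually_goodSet (hD : DegreeLE Γ D) (hc : Γ.Connected) (hQ : IsGeodesicChoice Q)
    (hA : Adapted ρ D A c C h) (o : ℕ → V) (B Z : ℕ → Finset Γ.edgeSet) (s₀ : ℕ)
    (hZ : ∀ k, (Z k).card ≤ 2 * s₀) :
    ∀ᵐ ω ∂(law Γ ρ), ∀ᶠ k in atTop, ∀ i, ω ∈ goodSet Q (o k) A c C h (B k) (Z k) (s₀ + k + i) := by
  have hsum : Summable fun k : ℕ => 4 * (1 / 4 : ℝ) ^ s₀ * (1 / 4) ^ k :=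
    (summable_geometric_of_lt_one (by norm_num) (by norm_num)).mul_left _
  have hle : ∑' k, law Γ ρ (⋃ i, (goodSet Q (o k) A c C h (B k) (Z k) (s₀ + k + i))ᶜ) ≠ ⊤ := by
    refine ne_top_of_le_ne_top hsum.tsum_ofReal_ne_top (ENNReal.tsum_le_tsum fun k => ?_)
    rw [mul_assoc, ← pow_add]
    exact measure_iUnion_compl_goodSet_le hD hc hQ hA (s₀ + k) ((hZ k).trans (by omega))
  filter_upwards [ae_eventually_notMem hle] with ω hω
  filter_upwards [hω] with k hk i
  by_contra hcon
  exact hk (Set.mem_iUnion.2 ⟨i, hcon⟩)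

theorem ae_exists_coarse (hD : DegreeLE Γ D) (hc : Γ.Connected) {H : ℝ≥0}
    (hA : Adapted ρ D A c (c + H) h) (o : V) :
    ∀ᵐ ω ∂(law Γ ρ), ∃ s₀, Coarse ω o A (c + H) s₀ := by
  obtain ⟨Q, hQ⟩ := exists_isGeodesicChoice hc
  filter_upwards [ae_eventually_goodSet hD hc hQ hA (fun _ => o) (fun _ => ∅) (fun _ => ∅) 0
    (by simp)] with ω hω
  obtain ⟨k, hk⟩ := hω.exists
  refine ⟨k, coarse_of_goodSet (h := h) (B := ∅) (Z := ∅) hQ rfl (fun s hs => ?_) (by simp)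
    (by simp)⟩
  obtain ⟨i, rfl⟩ := Nat.exists_eq_add_of_le hs
  simpa using hk i

/-- The estimates `goodSet` hold at finitely many scales with probability at least `1/2`. -/
theorem half_le_measure_iInter_goodSet (hD : DegreeLE Γ D) (hc : Γ.Connected)
    (hQ : IsGeodesicChoice Q) (hA : Adapted ρ D A c C h) {o : V} {B Z : Finset Γ.edgeSet} {L : ℕ}
    (hL : 2 ≤ L) (hZ : Z.card ≤ 2 * L) (k : ℕ) :
    1 / 2 ≤ law Γ ρ (⋂ (i) (_ : i ≤ k), goodSet Q o A c C h B Z (L + i)) := by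
  have hm : MeasurableSet (⋂ (i) (_ : i ≤ k), goodSet Q o A c C h B Z (L + i)) :=
    MeasurableSet.iInter fun i => MeasurableSet.iInter fun _ => measurableSet_goodSet hD hc
  have h₁ : law Γ ρ (⋂ (i) (_ : i ≤ k), goodSet Q o A c C h B Z (L + i))ᶜ ≤ 1 / 2 := by
    refine (measure_mono (t := ⋃ i, (goodSet Q o A c C h B Z (L + i))ᶜ) ?_).trans
      ((measure_iUnion_compl_goodSet_le hD hc hQ hA L hZ).trans ?_)
    · rw [Set.compl_iInter]
      refine Set.iUnion_mono fun i => ?_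
      rw [Set.compl_iInter]
      exact Set.iUnion_subset fun _ => subset_rfl
    · rw [show (1 / 2 : ENNReal) = ENNReal.ofReal (1 / 2) by
        rw [ENNReal.ofReal_div_of_pos (by norm_num)]; simp]
      refine ENNReal.ofReal_le_ofReal ?_
      have : (1 / 4 : ℝ) ^ L ≤ (1 / 4) ^ 2 := pow_le_pow_of_le_one (by norm_num) (by norm_num) hL
      linarith
  rw [prob_compl_eq_one_sub hm] at h₁
  refine (ENNReal.add_le_add_iff_left (a := 1 / 2) (by simp)).1 ?_
  rw [ENNReal.add_halves]
  exact tsub_le_iff_right.1 h₁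

open Classical in
/-- The lengths are at most `l` on `B ∩ Z` and in `[h, H]` on `B \ Z`. -/
def prescribedSet (B Z : Finset Γ.edgeSet) (l h H : ℝ≥0) : Set (Config Γ) :=
  Set.pi B fun e => if e ∈ Z then Set.Iic l else Set.Icc h H

theorem prescribedSet_isLocal (B Z : Finset Γ.edgeSet) (l h H : ℝ≥0) :
    IsLocal (prescribedSet B Z l h H) B := fun ω ω' hω hmem e he => by
  have := hmem e he
  rwa [hω e he] at this

theorem measurableSet_prescribedSet (B Z : Finset Γ.edgeSet) (l h H : ℝ≥0) :
    MeasurableSet (prescribedSet B Z l h H) := by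
  refine MeasurableSet.pi B.countable_toSet fun e _ => ?_
  split_ifs
  · exact measurableSet_Iic
  · exact measurableSet_Icc

theorem le_measure_prescribedSet (B Z : Finset Γ.edgeSet) (l h H : ℝ≥0) {n : ℕ}
    (hB : B.card ≤ n) :
    min (ρ (Set.Iic l)) (ρ (Set.Icc h H)) ^ n ≤ law Γ ρ (prescribedSet B Z l h H) := by
  classical
  have hle : min (ρ (Set.Iic l)) (ρ (Set.Icc h H)) ≤ 1 := (min_le_left _ _).trans prob_le_one
  have heq : law Γ ρ (prescribedSet B Z l h H) =
      ∏ e ∈ B, ρ (if e ∈ Z then Set.Iic l else Set.Icc h H) := by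
    unfold law prescribedSet
    rw [Measure.infinitePi_pi (μ := fun _ : Γ.edgeSet => ρ)]
    intro e _
    split_ifs
    · exact measurableSet_Iic
    · exact measurableSet_Icc
  rw [heq]
  refine (pow_le_pow_right_of_le_one' hle hB).trans (Finset.pow_card_le_prod _ _ _ fun e _ => ?_)
  split_ifs
  · exact min_le_left _ _
  · exact min_le_right _ _

/-- Almost surely, every word geodesic ray has infinitely many barriers with coarse estimates. -/
theorem ae_frequently_barrier (hD : DegreeLE Γ D) (hc : Γ.Connected) {l H : ℝ≥0}
    (hA : Adapted ρ D A c (c + H) h) (hlh : l < h) (hhH : h ≤ H) (hl : 0 < ρ (Set.Iic l))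
    (hh : 0 < ρ (Set.Icc h H)) {L K : ℕ} (hL : 2 ≤ L) (hK : L ≤ K) (γ : GeodesicRay Γ) :
    ∀ᵐ ω ∂(law Γ ρ), ∃ᶠ N in atTop, Coarse ω (γ.toFun N) A (c + H) L ∧
      Barrier ω γ N L K l h H := by
  classical
  obtain ⟨Q, hQ⟩ := exists_isGeodesicChoice hc
  set M := 2 * ((A + 1) * (L + 1)) + 2 * K + 1 with hM
  -- The radius $r_k$ on which the $k$-th event depends grows linearly, so quadratically spaced
  -- centres make the edge sets $F_k$ disjoint; $M$ is the constant needed for $2r_k<M(2k+1)$.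
  let N : ℕ → ℕ := fun k => M * (k + 1) ^ 2
  let r : ℕ → ℕ := fun k => (A + 1) * (L + k) + K
  let edge : ℕ → Γ.edgeSet := fun i => ⟨s(γ.toFun i, γ.toFun (i + 1)), adj_of_dist_eq_one i⟩
  let Z : ℕ → Finset Γ.edgeSet := fun k => (Finset.Ico (N k - L) (N k + L)).image edge
  choose B hBcard hBmem using fun k => hD.exists_edgeBall hc K (γ.toFun (N k))
  choose F _ hFmem using fun k => hD.exists_edgeBall hc (r k) (γ.toFun (N k))
  have hLN : ∀ k, k + L ≤ N k := fun k => by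
    have h₁ : L + 1 ≤ M := by rw [hM]; nlinarith
    have h₂ : k + 1 ≤ (k + 1) ^ 2 := by nlinarith
    have h₃ := Nat.mul_le_mul h₁ h₂
    simp only [N]
    nlinarith
  have hZcard : ∀ k, (Z k).card ≤ 2 * L := fun k => by
    refine Finset.card_image_le.trans ?_
    rw [Nat.card_Ico]
    omega
  have hZmem : ∀ k i, N k - L ≤ i → i < N k + L → edge i ∈ Z k := fun k i h₁ h₂ =>
    Finset.mem_image_of_mem _ (Finset.mem_Ico.2 ⟨h₁, h₂⟩)
  have hZB : ∀ k, Z k ⊆ B k := fun k e he => by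
    obtain ⟨i, hi, rfl⟩ := Finset.mem_image.1 he
    rw [Finset.mem_Ico] at hi
    have hLk := hLN k
    refine (hBmem k _).2 fun v hv => ?_
    have hdist : ∀ j, N k - L ≤ j → j ≤ N k + L → Γ.dist (γ.toFun (N k)) (γ.toFun j) ≤ K := by
      intro j h₁ h₂
      rcases le_total (N k) j with hj | hj
      · rw [γ.dist_of_le hj]; omega
      · rw [Γ.dist_comm, γ.dist_of_le hj]; omega
    rcases Sym2.mem_iff.1 hv with rfl | rfl
    · exact hdist _ hi.1 (by omega)
    · exact hdist _ (by omega) (by omega)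
  -- Only the scales $L,\dots,L+k$ are imposed, to keep the event local. The larger scales hold
  -- eventually by the first Borel–Cantelli lemma.
  let T : ℕ → Set (Config Γ) := fun k =>
    ⋂ (i) (_ : i ≤ k), goodSet Q (γ.toFun (N k)) A c (c + H) h (B k) (Z k) (L + i)
  let E : ℕ → Set (Config Γ) := fun k => prescribedSet (B k) (Z k) l h H ∩ T k
  have hTmeas : ∀ k, MeasurableSet (T k) := fun k =>
    MeasurableSet.iInter fun i => MeasurableSet.iInter fun _ => measurableSet_goodSet hD hc
  have hTloc : ∀ k, IsLocal (T k) (F k \ B k) := fun k =>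
    IsLocal.iInter fun i => IsLocal.iInter fun hi =>
      goodSet_isLocal hc hQ (r := r k)
        ((Nat.mul_le_mul_left _ (Nat.add_le_add_left hi L)).trans (Nat.le_add_right _ _))
        fun e he => (hFmem k e).2 he
  have hEmeas : ∀ k, MeasurableSet (E k) := fun k =>
    (measurableSet_prescribedSet _ _ _ _ _).inter (hTmeas k)
  have hBF : ∀ k, B k ⊆ F k := fun k e he =>
    (hFmem k e).2 fun v hv => ((hBmem k e).1 he v hv).trans (Nat.le_add_left _ _)
  have hEloc : ∀ k, IsLocal (E k) (F k) := fun k =>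
    ((prescribedSet_isLocal _ _ _ _ _).mono (hBF k)).inter ((hTloc k).mono Finset.sdiff_subset)
  have hdisj : ∀ j k, j < k → Disjoint (F j) (F k) := by
    intro j k hjk
    rw [Finset.disjoint_left]
    rintro ⟨e, he⟩ hj hk
    induction e with | _ u v
    have h₁ := (hFmem j _).1 hj u (Sym2.mem_mk_left u v)
    have h₂ := (hFmem k _).1 hk u (Sym2.mem_mk_left u v)
    have h₃ := hc.dist_triangle (u := γ.toFun (N j)) (v := u) (w := γ.toFun (N k))
    have h₄ : N j ≤ N k := Nat.mul_le_mul_left _ (Nat.pow_le_pow_left (by omega) 2)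
    rw [Γ.dist_comm (u := u), γ.dist_of_le h₄] at h₃
    have h₅ : N j + M * (2 * k + 1) ≤ N k := by
      have : (j + 1) ^ 2 + (2 * k + 1) ≤ (k + 1) ^ 2 := by nlinarith
      calc N j + M * (2 * k + 1) = M * ((j + 1) ^ 2 + (2 * k + 1)) := by simp only [N]; ring
        _ ≤ _ := Nat.mul_le_mul_left _ this
    have h₆ : r j ≤ r k :=
      Nat.add_le_add_right (Nat.mul_le_mul_left _ (by omega)) _
    have h₇ : 2 * r k < M * (2 * k + 1) := by
      simp only [r]
      have : M * (2 * k + 1) = 2 * ((A + 1) * (L + k) + K) + 1 + (2 * (A + 1)) +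
        2 * k * (2 * ((A + 1) * L) + (A + 1) + 2 * K + 1) := by rw [hM]; ring
      omega
    omega
  have hind : iIndepSet E (law Γ ρ) := iIndepSet_of_isLocal ρ hEmeas hEloc hdisj
  set p := min (ρ (Set.Iic l)) (ρ (Set.Icc h H)) ^ (((D + 1) ^ K) ^ 2) with hp
  have hp0 : p ≠ 0 := pow_ne_zero _ (lt_min hl hh).ne'
  -- Prescription and estimates depend on disjoint edge sets, and the number of prescribed edges is
  -- bounded uniformly in $k$.
  have hEprob : ∀ k, p * (1 / 2) ≤ law Γ ρ (E k) := fun k => by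
    have h₁ : law Γ ρ (E k) = law Γ ρ (prescribedSet (B k) (Z k) l h H) * law Γ ρ (T k) :=
      (prescribedSet_isLocal _ _ _ _ _).measure_inter ρ (measurableSet_prescribedSet _ _ _ _ _)
        (hTmeas k) (hTloc k) Finset.disjoint_sdiff
    rw [h₁]
    exact mul_le_mul' (le_measure_prescribedSet _ _ _ _ _ (hBcard k))
      (half_le_measure_iInter_goodSet hD hc hQ hA hL (hZcard k) k)
  have htop : ∑' k, law Γ ρ (E k) = ⊤ := by
    refine top_unique ?_
    rw [← ENNReal.tsum_const_eq_top_of_ne_zero (α := ℕ)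
      (mul_ne_zero hp0 (by simp : (1 / 2 : ENNReal) ≠ 0))]
    exact ENNReal.tsum_le_tsum hEprob
  have hlim : ∀ᵐ ω ∂(law Γ ρ), ω ∈ limsup E atTop :=
    (mem_ae_iff_prob_eq_one (MeasurableSet.measurableSet_limsup hEmeas)).2
      (measure_limsup_eq_one hEmeas hind htop)
  filter_upwards [hlim, ae_eventually_goodSet hD hc hQ hA (fun k => γ.toFun (N k)) B Z L hZcard]
    with ω hω₁ hω₂
  rw [mem_limsup_iff_frequently_mem] at hω₁
  have hNtop : Tendsto N atTop atTop :=
    tendsto_atTop_mono (fun k => (Nat.le_add_right k L).trans (hLN k)) tendsto_id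
  refine hNtop.frequently ((hω₁.and_eventually hω₂).mono ?_)
  rintro k ⟨⟨hpre, hT⟩, htail⟩
  have hlow : ∀ e ∈ Z k, ω e ≤ l := fun e he => by
    simpa [he] using hpre e (hZB k he)
  have hhigh : ∀ e ∈ B k \ Z k, h ≤ ω e ∧ ω e ≤ H := fun e he => by
    rw [Finset.mem_sdiff] at he
    simpa [he.2] using hpre e he.1
  have hup : ∀ e ∈ B k, ω e ≤ H := fun e he => by
    by_cases heZ : e ∈ Z k
    · exact (hlow e heZ).trans (hlh.le.trans hhH)
    · exact (hhigh e (Finset.mem_sdiff.2 ⟨he, heZ⟩)).2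
  have hball : ∀ u v (huv : Γ.Adj u v), Γ.dist (γ.toFun (N k)) u ≤ K →
      Γ.dist (γ.toFun (N k)) v ≤ K → (⟨s(u, v), huv⟩ : Γ.edgeSet) ∈ B k := by
    intro u v huv hu hv
    refine (hBmem k _).2 fun w hw => ?_
    rcases Sym2.mem_iff.1 hw with rfl | rfl
    · exact hu
    · exact hv
  refine ⟨coarse_of_goodSet hQ rfl (fun s hs => ?_) hup fun e he => (hhigh e he).1, ?_, ?_, ?_⟩
  · obtain ⟨i, rfl⟩ := Nat.exists_eq_add_of_le hs
    rcases le_total i k with hi | hi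
    · exact Set.mem_iInter₂.1 hT i hi
    · obtain ⟨j, rfl⟩ := Nat.exists_eq_add_of_le hi
      rw [← add_assoc]
      exact htail j
  · intro i h₁ h₂
    rw [edgeTime_of_mem (adj_of_dist_eq_one i : s(γ.toFun i, γ.toFun (i + 1)) ∈ Γ.edgeSet)]
    exact hlow _ (hZmem k i h₁ h₂)
  · intro u v huv hu hv hne
    rw [edgeTime_of_mem (huv : s(u, v) ∈ Γ.edgeSet)]
    refine (hhigh _ (Finset.mem_sdiff.2 ⟨hball u v huv hu hv, fun hmem => ?_⟩)).1
    obtain ⟨i, hi, hei⟩ := Finset.mem_image.1 hmem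
    rw [Finset.mem_Ico] at hi
    exact hne i hi.1 hi.2 (congrArg Subtype.val hei).symm
  · intro u v huv hu hv
    rw [edgeTime_of_mem (huv : s(u, v) ∈ Γ.edgeSet)]
    exact hup _ (hball u v huv hu hv)

end

end FPP

/-! ### Coalescence of geodesic rays -/

namespace HypGraph

variable {V : Type*} {Γ : SimpleGraph V}

/-- Busemann functions of geodesic rays are eventually constant along the ray. -/
theorem GeodesicRay.exists_dist_eq_add (hc : Γ.Connected) (γ : GeodesicRay Γ) (x : V) :
    ∃ n₀, ∀ n L, n₀ + L ≤ n → Γ.dist (γ.toFun n) x = Γ.dist (γ.toFun (n - L)) x + L := by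
  -- Up to an additive constant, $d(\gamma(n),x)-n$; the constant makes it a natural number. Being
  -- nonincreasing, it is constant once it has reached its minimum.
  let g : ℕ → ℕ := fun n => Γ.dist (γ.toFun n) x + Γ.dist (γ.toFun 0) x - n
  have hg : ∀ n, g n + n = Γ.dist (γ.toFun n) x + Γ.dist (γ.toFun 0) x := fun n => by
    have h₁ := hc.dist_triangle (u := γ.toFun 0) (v := x) (w := γ.toFun n)
    rw [γ.dist_of_le (Nat.zero_le n), Γ.dist_comm (u := x)] at h₁
    simp only [g]
    omega
  have hanti : ∀ m n, m ≤ n → g n ≤ g m := fun m n hmn => by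
    have h₁ := hc.dist_triangle (u := γ.toFun n) (v := γ.toFun m) (w := x)
    rw [Γ.dist_comm (u := γ.toFun n) (v := γ.toFun m), γ.dist_of_le hmn] at h₁
    have h₂ := hg m
    have h₃ := hg n
    omega
  have hconst : ∀ n, Function.argmin g ≤ n → g n = g (Function.argmin g) := fun n hn =>
    le_antisymm (hanti _ _ hn) (Function.argmin_le g n)
  refine ⟨Function.argmin g, fun n L hn => ?_⟩
  have h₁ := hconst n (by omega)
  have h₂ := hconst (n - L) (by omega)
  have h₃ := hg n
  have h₄ := hg (n - L)
  omega

end HypGraph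

namespace FPP

open HypGraph

variable {V : Type*} {Γ : SimpleGraph V} {ω : Config Γ} {o : V}

/-- Rays that frequently meet on a geodesic ray coalesce. -/
theorem coalesce_of_frequently (hg : Generic ω) (γ : GeodesicRay Γ)
    {σ τ : ℕ → V} (hσ : IsFPPRay ω σ) (hτ : IsFPPRay ω τ)
    (h : ∃ᶠ N in atTop, (∃ a, σ a = γ.toFun N) ∧ ∃ b, τ b = γ.toFun N) : Coalesce σ τ := by
  obtain ⟨N₀, ⟨a, ha⟩, b, hb⟩ := h.exists
  -- Meetings at far points of $\gamma$ happen at late times, so the uniqueness of the segment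
  -- between two meetings covers any prescribed initial piece.
  have hlate : ∀ (φ : ℕ → V) (n : ℕ), ∀ᶠ N in atTop, ∀ i, φ i = γ.toFun N → n < i := by
    intro φ n
    filter_upwards [eventually_gt_atTop
      ((Finset.range (n + 1)).sup fun i => Γ.dist (γ.toFun 0) (φ i))] with N hN i hi
    by_contra hcon
    have h₁ : Γ.dist (γ.toFun 0) (φ i) ≤
        (Finset.range (n + 1)).sup fun i => Γ.dist (γ.toFun 0) (φ i) :=
      Finset.le_sup (f := fun i => Γ.dist (γ.toFun 0) (φ i)) (Finset.mem_range.2 (by omega))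
    rw [hi, γ.dist_of_le (Nat.zero_le N)] at h₁
    omega
  refine ⟨a, b, fun k => ?_⟩
  obtain ⟨N, ⟨⟨a', ha'⟩, b', hb'⟩, h₁, h₂⟩ :=
    (h.and_eventually ((hlate σ (a + k)).and (hlate τ b))).exists
  have h₃ := h₁ a' ha'
  have h₄ := h₂ b' hb'
  exact (hg.isSeg_unique (by omega) (by omega)
    ((isFPPRay_iff.1 hσ a').mono (Nat.zero_le a) le_rfl)
    ((isFPPRay_iff.1 hτ b').mono (Nat.zero_le b) le_rfl) (ha.trans hb.symm)
    (ha'.trans hb'.symm)).2 k (by omega)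

theorem eq_of_coalesce (hg : Generic ω) {σ τ : ℕ → V} (hσ : IsFPPRay ω σ) (hτ : IsFPPRay ω τ)
    (h₀ : σ 0 = τ 0) (h : Coalesce σ τ) : σ = τ := by
  obtain ⟨a, b, hab⟩ := h
  funext n
  have := (hg.isSeg_unique (Nat.zero_le (a + n)) (Nat.zero_le (b + n)) (isFPPRay_iff.1 hσ _)
    (isFPPRay_iff.1 hτ _) h₀ (hab n)).2 n (by omega)
  simpa using this

/-- Every ray to the endpoint visits all but finitely many of the barrier centres, since for large
$N$ the vertex $\gamma(N-L)$ lies on a word geodesic from its starting point to $\gamma(N)$. Hence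
any two rays coalesce, and two from the same vertex coincide. -/
theorem Regular.mem_coalescenceEvent {δ ε : ℝ} {A A' : ℕ} {C C' : ℝ≥0} {s₀ : ℕ}
    (h : Regular ω o δ A' C' s₀) {γ : GeodesicRay Γ} {L K : ℕ} {l x H : ℝ≥0}
    (hB : ∃ᶠ N in atTop, Coarse ω (γ.toFun N) A C L ∧ Barrier ω γ N L K l x H)
    (hth : LargeThreshold δ ε A L) (hK : (A + 2) * L ≤ K) (hlx : l < x)
    (hnum : 2 * ((H : ℝ) + x) * (2 * ε * L + 4 * δ) < (x - l) * L) (hxH : x ≤ H) (hL : 0 < L) :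
    ω ∈ coalescenceEvent o γ.endpoint := by
  have hhit : ∀ σ, IsFPPRay ω σ → HasDirection o σ γ.endpoint → ∀ᶠ N in atTop,
      Coarse ω (γ.toFun N) A C L ∧ Barrier ω γ N L K l x H → ∃ n, σ n = γ.toFun N := by
    intro σ hσ hd
    rw [h.hasDirection_iff hσ] at hd
    obtain ⟨n₀, hn₀⟩ := γ.exists_dist_eq_add h.conn (σ 0)
    filter_upwards [eventually_ge_atTop (n₀ + L),
      eventually_gt_atTop (L + Γ.dist (γ.toFun 0) (σ 0))] with N hN₁ hN₂ hN
    refine hN.2.exists_eq h.conn h.hasDelta h.generic hN.1 hth hK hlx hnum hxH hL (by omega) hσ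
      (hd.base h.conn _) (hn₀ N L hN₁) ?_
    have h₁ := h.conn.dist_triangle (u := γ.toFun 0) (v := σ 0) (w := γ.toFun N)
    rw [γ.dist_of_le (Nat.zero_le N), Γ.dist_comm (u := σ 0)] at h₁
    omega
  have hco : ∀ σ τ : ℕ → V, IsFPPRay ω σ → HasDirection o σ γ.endpoint → IsFPPRay ω τ →
      HasDirection o τ γ.endpoint → Coalesce σ τ := fun σ τ hσ hdσ hτ hdτ =>
    coalesce_of_frequently h.generic γ hσ hτ
      ((hB.and_eventually ((hhit σ hσ hdσ).and (hhit τ hτ hdτ))).mono fun N hN =>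
        ⟨hN.2.1 hN.1, hN.2.2 hN.1⟩)
  refine ⟨fun v => ?_, hco⟩
  obtain ⟨σ, h₀, hσ, hd⟩ := h.exists_ray v γ.endpoint
  exact ⟨σ, ⟨h₀, hσ, hd⟩, fun τ ⟨hτ₀, hτ, hdτ⟩ =>
    eq_of_coalesce h.generic hτ hσ (hτ₀.trans h₀.symm) (hco τ σ hτ hdτ hσ hd)⟩

/-! ### Almost sure regularity and coalescence. -/

section

variable {ρ : Measure ℝ≥0} [IsProbabilityMeasure ρ] {D : ℕ}

theorem DegreeLE.countable (hD : DegreeLE Γ D) (hc : Γ.Connected) : Countable V := by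
  obtain ⟨o⟩ := hc.nonempty
  have : (⋃ r : ℕ, {v | Γ.dist o v ≤ r}) = Set.univ :=
    Set.eq_univ_of_forall fun v => Set.mem_iUnion.2 ⟨Γ.dist o v, le_refl (Γ.dist o v)⟩
  rw [← Set.countable_univ_iff, ← this]
  exact Set.countable_iUnion fun r => (hD.finite_ball hc o r).countable

theorem ae_exists_regular (hD : DegreeLE Γ D) (hc : Γ.Connected) {δ : ℝ} (hδ : HasDelta Γ δ)
    (hρ : ∀ x, ρ {x} = 0) {A : ℕ} {c h H : ℝ≥0} (hA : Adapted ρ D A c (c + H) h) (hc0 : 0 < c)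
    (o : V) : ∀ᵐ ω ∂(law Γ ρ), ∃ s₀, Regular ω o δ A (c + H) s₀ := by
  have := hD.countable hc
  obtain ⟨s₁, hs₁⟩ := exists_largeThreshold δ (ε := 1 / 2) (by norm_num) (by norm_num) A
  filter_upwards [ae_generic hρ, ae_exists_coarse hD hc hA o] with ω hg ⟨s₀, hs₀⟩
  exact ⟨max s₀ s₁, hc, hδ, hD.finite_ball hc, hg, hs₀.mono (le_max_left _ _),
    hs₁.mono (le_max_right _ _), add_pos_of_pos_of_nonneg hc0 zero_le⟩

/-- Almost surely all geodesic rays in a given direction coalesce. -/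
theorem ae_mem_coalescenceEvent (hD : DegreeLE Γ D) (hc : Γ.Connected) {δ : ℝ}
    (hδ : HasDelta Γ δ) (hρ : ∀ x, ρ {x} = 0)
    (hexp : ∃ a : ℝ, 0 < a ∧ Integrable (fun x : ℝ≥0 => Real.exp (a * x)) ρ) (o : V)
    (ξ : Boundary Γ) : ∀ᵐ ω ∂(law Γ ρ), ω ∈ coalescenceEvent o ξ := by
  obtain ⟨γ, rfl⟩ : ∃ γ : GeodesicRay Γ, γ.endpoint = ξ := Quotient.exists_rep ξ
  obtain ⟨l, h, H, hlh, hhH, hl, hh⟩ := exists_two_ranges ρ hρ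
  have hh0 : 0 < h := pos_of_gt hlh
  obtain ⟨A, c, hA, hc0⟩ := exists_adapted ρ (hρ 0) hexp D hh0 H
  have hlh' : (0 : ℝ) < h - l := sub_pos.2 (by exact_mod_cast hlh)
  have hh' : (0 : ℝ) < h := by exact_mod_cast hh0
  have hl' : (0 : ℝ) ≤ l := l.2
  have hH' : (0 : ℝ) ≤ H := H.2
  -- In the comparison of costs, $\varepsilon$ makes the term proportional to $L$ exactly half of
  -- $(h-l)L$, and $L$ is then taken so large that the $\delta$ term is less than the other half.
  set ε : ℝ := (h - l) / (8 * (H + h)) with hε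
  have hε0 : 0 < ε := by positivity
  have hε1 : ε < 1 := by
    rw [hε, div_lt_one (by positivity)]
    linarith
  have hεeq : 4 * ε * (H + h) = (h - l) / 2 := by
    rw [hε]
    field_simp
    ring
  obtain ⟨s₁, hs₁⟩ := exists_largeThreshold δ hε0 hε1 A
  obtain ⟨n, hn⟩ := exists_nat_gt (16 * δ * (H + h) / (h - l))
  rw [div_lt_iff₀ hlh'] at hn
  set L := max 2 (max s₁ n)
  have hL2 : 2 ≤ L := le_max_left _ _
  have hLs : s₁ ≤ L := (le_max_left _ _).trans (le_max_right _ _)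
  have hLn : (n : ℝ) ≤ L := by exact_mod_cast (le_max_right s₁ n).trans (le_max_right _ _)
  have hnum : 2 * ((H : ℝ) + h) * (2 * ε * L + 4 * δ) < (h - l) * L := by
    have h₁ : (n : ℝ) * (h - l) ≤ L * (h - l) := mul_le_mul_of_nonneg_right hLn hlh'.le
    have h₂ : 2 * ((H : ℝ) + h) * (2 * ε * L + 4 * δ) =
      4 * ε * (H + h) * L + 16 * δ * (H + h) / 2 := by ring
    rw [h₂, hεeq]
    linarith
  filter_upwards [ae_exists_regular hD hc hδ hρ hA hc0 o,
    ae_frequently_barrier hD hc hA hlh hhH hl hh hL2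
      (by nlinarith : L ≤ (A + 2) * L) γ] with ω ⟨s₀, hreg⟩ hB
  exact hreg.mem_coalescenceEvent hB (hs₁.mono hLs) le_rfl hlh hnum hhH (by omega)

end

/-! ### Cayley graphs and the theorem. -/

/-- The degrees of a Cayley graph are bounded. -/
theorem degreeLE_cayleyGraph {G : Type*} [Group G] (S : Finset G) :
    DegreeLE (cayleyGraph S) (S.card + S.card) := by
  classical
  intro u
  refine ⟨S.image (fun s => u * s) ∪ S.image (fun s => u * s⁻¹),
    (Finset.card_union_le _ _).trans (add_le_add Finset.card_image_le Finset.card_image_le), ?_⟩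
  intro v huv
  obtain ⟨-, s, hs, rfl | h⟩ := (SimpleGraph.mulCayley_adj' _ u v).1 huv
  · exact Finset.mem_union_left _ (Finset.mem_image_of_mem _ hs)
  · exact Finset.mem_union_right _ (Finset.mem_image.2 ⟨s, hs, by rw [h, mul_inv_cancel_right]⟩)

end FPP


theorem theorem3p1 {G : Type*} [Group G] (S : Finset G)
    (hS_symm : ∀ s ∈ S, s⁻¹ ∈ S) (hS_gen : Subgroup.closure (S : Set G) = ⊤)
    (hG_hyp : IsHyperbolic (cayleyGraph S)) (hG_ne : ¬ IsElementary G)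
    (ρ : Measure ℝ≥0) [IsProbabilityMeasure ρ] (hρ_atom : ∀ x : ℝ≥0, ρ {x} = 0)
    (hρ_exp : ∃ a : ℝ, 0 < a ∧ Integrable (fun x : ℝ≥0 => Real.exp (a * x)) ρ) :
    ∃ Ω₀ : Set (Config (cayleyGraph S)),
      MeasurableSet Ω₀ ∧ law (cayleyGraph S) ρ Ω₀ = 1 ∧
      (∀ ω ∈ Ω₀,
        (forwardTree 1 ω).IsTree ∧
        IsProperEmbedding (forwardInclusion 1 ω) 1 ∧
        IsTwoProper (forwardInclusion 1 ω) 1 ∧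
        ∃ F φ, IsCannonThurstonMap (forwardInclusion 1 ω) 1 F ∧
          IsBoundaryValue F φ ∧ Function.Surjective φ) ∧
      ∀ ξ : Boundary (cayleyGraph S),
        (∀ᵐ ω ∂(law (cayleyGraph S) ρ), ω ∈ coalescenceEvent 1 ξ) ∧
        ∀ ω ∈ Ω₀ ∩ coalescenceEvent 1 ξ,
          (backwardTree 1 ξ ω).IsTree ∧
          IsProperEmbedding (backwardInclusion 1 ξ ω) 1 ∧
          IsTwoProper (backwardInclusion 1 ξ ω) 1 ∧
          ∃ F φ, IsCannonThurstonMap (backwardInclusion 1 ξ ω) 1 F ∧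
            IsBoundaryValue F φ ∧ Function.Surjective φ := by
  have hc := hG_hyp.1
  have hD := degreeLE_cayleyGraph S
  obtain ⟨δ, hδ⟩ := hG_hyp.exists_hasDelta
  have hb : ∀ r : ℕ, {v | (cayleyGraph S).dist 1 v ≤ r}.Finite := hD.finite_ball hc 1
  -- No edges are prescribed here, so the values $h=1$ and $H=0$ are immaterial.
  obtain ⟨A, c, hA, hc0⟩ := exists_adapted ρ (hρ_atom 0) hρ_exp _ one_pos 0
  have hreg := ae_exists_regular hD hc hδ hρ_atom hA hc0 1
  -- Regularity at the identity involves no direction, so one measurable null set serves all $\xi$.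
  -- It is enlarged from the set of non-regular configurations, whose measurability is not needed.
  obtain ⟨N, hN, hNm, hN0⟩ := exists_measurable_superset_of_null (ae_iff.1 hreg)
  have hΩ : ∀ ω ∈ Nᶜ, ∃ s₀, Regular ω 1 δ A (c + 0) s₀ := fun ω hω => by
    by_contra hcon
    exact hω (hN hcon)
  refine ⟨Nᶜ, hNm.compl, ?_, fun ω hω => ?_, fun ξ =>
    ⟨ae_mem_coalescenceEvent hD hc hδ hρ_atom hρ_exp 1 ξ, fun ω hω => ?_⟩⟩
  · rw [prob_compl_eq_one_iff hNm]
    exact hN0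
  · obtain ⟨s₀, h⟩ := hΩ ω hω
    obtain ⟨hT, h2⟩ := h.forwardTree_isTree_and_gromovTwoProper
    exact ⟨hT, isProperEmbedding_ofLE hb _, h2.isTwoProper hc _,
      h2.exists_cannonThurstonMap hδ hc hb _ hT.connected⟩
  · obtain ⟨s₀, h⟩ := hΩ ω hω.1
    obtain ⟨hT, h2⟩ := h.backwardTree_isTree_and_gromovTwoProper hω.2
    exact ⟨hT, isProperEmbedding_ofLE hb _, h2.isTwoProper hc _,
      h2.exists_cannonThurstonMap hδ hc hb _ hT.connected⟩
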